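/- **Setting.** Let $\Lambda$ be a finite $d$-dimensional lattice: a finite connected graph with graph distance $\mathrm{dist}$, an increasing real polynomial $b$ of degree $d$ such that every ball of radius $r$ has at most $b(r)$ sites, and a constant $C_d$ such that $|A|\le C_d(l_A+1)^d$ for every nonempty region $A\subseteq\Lambda$, where $l_A$ is the diameter of $A$. Each site carries a finite-dimensional Hilbert space. For an interaction $\Phi=\sum_{A\subseteq\Lambda}\Phi_A$ put $\|\Phi\|_\mu=\max_{j}\sum_{A\ni j}\|\Phi_A\|e^{\mu l_A}$ and $\|\Phi\|_\star=\|\Phi\|_0$. Let $H_0=\sum_{j\in\Lambda}H_{0j}$, where $H_{0j}\ge0$ is supported on a region $R_j\ni j$, the $H_{0j}$ commute and have a common zero-energy state. Let $P_j$ be the projector onto $\ker H_{0j}$ and, for $A\subseteq\Lambda$, let $H_{0A}=\sum_{R_j\cap A\ne\emptyset}H_{0j}$, $P_A=\prod_{R_j\cap A\ne\emptyset}P_j$, $Q_A=1-P_A$, $R_A=\bigcup_{R_j\cap A\neq\emptyset}R_j$, and $P=P_\Lambda$. Assume that $H_0$ is gapped, also locally, with gap $\Delta_0>0$: for every $A\subseteq\Lambda$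 (including $A=\Lambda$, where $H_{0A}=H_0$), $H_{0A}$ has no eigenvalue in $(0,\Delta_0)$. Let $V=\sum_AV_A$ with $V_A$ Hermitian, supported on $A$, and zero unless $A$ is connected and $|A|\le k$. Put $l_0=\max_j l_{R_j}$, $w=\max_j|\bigcup_{R_{j'}\ni j}R_{j'}|$ and $u=\max_{|A|\le k}|R_A|$. Let $\mathscr D_A(M)=P_AMP_A+Q_AMQ_A$ and $\mathscr L_A(M)=\int_0^\infty(e^{-\tau H_{0A}}Q_AMP_A-\mathrm{h.c.})\,d\tau$. The local Schrieffer–Wolff transformation is $e^T$ with $T=\sum_A\mathscr L_A(V_A)$, where $\mathscr L_A(V_A)$ is a term on $R_A$. Let $H_1=H_0+\sum_A\mathscr D_A(V_A)$ and $$V'=\sum_{n\ge1}\frac1{n!}\mathrm{ad}_T^n\Big(\frac{n}{n+1}V+\frac1{n+1}\sum_A\mathscr D_A(V_A)\Big),$$ an interaction in which $\mathscr D_A(V_A)$ is a term on $R_A$ and the commutator of terms on overlapping regions $A$, $B$ is a term on $A\cup B$. Let $O_X$ be Hermitian, supported on a nonempty region $X$, with $\|O_X\|=1$. With $H=H_0+V$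 and $H_P=PHP$, the error is $$\epsilon(t)=\|P(e^{iHt}O_Xe^{-iHt}-e^{iH_Pt}O_Xe^{-iH_Pt})P\|.$$ For $\kappa,\eta>0$ let $$v=\frac{2wC_de^{\eta}}{\kappa}\Big(\frac d{e\eta}\Big)^de^{2(\kappa+\eta)l_0}\|V\|_{\kappa+\eta},\qquad p_\kappa(r)=2(e^\kappa-1)\,b\Big(r-\frac{d}{d\kappa}\Big)(e^\kappa-1)^{-1},$$ $$\tilde p(r)=p_\kappa(r+r_X+l_0+\kappa^{-1}\ln|X|),\qquad \tilde P(r)=\int_0^r\tilde p(r')\,dr',$$ where in $b(r-\frac d{d\kappa})$ the number $r$ is a constant and $r_X$ is the radius of the smallest ball, centred at a site, that contains $X$. The Lieb–Robinson velocity $v$ depends on the strength of $V$ and on the geometry only, not on the strength of $H_0$. (If $V=0$, so that $v=0$, the terms with $v^{-1}$ below are read as $0$.) **Claim.** There is a constant $K\ge0$ depending only on $w$ and $u$ such that, in this setting: 1. $e^THe^{-T}=H_1+V'$. 2. $\|T\|_\star\le w\|V\|_\star/\Delta_0$. 3. For all $t\ge0$: $\epsilon(t)\le[2|X|+\tilde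 p(vt)]\|T\|_\star+v^{-1}\tilde P(vt)\|V'\|_\star$. 4. If $\Delta_0\ge K\|V\|_\star$, then $\|V'\|_\star\le\frac{4wu\|V\|_\star^2}{\Delta_0}\big(1+K\frac{\|V\|_\star}{\Delta_0}\big)$, and for all $t\ge0$ $$\epsilon(t)\le\frac{\|V\|_\star}{\Delta_0}\,w\Big[2|X|+\tilde p(vt)+4uv^{-1}\|V\|_\star\tilde P(vt)\Big(1+K\frac{\|V\|_\star}{\Delta_0}\Big)\Big].$$ 5. $\tilde p$ and $\tilde P$ are polynomials of degree $d$ and $d+1$, and $\frac{\|V\|_\star}{\Delta_0}w[2|X|+\tilde p(vt)+4uv^{-1}\|V\|_\star\tilde P(vt)]=O(t^{d+1})$ as $t\to\infty$. -/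

import Mathlib

open scoped Matrix.Norms.L2Operator ComplexOrder BigOperators

noncomputable section

namespace LocalSW

open Polynomial

/-! ## The lattice -/

/-- A finite `d`-dimensional lattice: a finite connected graph, the distance of two sites being the
minimal number of edges that connect them, whose balls of radius `r` have at most `ballPoly r`
sites, `ballPoly` being an increasing polynomial of degree `d`, and with a geometric constant
`volConst` such that a region of diameter `l` has at most `volConst * (l + 1) ^ d` sites. -/
structure LatticeGeometry (d : ℕ) (Λ : Type*) [Fintype Λ] [DecidableEq Λ] where
  graph : SimpleGraph Λ
  connected : graph.Connected
  ballPoly : ℝ[X]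
  natDegree_ballPoly : ballPoly.natDegree = d
  monotoneOn_ballPoly : MonotoneOn (fun r : ℝ => ballPoly.eval r) (Set.Ici 0)
  card_ball_le : ∀ (x : Λ) (r : ℕ),
    ((Finset.univ.filter (fun y => graph.dist x y ≤ r)).card : ℝ) ≤ ballPoly.eval (r : ℝ)
  volConst : ℝ
  card_le : ∀ A : Finset Λ, A.Nonempty →
    (A.card : ℝ) ≤
      volConst * ((((A ×ˢ A).sup (fun p => graph.dist p.1 p.2) : ℕ) : ℝ) + 1) ^ d

section Lattice

variable {d : ℕ} {Λ : Type*} [Fintype Λ] [DecidableEq Λ]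

/-- The diameter of a region. -/
def LatticeGeometry.diam (L : LatticeGeometry d Λ) (A : Finset Λ) : ℕ :=
  (A ×ˢ A).sup (fun p => L.graph.dist p.1 p.2)

/-- The radius of a region: the least `r` such that a ball of radius `r` around some site of the
lattice contains the region. -/
def LatticeGeometry.radius (L : LatticeGeometry d Λ) (X : Finset Λ) : ℕ :=
  sInf {r : ℕ | ∃ x : Λ, ∀ y ∈ X, L.graph.dist x y ≤ r}

end Lattice

/-! ## Operators and interactions -/

section Operators

variable {Λ : Type*} [Fintype Λ] [DecidableEq Λ]

/-- Operators on the tensor product over the sites `x` of the Hilbert spaces of dimension `q x`, as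
matrices in the product basis. They carry the operator norm. -/
abbrev Op (q : Λ → ℕ) : Type _ := Matrix (∀ x, Fin (q x)) (∀ x, Fin (q x)) ℂ

/-- `M` is supported on `A`: it is `m ⊗ 1` with `m` acting on the sites in `A`. -/
def SupportedOn {q : Λ → ℕ} (A : Finset Λ) (M : Op q) : Prop :=
  ∃ m : Matrix (∀ x : A, Fin (q x)) (∀ x : A, Fin (q x)) ℂ, ∀ i j,
    M i j = if ∀ x, x ∉ A → i x = j x then m (fun x => i x) (fun x => j x) else 0

/-- The orthogonal projector onto the kernel of an operator. -/
def kerProj {q : Λ → ℕ} (M : Op q) : Op q :=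
  (Matrix.toEuclideanCLM (n := ∀ x, Fin (q x)) (𝕜 := ℂ)).symm
    (LinearMap.ker
      (Matrix.toEuclideanCLM (n := ∀ x, Fin (q x)) (𝕜 := ℂ) M).toLinearMap).starProjection

theorem commute_kerProj_right {q : Λ → ℕ} {M N : Op q} (hN : N.IsHermitian) (h : Commute M N) :
    Commute N (kerProj M) := by
  let e := Matrix.toEuclideanCLM (n := ∀ x, Fin (q x)) (𝕜 := ℂ)
  have hc : Commute (e M) (e N) := h.map e
  have hsa : IsSelfAdjoint (e N) := IsSelfAdjoint.map (show IsSelfAdjoint N from hN) e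
  have key : Commute (LinearMap.ker (e M).toLinearMap).starProjection (e N) := by
    have hi := (Submodule.isIdempotentElem_starProjection (LinearMap.ker (e M).toLinearMap))
    rw [ContinuousLinearMap.IsIdempotentElem.commute_iff hi]
    have h1 : ∀ x, e M (e N x) = e N (e M x) := fun x =>
      congrArg (fun f => f x) hc.eq
    refine ⟨?_, ?_⟩
    · rw [Submodule.range_starProjection, Module.End.mem_invtSubmodule]
      intro x hx
      have hx' : e M x = 0 := hx
      show e M (e N x) = 0
      rw [h1, hx', map_zero]
    · rw [Submodule.ker_starProjection, Module.End.mem_invtSubmodule]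
      intro x hx
      show e N x ∈ (LinearMap.ker (e M).toLinearMap)ᗮ
      rw [Submodule.mem_orthogonal] at hx ⊢
      intro u hu
      have hu' : e M u = 0 := hu
      have hs : (ContinuousLinearMap.adjoint (e N)) = e N := hsa
      rw [← ContinuousLinearMap.adjoint_inner_left, hs]
      apply hx
      show e M (e N u) = 0
      rw [h1, hu', map_zero]
  have := key.symm.map e.symm
  simpa [e, kerProj] using this

theorem isHermitian_kerProj {q : Λ → ℕ} (M : Op q) : (kerProj M).IsHermitian := by
  let e := Matrix.toEuclideanCLM (n := ∀ x, Fin (q x)) (𝕜 := ℂ)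
  have h : IsSelfAdjoint (LinearMap.ker (e M).toLinearMap).starProjection :=
    isSelfAdjoint_starProjection _
  show star (kerProj M) = kerProj M
  apply EquivLike.injective e
  rw [map_star e]
  show star (e (e.symm _)) = e (e.symm _)
  rw [StarAlgEquiv.apply_symm_apply]
  exact h

/-- The projectors onto the kernels of two commuting Hermitian operators commute. -/
theorem commute_kerProj {q : Λ → ℕ} {M N : Op q} (hN : N.IsHermitian) (h : Commute M N) :
    Commute (kerProj M) (kerProj N) :=
  commute_kerProj_right (isHermitian_kerProj M) (commute_kerProj_right hN h)

/-- An interaction: a family of operators indexed by the regions of the lattice. -/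
abbrev Interaction (q : Λ → ℕ) : Type _ := Finset Λ → Op q

/-- The sum of all the terms of an interaction. -/
def Interaction.total {q : Λ → ℕ} (Φ : Interaction q) : Op q := ∑ A, Φ A

/-- The commutator of two interactions: the commutator of the terms on overlapping regions `A`, `B`
is a term on `A ∪ B`. -/
def Interaction.comm {q : Λ → ℕ} (Φ Ψ : Interaction q) : Interaction q := fun B =>
  ∑ A, ∑ A', if A ∪ A' = B ∧ (A ∩ A').Nonempty then Φ A * Ψ A' - Ψ A' * Φ A else 0

/-- `max_j ∑_{A ∋ j} ‖Φ_A‖ exp (μ l_A)`. -/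
def interNorm {d : ℕ} {q : Λ → ℕ} (L : LatticeGeometry d Λ) (μ : ℝ) (Φ : Interaction q) : ℝ :=
  ⨆ j : Λ, ∑ A with j ∈ A, ‖Φ A‖ * Real.exp (μ * L.diam A)

/-- The local interaction strength `‖Φ‖⋆ = max_j ∑_{A ∋ j} ‖Φ_A‖`. -/
def starNorm {d : ℕ} {q : Λ → ℕ} (L : LatticeGeometry d Λ) (Φ : Interaction q) : ℝ :=
  interNorm L 0 Φ

/-- `exp (i H t) O exp (-i H t)`. -/
def heisenberg {q : Λ → ℕ} (H O : Op q) (t : ℝ) : Op q :=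
  NormedSpace.exp ((Complex.I * (t : ℂ)) • H) * O * NormedSpace.exp (-(Complex.I * (t : ℂ)) • H)

/-! ## The unperturbed Hamiltonian -/

/-- A commuting frustration-free Hamiltonian `∑ j, term j`: `term j` is positive semidefinite and
supported on a region `region j` that contains `j`, the terms commute, and they have a
common zero-energy state. -/
structure CommutingHamiltonian (q : Λ → ℕ) where
  region : Λ → Finset Λ
  mem_region : ∀ j, j ∈ region j
  term : Λ → Op q
  supportedOn_term : ∀ j, SupportedOn (region j) (term j)
  posSemidef_term : ∀ j, (term j).PosSemidef
  commute_term : ∀ j j', Commute (term j) (term j')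
  frustrationFree : ∃ ψ : (∀ x, Fin (q x)) → ℂ, ψ ≠ 0 ∧ ∀ j, (term j).mulVec ψ = 0

namespace CommutingHamiltonian

variable {q : Λ → ℕ} (H₀ : CommutingHamiltonian q)

/-- The sites `j` such that the region of the `j`th term meets `A`. -/
def meets (A : Finset Λ) : Finset Λ :=
  Finset.univ.filter (fun j => (H₀.region j ∩ A).Nonempty)

/-- `H₀` as an operator. -/
def ham : Op q := ∑ j, H₀.term j

/-- The truncated Hamiltonian `H_{0A}`: the sum of the terms whose regions meet `A`. -/
def trunc (A : Finset Λ) : Op q := ∑ j ∈ H₀.meets A, H₀.term j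

/-- `P_A`: the product of the projectors onto the kernels of the terms whose regions
meet `A`. -/
def proj (A : Finset Λ) : Op q :=
  (H₀.meets A).noncommProd (fun j => kerProj (H₀.term j))
    (fun i _ j _ _ => commute_kerProj (H₀.posSemidef_term j).isHermitian (H₀.commute_term i j))

/-- The projector onto the zero-energy space of `H₀`. -/
def P : Op q := H₀.proj Finset.univ

/-- `R_A`: the union of the regions that meet `A`. -/
def hull (A : Finset Λ) : Finset Λ := (H₀.meets A).biUnion H₀.region

/-- `w = max_j |⋃_{R_{j'} ∋ j} R_{j'}|`. -/
def w : ℕ :=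
  Finset.univ.sup (fun j => ((Finset.univ.filter (fun j' => j ∈ H₀.region j')).biUnion
    H₀.region).card)

/-- The largest diameter of the regions of the terms. -/
def range {d : ℕ} (L : LatticeGeometry d Λ) : ℕ :=
  Finset.univ.sup (fun j => L.diam (H₀.region j))

/-- `u = max_{|A| ≤ k} |R_A|`: the degree of locality of the Schrieffer-Wolff generator for a
`k`-local perturbation. -/
def u (k : ℕ) : ℕ :=
  (Finset.univ.filter (fun A : Finset Λ => A.card ≤ k)).sup (fun A => (H₀.hull A).card)

/-- `H₀` is gapped with gap (at least) `Δ`, also locally: every truncated Hamiltonian `H_{0A}`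
(for `A` the whole lattice this is `H₀`) has no spectrum in the open interval `(0, Δ)`. -/
def HasGap (Δ : ℝ) : Prop :=
  0 < Δ ∧ ∀ A : Finset Λ, ∀ E ∈ spectrum ℝ (H₀.trunc A), E = 0 ∨ Δ ≤ E

end CommutingHamiltonian

/-! ## The perturbation and the local Schrieffer-Wolff transformation -/

/-- A `k`-local perturbation: the term on `A` is Hermitian, supported on `A`, and it vanishes if `A`
is not connected or has more than `k` sites. -/
structure LocalPerturbation {d : ℕ} (L : LatticeGeometry d Λ) (q : Λ → ℕ) (k : ℕ) where
  term : Interaction q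
  isHermitian_term : ∀ A, (term A).IsHermitian
  supportedOn_term : ∀ A, SupportedOn A (term A)
  term_eq_zero_of_not_connected : ∀ A : Finset Λ,
    ¬ (L.graph.induce (A : Set Λ)).Connected → term A = 0
  term_eq_zero_of_card : ∀ A : Finset Λ, k < A.card → term A = 0

section SchriefferWolff

variable {d : ℕ} {q : Λ → ℕ} (L : LatticeGeometry d Λ) (H₀ : CommutingHamiltonian q)

/-- `𝓛_A(M) = ∫_0^∞ (exp (-τ H_{0A}) Q_A M P_A - h.c.) dτ`. -/
def localGen (A : Finset Λ) (M : Op q) : Op q :=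
  ∫ τ in Set.Ioi (0 : ℝ),
    (NormedSpace.exp (-(τ : ℂ) • H₀.trunc A) * (1 - H₀.proj A) * M * H₀.proj A -
      (NormedSpace.exp (-(τ : ℂ) • H₀.trunc A) * (1 - H₀.proj A) * M * H₀.proj A).conjTranspose)

/-- `𝓓_A(M) = P_A M P_A + Q_A M Q_A`. -/
def localDiag (A : Finset Λ) (M : Op q) : Op q :=
  H₀.proj A * M * H₀.proj A + (1 - H₀.proj A) * M * (1 - H₀.proj A)

/-- The generator `T = ∑_A 𝓛_A(V_A)` as an interaction; `𝓛_A(V_A)` is a term on `R_A`. -/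
def swGen (V : Interaction q) : Interaction q := fun B =>
  ∑ A with H₀.hull A = B, localGen H₀ A (V A)

/-- `∑_A 𝓓_A(V_A)` as an interaction; `𝓓_A(V_A)` is a term on `R_A`. -/
def diagInter (V : Interaction q) : Interaction q := fun B =>
  ∑ A with H₀.hull A = B, localDiag H₀ A (V A)

/-- The block-diagonal Hamiltonian `H₁ = H₀ + ∑_A 𝓓_A(V_A)`. -/
def blockHam (V : Interaction q) : Op q := H₀.ham + ∑ A, localDiag H₀ A (V A)

/-- `V - (n + 1)⁻¹ ∑_A (V_A - 𝓓_A(V_A))` as an interaction,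
namely `n / (n + 1)` times `V` plus `1 / (n + 1)` times `∑_A 𝓓_A(V_A)`. -/
def mixedInter (V : Interaction q) (n : ℕ) : Interaction q := fun B =>
  ((n : ℂ) / ((n : ℂ) + 1)) • V B + (1 / ((n : ℂ) + 1)) • diagInter H₀ V B

/-- The residual interaction
`V' = ∑_{n ≥ 1} (1 / n!) ad_T ^ n (V - (n + 1)⁻¹ ∑_A (V_A - 𝓓_A(V_A)))`. -/
def residualInter (V : Interaction q) : Interaction q := fun B =>
  ∑' n : ℕ, (((n + 1).factorial : ℂ)⁻¹) •
    ((Interaction.comm (swGen H₀ V))^[n + 1] (mixedInter H₀ V (n + 1))) B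

/-- The error of the constrained dynamics,
`‖P (exp (i H t) O exp (-i H t) - exp (i H_P t) O exp (-i H_P t)) P‖`, where `H = H₀ + V` and
`H_P = P H P`. -/
def swError (V : Interaction q) (O : Op q) (t : ℝ) : ℝ :=
  ‖H₀.P * (heisenberg (H₀.ham + V.total) O t -
    heisenberg (H₀.P * (H₀.ham + V.total) * H₀.P) O t) * H₀.P‖

/-! ## The constants of the bound -/

/-- The Lieb-Robinson velocity. -/
def velocity (V : Interaction q) (κ η : ℝ) : ℝ :=
  2 * H₀.w * L.volConst * Real.exp η / κ * ((d : ℝ) / (Real.exp 1 * η)) ^ d *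
    Real.exp (2 * (κ + η) * H₀.range L) * interNorm L (κ + η) V

/-- `p_κ(r) = 2 (e ^ κ - 1) b(r - d/dκ) (e ^ κ - 1)⁻¹`: the operator `r - d/dκ` is substituted into
the polynomial `b`, and the result is applied to the function `κ ↦ (e ^ κ - 1)⁻¹`. -/
def pKappa (b : ℝ[X]) (κ r : ℝ) : ℝ :=
  2 * (Real.exp κ - 1) * ∑ m ∈ Finset.range (b.natDegree + 1), b.coeff m *
    ((fun (f : ℝ → ℝ) (s : ℝ) => r * f s - deriv f s)^[m] (fun s => (Real.exp s - 1)⁻¹)) κ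

/-- `p̃(r) = p_κ(r + r_X + l₀ + κ⁻¹ log |X|)`. -/
def pTilde (X : Finset Λ) (κ r : ℝ) : ℝ :=
  pKappa L.ballPoly κ (r + L.radius X + H₀.range L + κ⁻¹ * Real.log X.card)

/-- `P̃(r) = ∫_0^r p̃`. -/
def PTilde (X : Finset Λ) (κ r : ℝ) : ℝ := ∫ s in (0 : ℝ)..r, pTilde L H₀ X κ s

end SchriefferWolff

end Operators

end LocalSW

end

open LocalSW Polynomial

/-! On the zero-energy space `P` the block-diagonal Hamiltonian `H₁` acts exactly as `P H P`:
writing `P = P_A R` with `R` commuting with everything on `A`, both `P 𝓓_A(V_A)` and `𝓓_A(V_A) P`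
equal `P V_A P`. The error is therefore at most the difference of the Heisenberg evolutions under
`H` and `H₁` (`swError_le_norm_sub`), and the whole task is to compare these two.

The gap makes the integral `𝓛_A` converge to an expression in the pseudo-inverse of `H_{0A}`, whose
norm is at most `1/Δ`. This yields `[H₀, 𝓛_A(V_A)] = V_A - 𝓓_A(V_A)`, because the terms of `H₀` that
do not meet `A` drop out. Thus `[T, H₀]` turns `V` into its block-diagonal part, and re-indexing the
series of `exp(ad_T)` leaves exactly `V'` (`exp_swGen_conj`). Since `T` is anti-Hermitian, `e^T` is
unitary. In the rotated frame the difference of evolutions splits into dressing `O` at time `0`,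
dressing the evolved `O` at time `t`, and a Duhamel integral of the commutator of the evolved `O`
with `V'` (`norm_heisenberg_sub_le_of_conj`). The first piece costs `2|X|‖T‖⋆`; the other two need a
Lieb-Robinson bound for `H₁`.

That bound (`lieb_robinson`) is insensitive to the strength of `H₀`: commuting terms spread an
operator on `A` at most to its hull, however strong they are, so in the interaction picture only the
terms `𝓓_A(V_A)` drive the growth. An exponential site weight turns the iteration into growth at
rate `κ v`. Sites near `X` then count fully and the others with exponential weight; summing this
profile against the ball volumes `b` gives `p̃`, by the series `2(e^κ - 1) ∑_{n≥1} b(r+n) e^{-κn}`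
for `p_κ(r)`.

For the size of `V'`, the first commutator gives the constant `4wu`. In the later ones the regions
grow linearly with the order, so the norms grow like `(n+1)!`; the factor `1/n!` leaves a series of
ratio at most `1/2` once `Δ₀ ≥ K‖V‖⋆` (`starNorm_residualInter_le`). -/

namespace LocalSW

open Polynomial

/-! ### Supports of operators as commutants -/

section Support

variable {Λ : Type*} [Fintype Λ] [DecidableEq Λ] {q : Λ → ℕ}

/-- Operators supported on disjoint regions commute. -/
theorem SupportedOn.commute {A B : Finset Λ} {M N : Op q} (hM : SupportedOn A M)
    (hN : SupportedOn B N) (h : Disjoint A B) : Commute M N := by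
  obtain ⟨m, hm⟩ := hM
  obtain ⟨n, hn⟩ := hN
  ext i j
  rw [Matrix.mul_apply, Matrix.mul_apply,
    Finset.sum_eq_single (A.piecewise j i), Finset.sum_eq_single (A.piecewise i j)]
  · rw [hm, hm, hn, hn]
    have e1 : (fun x : B => A.piecewise j i x) = fun x : B => i x := by
      ext x
      rw [Finset.piecewise_eq_of_notMem _ _ _ (Finset.disjoint_right.1 h x.2)]
    have e2 : (fun x : B => A.piecewise i j x) = fun x : B => j x := by
      ext x
      rw [Finset.piecewise_eq_of_notMem _ _ _ (Finset.disjoint_right.1 h x.2)]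
    have e3 : (fun x : A => A.piecewise j i x) = fun x : A => j x := by
      ext x
      rw [Finset.piecewise_eq_of_mem _ _ _ x.2]
    have e4 : (fun x : A => A.piecewise i j x) = fun x : A => i x := by
      ext x
      rw [Finset.piecewise_eq_of_mem _ _ _ x.2]
    have c1 : ∀ x, x ∉ A → i x = A.piecewise j i x := fun x hx => by
      rw [Finset.piecewise_eq_of_notMem _ _ _ hx]
    have c2 : ∀ x, x ∉ A → A.piecewise i j x = j x := fun x hx => by
      rw [Finset.piecewise_eq_of_notMem _ _ _ hx]
    have c3 : (∀ x, x ∉ B → A.piecewise j i x = j x) ↔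
        ∀ x, x ∉ B → i x = A.piecewise i j x := by
      refine forall_congr' fun x => imp_congr_right fun _ => ?_
      by_cases hx : x ∈ A <;> simp [hx]
    rw [e1, e2, e3, e4, if_pos c1, if_pos c2]
    by_cases hc : ∀ x, x ∉ B → i x = A.piecewise i j x
    · rw [if_pos hc, if_pos (c3.2 hc), mul_comm]
    · rw [if_neg hc, if_neg (fun h => hc (c3.1 h)), mul_zero, zero_mul]
  · intro k _ hk
    by_contra hne
    apply hk
    rw [hn, hm] at hne
    have h1 : ∀ x, x ∉ B → i x = k x := by by_contra hc; simp [hc] at hne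
    have h2 : ∀ x, x ∉ A → k x = j x := by by_contra hc; simp [hc] at hne
    ext x
    by_cases hx : x ∈ A
    · rw [Finset.piecewise_eq_of_mem _ _ _ hx, h1 x (Finset.disjoint_left.1 h hx)]
    · rw [Finset.piecewise_eq_of_notMem _ _ _ hx, h2 x hx]
  · simp
  · intro k _ hk
    by_contra hne
    apply hk
    rw [hn, hm] at hne
    have h1 : ∀ x, x ∉ A → i x = k x := by by_contra hc; simp [hc] at hne
    have h2 : ∀ x, x ∉ B → k x = j x := by by_contra hc; simp [hc] at hne
    ext x
    by_cases hx : x ∈ A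
    · rw [Finset.piecewise_eq_of_mem _ _ _ hx, h2 x (Finset.disjoint_left.1 h hx)]
    · rw [Finset.piecewise_eq_of_notMem _ _ _ hx, h1 x hx]
  · simp

/-- The operator `|c⟩⟨c'|` on the sites outside `A`, times the identity on `A`. -/
def outerUnit (q : Λ → ℕ) (A : Finset Λ) (c c' : ∀ x, Fin (q x)) : Op q := fun i j =>
  if i = A.piecewise j c ∧ j = A.piecewise j c' then 1 else 0

theorem supportedOn_outerUnit (A : Finset Λ) (c c' : ∀ x, Fin (q x)) :
    SupportedOn Aᶜ (outerUnit q A c c') := by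
  refine ⟨fun a b => if (a = fun x : (Aᶜ : Finset Λ) => c x) ∧
    (b = fun x : (Aᶜ : Finset Λ) => c' x) then 1 else 0, fun i j => ?_⟩
  simp only [outerUnit]
  rw [← ite_and]
  refine if_congr ?_ rfl rfl
  simp only [funext_iff, Finset.mem_compl, not_not, Subtype.forall]
  constructor
  · rintro ⟨h1, h2⟩
    refine ⟨fun x hx => ?_, fun x hx => ?_, fun x hx => ?_⟩
    · rw [h1, Finset.piecewise_eq_of_mem _ _ _ hx]
    · rw [h1, Finset.piecewise_eq_of_notMem _ _ _ hx]
    · rw [h2, Finset.piecewise_eq_of_notMem _ _ _ hx]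
  · rintro ⟨h1, h2, h3⟩
    refine ⟨fun x => ?_, fun x => ?_⟩ <;> by_cases hx : x ∈ A
    · rw [Finset.piecewise_eq_of_mem _ _ _ hx, h1 x hx]
    · rw [Finset.piecewise_eq_of_notMem _ _ _ hx, h2 x hx]
    · rw [Finset.piecewise_eq_of_mem _ _ _ hx]
    · rw [Finset.piecewise_eq_of_notMem _ _ _ hx, h3 x hx]

/-- The operators supported on `A` are the commutant of those supported on the complement. -/
theorem supportedOn_iff_commute {A : Finset Λ} {M : Op q} :
    SupportedOn A M ↔ ∀ N : Op q, SupportedOn Aᶜ N → Commute M N := by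
  refine ⟨fun hM N hN => hM.commute hN disjoint_compl_right, fun h => ?_⟩
  -- This compares the `(i, j)` entries of the two products with the outer matrix unit `|c⟩⟨j|`;
  -- each product has a single nonzero summand.
  have key : ∀ i j c : ∀ x, Fin (q x), M i (A.piecewise j c) =
      if i = A.piecewise i c then M (A.piecewise i j) j else 0 := by
    intro i j c
    have h0 := congrFun (congrFun (h _ (supportedOn_outerUnit A c j)).eq i) j
    rw [Matrix.mul_apply, Matrix.mul_apply, Finset.sum_eq_single (A.piecewise j c),
      Finset.sum_eq_single (A.piecewise i j)] at h0
    · simp only [outerUnit, Finset.piecewise_same, Finset.piecewise_idem_left] at h0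
      simpa [ite_mul] using h0
    · intro k _ hk
      simp only [outerUnit]
      rw [if_neg, zero_mul]
      rintro ⟨h1, h2⟩
      apply hk
      rw [h2, h1]
      ext x
      by_cases hx : x ∈ A <;> simp [hx]
    · simp
    · intro k _ hk
      simp only [outerUnit]
      rw [if_neg (fun h => hk h.1), mul_zero]
    · simp
  -- The block `m` is read off from `M` with the sites outside `A` frozen in a reference
  -- configuration `r`. If there is no configuration at all, any `m` will do.
  rcases isEmpty_or_nonempty (∀ x, Fin (q x)) with he | ⟨⟨r⟩⟩
  · exact ⟨0, fun i => (he.false i).elim⟩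
  refine ⟨fun a b => M (fun x => if hx : x ∈ A then a ⟨x, hx⟩ else r x)
    (fun x => if hx : x ∈ A then b ⟨x, hx⟩ else r x), fun i j => ?_⟩
  have hp : ∀ i : ∀ x, Fin (q x), (fun x => if x ∈ A then i x else r x) = A.piecewise i r := by
    intro i
    ext x
    by_cases hx : x ∈ A <;> simp [hx]
  simp only [dite_eq_ite, hp]
  split_ifs with hij
  · have e := key (A.piecewise i r) j r
    simp only [Finset.piecewise_idem_left, if_true] at e
    rw [e]
    congr 2
    ext x
    by_cases hx : x ∈ A <;> simp [hx, hij x]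
  · have e := key i j j
    rw [Finset.piecewise_same, if_neg] at e
    · exact e
    · intro h2
      exact hij fun x hx => by
        rw [h2, Finset.piecewise_eq_of_notMem _ _ _ hx]

namespace SupportedOn

variable {A B : Finset Λ} {M N : Op q}

theorem mono (hM : SupportedOn A M) (h : A ⊆ B) : SupportedOn B M :=
  supportedOn_iff_commute.2 fun _ hN => hM.commute hN (disjoint_compl_right.mono_left h)

theorem add (hM : SupportedOn A M) (hN : SupportedOn A N) : SupportedOn A (M + N) :=
  supportedOn_iff_commute.2 fun R hR =>
    (supportedOn_iff_commute.1 hM R hR).add_left (supportedOn_iff_commute.1 hN R hR)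

theorem mul (hM : SupportedOn A M) (hN : SupportedOn A N) : SupportedOn A (M * N) :=
  supportedOn_iff_commute.2 fun R hR =>
    (supportedOn_iff_commute.1 hM R hR).mul_left (supportedOn_iff_commute.1 hN R hR)

theorem smul (c : ℂ) (hM : SupportedOn A M) : SupportedOn A (c • M) :=
  supportedOn_iff_commute.2 fun R hR => (supportedOn_iff_commute.1 hM R hR).smul_left c

theorem neg (hM : SupportedOn A M) : SupportedOn A (-M) :=
  supportedOn_iff_commute.2 fun R hR => (supportedOn_iff_commute.1 hM R hR).neg_left

theorem sub (hM : SupportedOn A M) (hN : SupportedOn A N) : SupportedOn A (M - N) := by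
  rw [sub_eq_add_neg]
  exact hM.add hN.neg

theorem zero : SupportedOn A (0 : Op q) :=
  supportedOn_iff_commute.2 fun R _ => Commute.zero_left R

theorem one : SupportedOn A (1 : Op q) :=
  supportedOn_iff_commute.2 fun R _ => Commute.one_left R

theorem sum {ι : Type*} {s : Finset ι} {f : ι → Op q} (h : ∀ i ∈ s, SupportedOn A (f i)) :
    SupportedOn A (∑ i ∈ s, f i) :=
  supportedOn_iff_commute.2 fun R hR =>
    Commute.sum_left _ _ _ fun i hi => supportedOn_iff_commute.1 (h i hi) R hR

theorem conjTranspose (hM : SupportedOn A M) : SupportedOn A M.conjTranspose := by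
  obtain ⟨m, hm⟩ := hM
  refine ⟨m.conjTranspose, fun i j => ?_⟩
  rw [Matrix.conjTranspose_apply, hm]
  simp only [eq_comm (a := i _)]
  split_ifs <;> simp

theorem exp (hM : SupportedOn A M) : SupportedOn A (NormedSpace.exp M) :=
  supportedOn_iff_commute.2 fun R hR => (supportedOn_iff_commute.1 hM R hR).exp_left

theorem tsum {f : ℕ → Op q} (h : ∀ i, SupportedOn A (f i)) : SupportedOn A (∑' i, f i) := by
  by_cases hs : Summable f
  · refine supportedOn_iff_commute.2 fun R hR => ?_
    exact Commute.tsum_left R fun i => supportedOn_iff_commute.1 (h i) R hR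
  · rw [tsum_eq_zero_of_not_summable hs]
    exact zero

/-- `commute_kerProj_right` requires a Hermitian partner, so an operator `R` on the complement is
split into its Hermitian and anti-Hermitian parts, which live on the complement as well. -/
theorem kerProj (hM : SupportedOn A M) : SupportedOn A (kerProj M) := by
  refine supportedOn_iff_commute.2 fun R hR => ?_
  have h1 : Commute (LocalSW.kerProj M) ((1 / 2 : ℂ) • (R + R.conjTranspose)) := by
    refine (commute_kerProj_right ?_
      (supportedOn_iff_commute.1 hM _ ((hR.add hR.conjTranspose).smul _))).symm
    rw [Matrix.IsHermitian, Matrix.conjTranspose_smul, Matrix.conjTranspose_add,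
      Matrix.conjTranspose_conjTranspose, add_comm]
    simp
  have h2 : Commute (LocalSW.kerProj M) ((Complex.I / 2 : ℂ) • (R - R.conjTranspose)) := by
    refine (commute_kerProj_right ?_
      (supportedOn_iff_commute.1 hM _ ((hR.sub hR.conjTranspose).smul _))).symm
    rw [Matrix.IsHermitian, Matrix.conjTranspose_smul, Matrix.conjTranspose_sub,
      Matrix.conjTranspose_conjTranspose, ← neg_sub, smul_neg, ← neg_smul]
    simp [neg_div]
  have h3 := h1.add_right (h2.smul_right (-Complex.I))
  have e : R = (1 / 2 : ℂ) • (R + R.conjTranspose) +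
      -Complex.I • (Complex.I / 2 : ℂ) • (R - R.conjTranspose) := by
    rw [smul_smul, show -Complex.I * (Complex.I / 2) = 1 / 2 by
      rw [mul_div, neg_mul, Complex.I_mul_I, neg_neg], ← smul_add, add_add_sub_cancel,
      ← two_smul ℂ, smul_smul]
    norm_num
  rw [e]
  exact h3

theorem heisenberg {O : Op q} (hM : SupportedOn A M) (hO : SupportedOn A O) (t : ℝ) :
    SupportedOn A (heisenberg M O t) :=
  ((hM.smul _).exp.mul hO).mul (hM.smul _).exp

end SupportedOn

theorem supportedOn_univ (M : Op q) : SupportedOn Finset.univ M :=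
  ⟨fun a b => M (fun x => a ⟨x, Finset.mem_univ x⟩) (fun x => b ⟨x, Finset.mem_univ x⟩),
    fun i j => by simp⟩

end Support

/-! ### Kernel projectors, pseudo-inverses and the gap integral -/

section KernelProjection

variable {Λ : Type*} [Fintype Λ] [DecidableEq Λ] {q : Λ → ℕ}

theorem kerProj_mul_self (M : Op q) : kerProj M * kerProj M = kerProj M := by
  have h := (Submodule.isIdempotentElem_starProjection (LinearMap.ker
    (Matrix.toEuclideanCLM (n := ∀ x, Fin (q x)) (𝕜 := ℂ) M).toLinearMap)).eq
  rw [kerProj, ← map_mul, h]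

theorem mul_kerProj (M : Op q) : M * kerProj M = 0 := by
  apply EquivLike.injective (Matrix.toEuclideanCLM (n := ∀ x, Fin (q x)) (𝕜 := ℂ))
  rw [map_mul, map_zero, kerProj, StarAlgEquiv.apply_symm_apply]
  ext1 x
  exact Submodule.starProjection_apply_mem (LinearMap.ker
    (Matrix.toEuclideanCLM (n := ∀ x, Fin (q x)) (𝕜 := ℂ) M).toLinearMap) x

theorem kerProj_mul_of_mul_eq_zero {M N : Op q} (h : M * N = 0) : kerProj M * N = N := by
  apply EquivLike.injective (Matrix.toEuclideanCLM (n := ∀ x, Fin (q x)) (𝕜 := ℂ))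
  rw [map_mul, kerProj, StarAlgEquiv.apply_symm_apply]
  ext1 x
  refine Submodule.starProjection_eq_self_iff.2 ?_
  have h' := congrArg (Matrix.toEuclideanCLM (n := ∀ x, Fin (q x)) (𝕜 := ℂ)) h
  rw [map_mul, map_zero] at h'
  exact congrArg (fun f => f x) h'

theorem kerProj_mul {M : Op q} (hM : M.IsHermitian) : kerProj M * M = 0 := by
  have h := congrArg Matrix.conjTranspose (mul_kerProj M)
  rwa [Matrix.conjTranspose_mul, (isHermitian_kerProj M).eq, hM.eq, Matrix.conjTranspose_zero] at h

theorem norm_le_one_of_isHermitian_of_mul_self {P : Op q} (h : P.IsHermitian) (h2 : P * P = P) :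
    ‖P‖ ≤ 1 := by
  have e : ‖P‖ * ‖P‖ = ‖P‖ := by
    rw [← CStarRing.norm_star_mul_self, show star P = P from h, h2]
  nlinarith [norm_nonneg P, sq_nonneg (‖P‖ - 1)]

theorem norm_kerProj_le (M : Op q) : ‖kerProj M‖ ≤ 1 :=
  norm_le_one_of_isHermitian_of_mul_self (isHermitian_kerProj M) (kerProj_mul_self M)

/-- The inverse of a Hermitian operator on the orthogonal complement of its kernel, extended by zero
to the kernel. -/
noncomputable def pinv (H : Op q) : Op q := cfc (fun x : ℝ => x⁻¹) H

variable {H : Op q}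

theorem continuousOn_spectrum (f : ℝ → ℝ) : ContinuousOn f (spectrum ℝ H) :=
  Matrix.finite_real_spectrum.continuousOn f

theorem isHermitian_pinv (H : Op q) : (pinv H).IsHermitian :=
  show IsSelfAdjoint (pinv H) from cfc_predicate _ _

theorem mul_pinv_eq_cfc (hH : H.IsHermitian) : H * pinv H = cfc (fun x : ℝ => x * x⁻¹) H := by
  rw [cfc_mul _ _ H (continuousOn_spectrum _) (continuousOn_spectrum _),
    cfc_id' ℝ H (show IsSelfAdjoint H from hH), pinv]

theorem commute_pinv (H : Op q) : Commute H (pinv H) := by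
  by_cases hH : IsSelfAdjoint H
  · have := cfc_commute_cfc (fun x : ℝ => x) (fun x : ℝ => x⁻¹) H
    rwa [cfc_id' ℝ H (show IsSelfAdjoint H from hH)] at this
  · rw [pinv, cfc_apply_of_not_predicate H hH]
    exact Commute.zero_right H

theorem pinv_mul_kerProj (hH : H.IsHermitian) : pinv H * kerProj H = 0 := by
  -- The scalar identity `x⁻¹ = x⁻¹ * x⁻¹ * x` also holds at `0`, by the convention `0⁻¹ = 0`.
  have e : pinv H = pinv H * pinv H * H := by
    conv_rhs => rw [← cfc_id' ℝ H (show IsSelfAdjoint H from hH), pinv]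
    rw [cfc_id' ℝ H (show IsSelfAdjoint H from hH),
      ← cfc_mul _ _ H (continuousOn_spectrum _) (continuousOn_spectrum _)]
    conv_rhs => rhs; rw [← cfc_id' ℝ H (show IsSelfAdjoint H from hH)]
    rw [← cfc_mul _ _ H (continuousOn_spectrum _) (continuousOn_spectrum _), pinv]
    refine cfc_congr fun x _ => ?_
    by_cases hx : x = 0 <;> simp [hx]
  rw [e, mul_assoc, mul_kerProj, mul_zero]

theorem kerProj_mul_pinv (hH : H.IsHermitian) : kerProj H * pinv H = 0 := by
  have h := congrArg Matrix.conjTranspose (pinv_mul_kerProj hH)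
  rwa [Matrix.conjTranspose_mul, (isHermitian_kerProj H).eq, (isHermitian_pinv H).eq,
    Matrix.conjTranspose_zero] at h

/-- `H` annihilates `1 - H * pinv H`, so the kernel projector fixes that operator; it also
annihilates `H * pinv H`, hence the operator is the projector itself. -/
theorem mul_pinv (hH : H.IsHermitian) : H * pinv H = 1 - kerProj H := by
  have h1 : H * (1 - H * pinv H) = 0 := by
    rw [mul_sub, mul_one, mul_pinv_eq_cfc hH, sub_eq_zero]
    conv_rhs => lhs; rw [← cfc_id' ℝ H (show IsSelfAdjoint H from hH)]
    rw [← cfc_mul _ _ H (continuousOn_spectrum _) (continuousOn_spectrum _)]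
    conv_lhs => rw [← cfc_id' ℝ H (show IsSelfAdjoint H from hH)]
    refine cfc_congr fun x _ => ?_
    by_cases hx : x = 0 <;> simp [hx]
  have h2 := kerProj_mul_of_mul_eq_zero h1
  rw [mul_sub, mul_one, ← mul_assoc, kerProj_mul hH, zero_mul, sub_zero] at h2
  rw [h2, sub_sub_cancel]

theorem norm_pinv_le (Δ : ℝ) (hΔ : 0 < Δ)
    (hgap : ∀ E ∈ spectrum ℝ H, E = 0 ∨ Δ ≤ E) : ‖pinv H‖ ≤ 1 / Δ := by
  refine norm_cfc_le (by positivity) fun x hx => ?_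
  rcases hgap x hx with rfl | h
  · simp [hΔ.le]
  · rw [Real.norm_eq_abs, abs_of_pos (inv_pos.2 (hΔ.trans_le h)), one_div]
    exact inv_anti₀ hΔ h

theorem norm_exp_neg_mul_le (hH : H.IsHermitian) (Δ : ℝ)
    (hgap : ∀ E ∈ spectrum ℝ H, E = 0 ∨ Δ ≤ E) (τ : ℝ) (hτ : 0 ≤ τ) :
    ‖NormedSpace.exp (-(τ : ℂ) • H) * (1 - kerProj H)‖ ≤ Real.exp (-Δ * τ) := by
  have e1 : -(τ : ℂ) • H = cfc (fun x : ℝ => -τ * x) H := by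
    rw [cfc_const_mul (-τ) (fun x => x) H (continuousOn_spectrum _),
      cfc_id' ℝ H (show IsSelfAdjoint H from hH),
      ← Complex.ofReal_neg, Complex.coe_smul]
  have e2 : NormedSpace.exp (-(τ : ℂ) • H) = cfc (fun x : ℝ => Real.exp (-τ * x)) H := by
    rw [e1, ← CFC.real_exp_eq_normedSpace_exp (cfc_predicate _ _), ← cfc_comp' _ _ H]
  rw [e2, ← mul_pinv hH, mul_pinv_eq_cfc hH,
    ← cfc_mul _ _ H (continuousOn_spectrum _) (continuousOn_spectrum _)]
  refine norm_cfc_le (by positivity) fun x hx => ?_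
  rcases hgap x hx with rfl | h
  · simp [Real.exp_nonneg]
  · by_cases h0 : x = 0
    · simp [h0, Real.exp_nonneg]
    · rw [mul_inv_cancel₀ h0, mul_one, Real.norm_eq_abs, Real.abs_exp, Real.exp_le_exp]
      nlinarith

/-- Since `1 - kerProj H = H * pinv H`, the integrand has an explicit antiderivative: minus `e^{-τH}
pinv(H) M kerProj(H)` made anti-Hermitian by subtracting its adjoint. The gap gives the decay
`e^{-Δτ}` that makes the integral converge and removes the boundary term at infinity. -/
theorem integral_exp_neg_mul (hH : H.IsHermitian) (Δ : ℝ) (hΔ : 0 < Δ)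
    (hgap : ∀ E ∈ spectrum ℝ H, E = 0 ∨ Δ ≤ E) (M : Op q) :
    (∫ τ in Set.Ioi (0 : ℝ),
      (NormedSpace.exp (-(τ : ℂ) • H) * (1 - kerProj H) * M * kerProj H -
        (NormedSpace.exp (-(τ : ℂ) • H) * (1 - kerProj H) * M * kerProj H).conjTranspose)) =
      pinv H * M * kerProj H - kerProj H * M.conjTranspose * pinv H := by
  have hs : ∀ τ : ℝ, -(τ : ℂ) • H = τ • (-H) := fun τ => by
    rw [← Complex.ofReal_neg, Complex.coe_smul, neg_smul, smul_neg]
  have hd : ∀ N : Op q, ∀ τ : ℝ, HasDerivAt (fun τ : ℝ => NormedSpace.exp (-(τ : ℂ) • H) * N)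
      (NormedSpace.exp (-(τ : ℂ) • H) * -H * N) τ := by
    intro N τ
    simp only [hs]
    exact (hasDerivAt_exp_smul_const (𝕂 := ℝ) (-H) τ).mul_const N
  have hcont : ∀ N : Op q, Continuous fun τ : ℝ => NormedSpace.exp (-(τ : ℂ) • H) * N := fun N =>
    continuous_iff_continuousAt.2 fun τ => (hd N τ).continuousAt
  have hstar : ∀ f : ℝ → Op q, Continuous f → Continuous fun τ => (f τ).conjTranspose :=
    fun f hf => continuous_star.comp hf
  have hF : ∀ τ : ℝ, NormedSpace.exp (-(τ : ℂ) • H) * (1 - kerProj H) * M * kerProj H =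
      -(NormedSpace.exp (-(τ : ℂ) • H) * -H * (pinv H * M * kerProj H)) := by
    intro τ
    rw [← mul_pinv hH]
    noncomm_ring
  let Φ : ℝ → Op q := fun τ => -(NormedSpace.exp (-(τ : ℂ) • H) * (pinv H * M * kerProj H) -
    (NormedSpace.exp (-(τ : ℂ) • H) * (pinv H * M * kerProj H)).conjTranspose)
  have hΦ : ∀ τ : ℝ, HasDerivAt Φ
      (NormedSpace.exp (-(τ : ℂ) • H) * (1 - kerProj H) * M * kerProj H -
        (NormedSpace.exp (-(τ : ℂ) • H) * (1 - kerProj H) * M * kerProj H).conjTranspose) τ := by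
    intro τ
    have h1 := hd (pinv H * M * kerProj H) τ
    refine (h1.sub h1.star).neg.congr_deriv ?_
    rw [hF, Matrix.conjTranspose_neg, Matrix.star_eq_conjTranspose]
    abel
  have hnormstar : ∀ X : Op q, ‖X.conjTranspose‖ = ‖X‖ := fun X => norm_star X
  have hexp : Filter.Tendsto (fun τ : ℝ => Real.exp (-Δ * τ)) Filter.atTop (nhds 0) :=
    Real.tendsto_exp_atBot.comp (Filter.tendsto_id.const_mul_atTop_of_neg (by linarith))
  rw [MeasureTheory.integral_Ioi_of_hasDerivAt_of_tendsto (f := Φ) (m := 0)]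
  · simp only [Φ, Complex.ofReal_zero, neg_zero, zero_smul, NormedSpace.exp_zero, one_mul, zero_sub,
      neg_neg, Matrix.conjTranspose_mul, Matrix.conjTranspose_one, mul_one,
      (isHermitian_kerProj H).eq, (isHermitian_pinv H).eq,
      mul_assoc]
  · exact (hΦ 0).continuousAt.continuousWithinAt
  · exact fun τ _ => hΦ τ
  · refine MeasureTheory.Integrable.mono'
      ((exp_neg_integrableOn_Ioi 0 hΔ).mul_const (2 * ‖M‖)) ?_ ?_
    · refine Continuous.aestronglyMeasurable ?_
      have hc := hcont ((1 - kerProj H) * M * kerProj H)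
      simp only [← mul_assoc] at hc
      exact hc.sub (hstar _ hc)
    · refine (MeasureTheory.ae_restrict_iff' measurableSet_Ioi).2 (Filter.Eventually.of_forall ?_)
      intro τ hτ
      refine (norm_sub_le _ _).trans ?_
      rw [hnormstar, ← two_mul]
      have h1 := norm_exp_neg_mul_le hH Δ hgap τ (le_of_lt hτ)
      have h2 : ‖NormedSpace.exp (-(τ : ℂ) • H) * (1 - kerProj H) * M * kerProj H‖ ≤
          Real.exp (-Δ * τ) * ‖M‖ * 1 :=
        (norm_mul_le _ _).trans (mul_le_mul ((norm_mul_le _ _).trans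
          (mul_le_mul_of_nonneg_right h1 (norm_nonneg _))) (norm_kerProj_le H) (norm_nonneg _)
          (by positivity))
      linarith
  · have hlim : Filter.Tendsto (fun τ : ℝ => NormedSpace.exp (-(τ : ℂ) • H) *
        (pinv H * M * kerProj H)) Filter.atTop (nhds 0) := by
      refine squeeze_zero_norm' (a := fun τ => Real.exp (-Δ * τ) * ‖pinv H * M * kerProj H‖) ?_
        (by simpa using hexp.mul_const _)
      filter_upwards [Filter.eventually_ge_atTop (0 : ℝ)] with τ hτ
      have e : pinv H * M * kerProj H = (1 - kerProj H) * (pinv H * M * kerProj H) := by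
        rw [sub_mul, one_mul, ← mul_assoc, ← mul_assoc, kerProj_mul_pinv hH]
        simp
      rw [e, ← mul_assoc]
      refine (norm_mul_le _ _).trans ?_
      rw [← e]
      exact mul_le_mul_of_nonneg_right (norm_exp_neg_mul_le hH Δ hgap τ hτ) (norm_nonneg _)
    have := (hlim.sub ((continuous_star.tendsto _).comp hlim)).neg
    rw [star_zero, sub_zero, neg_zero] at this
    exact this

end KernelProjection

/-- An anti-Hermitian element that is off-diagonal with respect to an orthogonal decomposition is
as large as its off-diagonal block. -/
theorem norm_sub_star_le {𝔸 : Type*} [CStarAlgebra 𝔸] {P X : 𝔸}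
    (h1 : X * P = X) (h2 : P * X = 0) : ‖X - star X‖ ≤ ‖X‖ := by
  have hXX : X * X = 0 := by
    rw [← h1, mul_assoc, ← mul_assoc P, h2, zero_mul, mul_zero]
  have hYY : star X * star X = 0 := by
    rw [← star_mul, hXX, star_zero]
  obtain ⟨a, ha⟩ : ∃ a, a = star X * X := ⟨_, rfl⟩
  obtain ⟨b, hb⟩ : ∃ b, b = X * star X := ⟨_, rfl⟩
  have hab : a * b = 0 := by rw [ha, hb, mul_assoc, ← mul_assoc X, hXX, zero_mul, mul_zero]
  have hba : b * a = 0 := by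
    rw [ha, hb, mul_assoc, ← mul_assoc (star X), hYY, zero_mul, mul_zero]
  have hpow : ∀ n : ℕ, (a + b) ^ (n + 1) = a ^ (n + 1) + b ^ (n + 1) := by
    intro n
    induction n with
    | zero => simp
    | succ n ih =>
      rw [pow_succ, ih, add_mul, mul_add, mul_add, pow_succ a n, pow_succ b n, mul_assoc _ a b, hab,
        mul_assoc _ b a, hba]
      simp [pow_succ, mul_assoc]
  have hsa : IsSelfAdjoint (a + b) := by
    rw [ha, hb]
    exact (IsSelfAdjoint.star_mul_self X).add (IsSelfAdjoint.mul_star_self X)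
  have hsq : ‖X - star X‖ * ‖X - star X‖ = ‖a + b‖ := by
    rw [← CStarRing.norm_star_mul_self, star_sub, star_star, mul_sub, sub_mul, sub_mul, hXX, hYY,
      ha, hb]
    congr 1
    abel
  have na : ‖a‖ = ‖X‖ * ‖X‖ := by rw [ha, CStarRing.norm_star_mul_self]
  have nb : ‖b‖ = ‖X‖ * ‖X‖ := by rw [hb, CStarRing.norm_self_mul_star]
  -- As `a * b = b * a = 0`, powers of `a + b` split. The factor `2` from the triangle inequality
  -- stays fixed while the exponent `2 ^ n` grows, so it disappears in the limit of roots.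
  have hbound : ∀ n : ℕ, ‖a + b‖ ^ 2 ^ n ≤ 2 * (‖X‖ * ‖X‖) ^ 2 ^ n := by
    intro n
    have e1 : ‖(a + b) ^ 2 ^ n‖ = ‖a + b‖ ^ 2 ^ n := by
      have := hsa.nnnorm_pow_two_pow n
      rw [← coe_nnnorm, this, NNReal.coe_pow, coe_nnnorm]
    obtain ⟨m, hm⟩ : ∃ m, 2 ^ n = m + 1 :=
      ⟨2 ^ n - 1, (Nat.succ_pred_eq_of_pos (by positivity)).symm⟩
    rw [← e1, hm, hpow, two_mul]
    refine (norm_add_le _ _).trans (add_le_add ?_ ?_)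
    · rw [← na]
      exact norm_pow_le' a (Nat.succ_pos m)
    · rw [← nb]
      exact norm_pow_le' b (Nat.succ_pos m)
  have hle : ‖a + b‖ ≤ ‖X‖ * ‖X‖ := by
    by_contra hlt
    push Not at hlt
    rcases eq_or_lt_of_le (norm_nonneg X) with h0 | h0
    · have hx : X = 0 := norm_eq_zero.1 h0.symm
      simp [ha, hb, hx] at hlt
    have hpos : 0 < ‖X‖ * ‖X‖ := by positivity
    have hc : 1 < ‖a + b‖ / (‖X‖ * ‖X‖) := (one_lt_div hpos).2 hlt
    obtain ⟨n, hn⟩ := pow_unbounded_of_one_lt 2 hc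
    have h4 : (‖a + b‖ / (‖X‖ * ‖X‖)) ^ n ≤ (‖a + b‖ / (‖X‖ * ‖X‖)) ^ 2 ^ n :=
      pow_le_pow_right₀ hc.le (Nat.lt_two_pow_self).le
    rw [div_pow _ _ (2 ^ n)] at h4
    have h6 : ‖a + b‖ ^ 2 ^ n / (‖X‖ * ‖X‖) ^ 2 ^ n ≤ 2 := by
      rw [div_le_iff₀ (pow_pos hpos _)]
      exact hbound n
    linarith
  rw [← hsq] at hle
  exact (mul_self_le_mul_self_iff (norm_nonneg _) (norm_nonneg _)).2 hle

/-! ### Frustration-free commuting terms and the local maps -/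

section LocalOperators

variable {Λ : Type*} [Fintype Λ] [DecidableEq Λ] {q : Λ → ℕ}

theorem commute_pinv_of_commute {H X : Op q} (hH : H.IsHermitian) (h : Commute X H) :
    Commute X (pinv H) :=
  (IsSelfAdjoint.commute_cfc (show IsSelfAdjoint H from hH) h.symm _).symm

/-- The projector is `1 - H * pinv H`, a function of `H`; so here `X` need not be Hermitian, only
`H`. -/
theorem commute_kerProj_of_commute {H X : Op q} (hH : H.IsHermitian) (h : Commute X H) :
    Commute X (kerProj H) := by
  have e : kerProj H = 1 - H * pinv H := by rw [mul_pinv hH, sub_sub_cancel]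
  rw [e]
  exact (Commute.one_right X).sub_right (h.mul_right (commute_pinv_of_commute hH h))

theorem SupportedOn.pinv {A : Finset Λ} {H : Op q} (hH : H.IsHermitian) (h : SupportedOn A H) :
    SupportedOn A (pinv H) :=
  supportedOn_iff_commute.2 fun R hR =>
    (commute_pinv_of_commute hH (supportedOn_iff_commute.1 h R hR).symm).symm

namespace CommutingHamiltonian

variable (H₀ : CommutingHamiltonian q) {A B : Finset Λ} {M N : Op q}

theorem mem_meets {A : Finset Λ} {j : Λ} : j ∈ H₀.meets A ↔ (H₀.region j ∩ A).Nonempty := by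
  simp [meets]

theorem self_mem_meets {j : Λ} (hj : j ∈ A) : j ∈ H₀.meets A :=
  H₀.mem_meets.2 ⟨j, Finset.mem_inter.2 ⟨H₀.mem_region j, hj⟩⟩

theorem mem_hull {x : Λ} : x ∈ H₀.hull A ↔ ∃ j, (H₀.region j ∩ A).Nonempty ∧ x ∈ H₀.region j := by
  simp [hull, mem_meets]

theorem subset_hull (A : Finset Λ) : A ⊆ H₀.hull A := fun x hx =>
  H₀.mem_hull.2 ⟨x, H₀.mem_meets.1 (H₀.self_mem_meets hx), H₀.mem_region x⟩

theorem region_subset_hull {j : Λ} (hj : j ∈ H₀.meets A) : H₀.region j ⊆ H₀.hull A := fun _ hx =>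
  H₀.mem_hull.2 ⟨j, H₀.mem_meets.1 hj, hx⟩

/-- Both sides say that one region `R_j` meets both `A` and `B`. The symmetry lets a sum over `A`
with `B` fixed be counted on the sites of the hull of `B`. -/
theorem hull_inter_nonempty_comm : (H₀.hull A ∩ B).Nonempty ↔ (A ∩ H₀.hull B).Nonempty := by
  constructor
  · rintro ⟨x, hx⟩
    rw [Finset.mem_inter, mem_hull] at hx
    obtain ⟨⟨j, ⟨a, ha⟩, hxj⟩, hxB⟩ := hx
    rw [Finset.mem_inter] at ha
    exact ⟨a, Finset.mem_inter.2
      ⟨ha.2, H₀.mem_hull.2 ⟨j, ⟨x, Finset.mem_inter.2 ⟨hxj, hxB⟩⟩, ha.1⟩⟩⟩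
  · rintro ⟨x, hx⟩
    rw [Finset.mem_inter, mem_hull] at hx
    obtain ⟨hxA, j, ⟨b, hb⟩, hxj⟩ := hx
    rw [Finset.mem_inter] at hb
    exact ⟨b, Finset.mem_inter.2
      ⟨H₀.mem_hull.2 ⟨j, ⟨x, Finset.mem_inter.2 ⟨hxj, hxA⟩⟩, hb.1⟩, hb.2⟩⟩

theorem commute_term_of_notMem_meets (hM : SupportedOn A M) {j : Λ} (hj : j ∉ H₀.meets A) :
    Commute M (H₀.term j) := by
  refine hM.commute (H₀.supportedOn_term j) ?_
  rw [mem_meets, Finset.not_nonempty_iff_eq_empty, ← Finset.disjoint_iff_inter_eq_empty] at hj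
  exact hj.symm

theorem posSemidef_trunc (A : Finset Λ) : (H₀.trunc A).PosSemidef :=
  Matrix.posSemidef_sum _ fun j _ => H₀.posSemidef_term j

theorem isHermitian_trunc (A : Finset Λ) : (H₀.trunc A).IsHermitian :=
  (H₀.posSemidef_trunc A).isHermitian

theorem commute_term_trunc (j : Λ) (A : Finset Λ) : Commute (H₀.term j) (H₀.trunc A) :=
  Commute.sum_right _ _ _ fun i _ => H₀.commute_term j i

theorem commute_trunc_trunc (A B : Finset Λ) : Commute (H₀.trunc A) (H₀.trunc B) :=
  Commute.sum_left _ _ _ fun i _ => H₀.commute_term_trunc i B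

/-- Column by column, the vanishing expectation of a sum of positive semidefinite operators forces
each expectation to vanish, and then each term kills the vector. -/
theorem term_mul_eq_zero {j : Λ} (hj : j ∈ H₀.meets A) (h : H₀.trunc A * N = 0) :
    H₀.term j * N = 0 := by
  ext i k
  have hx : (H₀.trunc A).mulVec (fun l => N l k) = 0 := by
    ext l
    exact congrFun (congrFun h l) k
  have h0 : star (fun l => N l k) ⬝ᵥ (H₀.trunc A).mulVec (fun l => N l k) = 0 := by
    rw [hx, dotProduct_zero]
  rw [trunc, Matrix.sum_mulVec, dotProduct_sum, Finset.sum_eq_zero_iff_of_nonneg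
    (fun i _ => (H₀.posSemidef_term i).dotProduct_mulVec_nonneg _)] at h0
  have h1 := ((H₀.posSemidef_term j).dotProduct_mulVec_zero_iff _).1 (h0 j hj)
  exact congrFun h1 i

/-- Positivity makes the kernel of the sum the common kernel of its terms. From here on `P_A` can be
treated by the spectral calculus of `H_{0A}` alone. -/
theorem proj_eq_kerProj (A : Finset Λ) : H₀.proj A = kerProj (H₀.trunc A) := by
  have h1 : ∀ j ∈ H₀.meets A, H₀.term j * H₀.proj A = 0 := by
    intro j hj
    have e : H₀.proj A = _ := (Finset.mul_noncommProd_erase (H₀.meets A) hj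
      (fun j => kerProj (H₀.term j)) (fun i _ j _ _ =>
        commute_kerProj (H₀.posSemidef_term j).isHermitian (H₀.commute_term i j))).symm
    rw [e, ← mul_assoc, mul_kerProj, zero_mul]
  have h2 : kerProj (H₀.trunc A) * H₀.proj A = H₀.proj A := by
    apply kerProj_mul_of_mul_eq_zero
    rw [trunc, Finset.sum_mul]
    exact Finset.sum_eq_zero h1
  have h3 : H₀.proj A * kerProj (H₀.trunc A) = kerProj (H₀.trunc A) := by
    refine Finset.noncommProd_induction (H₀.meets A) _ _
      (fun Z => Z * kerProj (H₀.trunc A) = kerProj (H₀.trunc A)) ?_ (one_mul _) ?_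
    · intro a b ha hb
      rw [mul_assoc, hb, ha]
    · intro j hj
      exact kerProj_mul_of_mul_eq_zero (H₀.term_mul_eq_zero hj (mul_kerProj _))
  have h4 : Commute (kerProj (H₀.trunc A)) (H₀.proj A) := by
    refine Finset.noncommProd_commute _ _ _ _ fun j _ => ?_
    exact commute_kerProj (H₀.posSemidef_term j).isHermitian (H₀.commute_term_trunc j A).symm
  rw [← h2, h4.eq, h3]

theorem isHermitian_proj (A : Finset Λ) : (H₀.proj A).IsHermitian := by
  rw [proj_eq_kerProj]
  exact isHermitian_kerProj _

theorem proj_mul_self (A : Finset Λ) : H₀.proj A * H₀.proj A = H₀.proj A := by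
  rw [proj_eq_kerProj, kerProj_mul_self]

theorem commute_proj_of_commute (h : Commute M (H₀.trunc A)) : Commute M (H₀.proj A) := by
  rw [proj_eq_kerProj]
  exact commute_kerProj_of_commute (H₀.isHermitian_trunc A) h

theorem supportedOn_trunc (A : Finset Λ) : SupportedOn (H₀.hull A) (H₀.trunc A) :=
  SupportedOn.sum fun j hj => (H₀.supportedOn_term j).mono (H₀.region_subset_hull hj)

theorem supportedOn_proj (A : Finset Λ) : SupportedOn (H₀.hull A) (H₀.proj A) := by
  rw [proj_eq_kerProj]
  exact (H₀.supportedOn_trunc A).kerProj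

theorem ham_eq (A : Finset Λ) : H₀.ham = H₀.trunc A + ∑ j ∈ (H₀.meets A)ᶜ, H₀.term j :=
  (Finset.sum_add_sum_compl _ _).symm

theorem trunc_univ : H₀.trunc Finset.univ = H₀.ham := by
  rw [trunc, ham]
  congr 1
  ext j
  simp [mem_meets, Finset.Nonempty.ne_empty ⟨j, H₀.mem_region j⟩, Finset.nonempty_iff_ne_empty]

theorem isHermitian_ham : H₀.ham.IsHermitian := by
  rw [← trunc_univ]
  exact H₀.isHermitian_trunc _

theorem isHermitian_P : (H₀.P).IsHermitian := H₀.isHermitian_proj _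

theorem P_mul_self : H₀.P * H₀.P = H₀.P := H₀.proj_mul_self _

theorem term_mul_P (j : Λ) : H₀.term j * H₀.P = 0 := by
  refine H₀.term_mul_eq_zero (A := Finset.univ) (H₀.self_mem_meets (Finset.mem_univ j)) ?_
  rw [P, proj_eq_kerProj, mul_kerProj]

theorem proj_mul_P (A : Finset Λ) : H₀.proj A * H₀.P = H₀.P := by
  rw [proj_eq_kerProj]
  apply kerProj_mul_of_mul_eq_zero
  rw [trunc, Finset.sum_mul]
  exact Finset.sum_eq_zero fun j _ => H₀.term_mul_P j

theorem P_mul_proj (A : Finset Λ) : H₀.P * H₀.proj A = H₀.P := by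
  have h' := congrArg Matrix.conjTranspose (H₀.proj_mul_P A)
  rwa [Matrix.conjTranspose_mul, (H₀.isHermitian_proj A).eq, H₀.isHermitian_P.eq] at h'

theorem P_mul_ham : H₀.P * H₀.ham = 0 := by
  rw [← trunc_univ, P, proj_eq_kerProj, kerProj_mul (H₀.isHermitian_trunc _)]

/-- `P = P_A R_A`, where the factor `R_A` commutes with the operators supported on `A`. -/
theorem exists_P_eq (A : Finset Λ) : ∃ R : Op q, H₀.P = H₀.proj A * R ∧ H₀.P = R * H₀.proj A ∧
    ∀ M, SupportedOn A M → Commute M R := by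
  obtain ⟨N, hN⟩ : ∃ N, N = ∑ j ∈ (H₀.meets A)ᶜ, H₀.term j := ⟨_, rfl⟩
  have hNh : N.IsHermitian := by
    rw [hN]
    exact (Matrix.posSemidef_sum _ fun j _ => H₀.posSemidef_term j).isHermitian
  have hNA : Commute N (H₀.trunc A) := by
    rw [hN]
    exact Commute.sum_left _ _ _ fun j _ => H₀.commute_term_trunc j A
  have hc : Commute (H₀.proj A) (kerProj N) :=
    commute_kerProj_of_commute hNh (H₀.commute_proj_of_commute hNA).symm
  -- The range of `P_A kerProj(N)` is killed both by `H_{0A}` and by the remaining terms `N`, hence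
  -- by `H₀`.
  have h1 : H₀.P * (H₀.proj A * kerProj N) = H₀.proj A * kerProj N := by
    rw [P, proj_eq_kerProj _ Finset.univ, trunc_univ]
    apply kerProj_mul_of_mul_eq_zero
    rw [H₀.ham_eq A, ← hN, add_mul, ← mul_assoc, hc.eq, ← mul_assoc N, mul_kerProj,
      proj_eq_kerProj, mul_kerProj]
    simp
  have h2 : kerProj N * H₀.P = H₀.P := by
    apply kerProj_mul_of_mul_eq_zero
    rw [hN, Finset.sum_mul]
    exact Finset.sum_eq_zero fun j _ => H₀.term_mul_P j
  have h3 : H₀.P = H₀.proj A * kerProj N := by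
    have h1' := congrArg Matrix.conjTranspose h1
    rw [Matrix.conjTranspose_mul, Matrix.conjTranspose_mul, H₀.isHermitian_P.eq,
      (H₀.isHermitian_proj A).eq, (isHermitian_kerProj N).eq, mul_assoc, H₀.proj_mul_P, h2] at h1'
    rw [h1', hc.eq]
  refine ⟨kerProj N, h3, by rw [← hc.eq, ← h3], fun M hM => commute_kerProj_of_commute hNh ?_⟩
  rw [hN]
  exact Commute.sum_right _ _ _ fun j hj =>
    H₀.commute_term_of_notMem_meets hM (Finset.mem_compl.1 hj)

/-- An operator that commutes with the truncated Hamiltonian and with `M` commutes with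
`𝓓_A(M)`. -/
theorem commute_localDiag {X : Op q} (h1 : Commute X (H₀.trunc A)) (h2 : Commute X M) :
    Commute X (localDiag H₀ A M) := by
  have h3 := H₀.commute_proj_of_commute h1
  have h4 := (Commute.one_right X).sub_right h3
  exact ((h3.mul_right h2).mul_right h3).add_right ((h4.mul_right h2).mul_right h4)

theorem supportedOn_localDiag (hM : SupportedOn A M) :
    SupportedOn (H₀.hull A) (localDiag H₀ A M) := by
  have h1 := H₀.supportedOn_proj A
  have h2 := hM.mono (H₀.subset_hull A)
  have h3 := SupportedOn.one.sub h1
  exact ((h1.mul h2).mul h1).add ((h3.mul h2).mul h3)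

theorem isHermitian_localDiag (hM : M.IsHermitian) : (localDiag H₀ A M).IsHermitian := by
  rw [Matrix.IsHermitian, localDiag]
  simp only [Matrix.conjTranspose_add, Matrix.conjTranspose_mul, Matrix.conjTranspose_sub,
    Matrix.conjTranspose_one, (H₀.isHermitian_proj A).eq, hM.eq, mul_assoc]

/-- With the reflection `U = 2 P_A - 1`, pinching is the average of `M` and `U M U`, so no factor
`2` is lost. -/
theorem norm_localDiag_le (A : Finset Λ) (M : Op q) : ‖localDiag H₀ A M‖ ≤ ‖M‖ := by
  have h2 : (2 * H₀.proj A - 1) * (2 * H₀.proj A - 1) = 1 := by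
    have := H₀.proj_mul_self A
    calc _ = 4 * (H₀.proj A * H₀.proj A) - 4 * H₀.proj A + 1 := by noncomm_ring
      _ = 1 := by rw [this, sub_self, zero_add]
  have h1 : ‖2 * H₀.proj A - 1‖ ≤ 1 := by
    have hs : star (2 * H₀.proj A - 1) = 2 * H₀.proj A - 1 := by
      rw [star_sub, star_one, two_mul, star_add,
        show star (H₀.proj A) = H₀.proj A from H₀.isHermitian_proj A]
    have e : ‖2 * H₀.proj A - 1‖ * ‖2 * H₀.proj A - 1‖ = ‖(1 : Op q)‖ := by
      rw [← CStarRing.norm_star_mul_self, hs, h2]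
    have e1 : ‖(1 : Op q)‖ ≤ 1 :=
      norm_le_one_of_isHermitian_of_mul_self Matrix.isHermitian_one (one_mul _)
    nlinarith [norm_nonneg (2 * H₀.proj A - 1)]
  have h3 : localDiag H₀ A M =
      (1 / 2 : ℂ) • (M + (2 * H₀.proj A - 1) * M * (2 * H₀.proj A - 1)) := by
    have : M + (2 * H₀.proj A - 1) * M * (2 * H₀.proj A - 1) = (2 : ℂ) • localDiag H₀ A M := by
      rw [two_smul, localDiag]
      noncomm_ring
    rw [this, smul_smul]
    norm_num
  rw [h3, norm_smul]
  have h4 : ‖(2 * H₀.proj A - 1) * M * (2 * H₀.proj A - 1)‖ ≤ 1 * ‖M‖ * 1 :=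
    (norm_mul_le _ _).trans (mul_le_mul ((norm_mul_le _ _).trans
      (mul_le_mul_of_nonneg_right h1 (norm_nonneg _))) h1 (norm_nonneg _) (by positivity))
  have h5 := norm_add_le M ((2 * H₀.proj A - 1) * M * (2 * H₀.proj A - 1))
  have h6 : ‖(1 / 2 : ℂ)‖ = 1 / 2 := by simp
  rw [h6]
  linarith

/-- Locality of `M` enters through `P = P_A R` with `R` commuting with `M`: one of the outer
projectors `P` in `P M P` can then be weakened to `P_A`. This makes the block-diagonal Hamiltonian
agree with `P H P` on the range of `P`. -/
theorem P_mul_localDiag (hM : SupportedOn A M) :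
    H₀.P * localDiag H₀ A M = H₀.P * M * H₀.P ∧ localDiag H₀ A M * H₀.P = H₀.P * M * H₀.P := by
  obtain ⟨R, h1, h2, h3⟩ := H₀.exists_P_eq A
  have hMR := (h3 M hM).eq
  have e1 : H₀.P * (1 - H₀.proj A) = 0 := by rw [mul_sub, mul_one, P_mul_proj, sub_self]
  have e2 : (1 - H₀.proj A) * H₀.P = 0 := by rw [sub_mul, one_mul, proj_mul_P, sub_self]
  -- The right-hand `P` is written as `R P_A`, and `R` is moved through `M` and absorbed by the
  -- left-hand `P`.
  have e3 : H₀.P * M * H₀.P = H₀.P * M * H₀.proj A := by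
    conv_lhs => rw [mul_assoc]; rhs; rw [h2]
    rw [← mul_assoc M, hMR, ← mul_assoc, ← mul_assoc, h1, mul_assoc _ R R]
    have hRR : H₀.proj A * (R * R) = H₀.proj A * R := by
      have := H₀.P_mul_self
      rw [h1] at this
      have hcR : R * H₀.proj A = H₀.proj A * R := by rw [← h1, ← h2]
      calc H₀.proj A * (R * R) = H₀.proj A * H₀.proj A * R * R := by
            rw [proj_mul_self, mul_assoc]
        _ = H₀.proj A * R * (H₀.proj A * R) := by
            rw [mul_assoc (H₀.proj A) R, ← mul_assoc R, hcR]
            simp only [mul_assoc]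
        _ = _ := this
    rw [hRR]
  have e4 : H₀.P * M * H₀.P = H₀.proj A * M * H₀.P := by
    have h5 : H₀.P * M * H₀.proj A = H₀.proj A * M * H₀.P := by
      calc H₀.P * M * H₀.proj A = H₀.proj A * (R * M) * H₀.proj A := by
            rw [h1]; simp only [mul_assoc]
        _ = H₀.proj A * M * H₀.P := by rw [← hMR, h2]; simp only [mul_assoc]
    rw [e3, h5]
  constructor
  · rw [localDiag, mul_add, ← mul_assoc, ← mul_assoc, P_mul_proj, ← mul_assoc, ← mul_assoc, e1,
      zero_mul, zero_mul, add_zero, e3]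
  · rw [localDiag, add_mul, mul_assoc, proj_mul_P, mul_assoc _ (1 - H₀.proj A) H₀.P, e2, mul_zero,
      add_zero, e4]

/-! ### The Schrieffer-Wolff generator under the gap assumption -/

section Gap

variable {Δ : ℝ}

theorem localGen_eq (hgap : H₀.HasGap Δ) (A : Finset Λ) (hM : M.IsHermitian) :
    localGen H₀ A M = pinv (H₀.trunc A) * M * H₀.proj A - H₀.proj A * M * pinv (H₀.trunc A) := by
  have h := integral_exp_neg_mul (H₀.isHermitian_trunc A) Δ hgap.1 (hgap.2 A) M
  rw [← proj_eq_kerProj, hM.eq] at h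
  exact h

theorem commute_localGen (hgap : H₀.HasGap Δ) {X : Op q} (hM : M.IsHermitian)
    (h1 : Commute X (H₀.trunc A)) (h2 : Commute X M) : Commute X (localGen H₀ A M) := by
  rw [H₀.localGen_eq hgap A hM]
  have h3 := H₀.commute_proj_of_commute h1
  have h4 := commute_pinv_of_commute (H₀.isHermitian_trunc A) h1
  exact ((h4.mul_right h2).mul_right h3).sub_right ((h3.mul_right h2).mul_right h4)

theorem supportedOn_localGen (hgap : H₀.HasGap Δ) (hM : M.IsHermitian) (hA : SupportedOn A M) :
    SupportedOn (H₀.hull A) (localGen H₀ A M) := by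
  rw [H₀.localGen_eq hgap A hM]
  have h1 := H₀.supportedOn_proj A
  have h2 := hA.mono (H₀.subset_hull A)
  have h3 := (H₀.supportedOn_trunc A).pinv (H₀.isHermitian_trunc A)
  exact ((h3.mul h2).mul h1).sub ((h1.mul h2).mul h3)

theorem conjTranspose_localGen (hgap : H₀.HasGap Δ) (hM : M.IsHermitian) :
    (localGen H₀ A M).conjTranspose = -localGen H₀ A M := by
  rw [H₀.localGen_eq hgap A hM]
  simp only [Matrix.conjTranspose_mul, Matrix.conjTranspose_sub, (H₀.isHermitian_proj A).eq, hM.eq,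
    (isHermitian_pinv _).eq, mul_assoc, neg_sub]

/-- The two halves of `𝓛_A(M)` are adjoint off-diagonal blocks with respect to `P_A`, so
`norm_sub_star_le` gives the norm of one block rather than the sum of the two. -/
theorem norm_localGen_le (hgap : H₀.HasGap Δ) (hM : M.IsHermitian) :
    ‖localGen H₀ A M‖ ≤ ‖M‖ / Δ := by
  have hΔ := hgap.1
  rw [H₀.localGen_eq hgap A hM]
  have e : H₀.proj A * M * pinv (H₀.trunc A) = star (pinv (H₀.trunc A) * M * H₀.proj A) := by
    rw [Matrix.star_eq_conjTranspose]
    simp only [Matrix.conjTranspose_mul, (H₀.isHermitian_proj A).eq, hM.eq,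
      (isHermitian_pinv _).eq, mul_assoc]
  rw [e]
  refine (norm_sub_star_le (P := H₀.proj A) ?_ ?_).trans ?_
  · rw [mul_assoc, proj_mul_self]
  · rw [← mul_assoc, ← mul_assoc, proj_eq_kerProj, kerProj_mul_pinv (H₀.isHermitian_trunc A)]
    simp
  · have h1 := norm_pinv_le Δ hΔ (hgap.2 A)
    have h2 : ‖H₀.proj A‖ ≤ 1 := by
      rw [proj_eq_kerProj]
      exact norm_kerProj_le _
    calc _ ≤ 1 / Δ * ‖M‖ * 1 :=
        (norm_mul_le _ _).trans (mul_le_mul ((norm_mul_le _ _).trans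
          (mul_le_mul_of_nonneg_right h1 (norm_nonneg _))) h2 (norm_nonneg _) (by positivity))
      _ = ‖M‖ / Δ := by ring

/-- The identity that makes `T` the right generator. Terms of `H₀` away from `A` commute with
`𝓛_A(M)`, and on the rest `H_{0A}` times its pseudo-inverse is `Q_A`, so the commutator is `Q_A M
P_A + P_A M Q_A`. -/
theorem ham_mul_localGen_sub (hgap : H₀.HasGap Δ) (hM : M.IsHermitian) (hA : SupportedOn A M) :
    H₀.ham * localGen H₀ A M - localGen H₀ A M * H₀.ham = M - localDiag H₀ A M := by
  have hc : Commute (∑ j ∈ (H₀.meets A)ᶜ, H₀.term j) (localGen H₀ A M) :=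
    Commute.sum_left _ _ _ fun j hj => H₀.commute_localGen hgap hM (H₀.commute_term_trunc j A)
      (H₀.commute_term_of_notMem_meets hA (Finset.mem_compl.1 hj)).symm
  have hh := H₀.isHermitian_trunc A
  have e1 := mul_pinv hh
  have e2 : pinv (H₀.trunc A) * H₀.trunc A = 1 - kerProj (H₀.trunc A) := by
    rw [← (commute_pinv _).eq, e1]
  have e3 := mul_kerProj (H₀.trunc A)
  have e4 := kerProj_mul hh
  rw [← proj_eq_kerProj] at e1 e2 e3 e4
  rw [H₀.ham_eq A, add_mul, mul_add, hc.eq, add_sub_add_right_eq_sub, H₀.localGen_eq hgap A hM,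
    mul_sub, sub_mul, ← mul_assoc, ← mul_assoc, e1, ← mul_assoc, ← mul_assoc, e3,
    mul_assoc _ (H₀.proj A) (H₀.trunc A), e4, mul_assoc _ (pinv _) (H₀.trunc A), e2, localDiag]
  noncomm_ring

/-- `𝓛_A(M)` and `𝓓_B(N)` commute unless some term of `H₀` meets both `A` and `B`. -/
theorem commute_localGen_localDiag (hgap : H₀.HasGap Δ) (hM : M.IsHermitian)
    (hA : SupportedOn A M) (hB : SupportedOn B N) (h : ¬ (H₀.hull A ∩ B).Nonempty) :
    Commute (localGen H₀ A M) (localDiag H₀ B N) := by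
  have hn : ∀ j, j ∈ H₀.meets A → j ∉ H₀.meets B := by
    intro j hjA hjB
    rw [mem_meets] at hjB
    obtain ⟨b, hb⟩ := hjB
    rw [Finset.mem_inter] at hb
    exact h ⟨b, Finset.mem_inter.2 ⟨H₀.region_subset_hull hjA hb.1, hb.2⟩⟩
  have hdisj : Disjoint A B := by
    rw [Finset.disjoint_left]
    exact fun x hxA hxB => h ⟨x, Finset.mem_inter.2 ⟨H₀.subset_hull A hxA, hxB⟩⟩
  have h1 : Commute (localGen H₀ A M) (H₀.trunc B) :=
    (H₀.commute_localGen hgap hM (H₀.commute_trunc_trunc B A)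
      (Commute.sum_left _ _ _ fun j hj =>
        (H₀.commute_term_of_notMem_meets hA fun hj' => hn j hj' hj).symm)).symm
  refine H₀.commute_localDiag h1 (H₀.commute_localGen hgap hM ?_ (hA.commute hB hdisj).symm).symm
  exact Commute.sum_right _ _ _ fun j hj => H₀.commute_term_of_notMem_meets hB (hn j hj)

end Gap

end CommutingHamiltonian

end LocalOperators

/-! ### Conjugation by an exponential as the exponential of `ad` -/

section Adjoint

variable {𝔸 : Type*} [NormedRing 𝔸] [NormedAlgebra ℂ 𝔸] [CompleteSpace 𝔸]

/-- The map `M ↦ [T, M]`. -/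
noncomputable def adL (T : 𝔸) : 𝔸 →L[ℂ] 𝔸 :=
  ContinuousLinearMap.mul ℂ 𝔸 T - (ContinuousLinearMap.mul ℂ 𝔸).flip T

omit [CompleteSpace 𝔸] in
theorem adL_apply (T M : 𝔸) : adL T M = T * M - M * T := rfl

theorem hasDerivAt_exp_smul_mul (T : 𝔸) (s : ℝ) :
    HasDerivAt (fun s : ℝ => NormedSpace.exp ((s : ℂ) • T))
      (NormedSpace.exp ((s : ℂ) • T) * T) s := by
  simp only [Complex.coe_smul]
  exact hasDerivAt_exp_smul_const (𝕂 := ℝ) T s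

theorem hasDerivAt_exp_smul_mul' (T : 𝔸) (s : ℝ) :
    HasDerivAt (fun s : ℝ => NormedSpace.exp ((s : ℂ) • T))
      (T * NormedSpace.exp ((s : ℂ) • T)) s := by
  simp only [Complex.coe_smul]
  exact hasDerivAt_exp_smul_const' (𝕂 := ℝ) T s

theorem exp_smul_mul_exp_neg_smul (c : ℂ) (T : 𝔸) :
    NormedSpace.exp (c • T) * NormedSpace.exp (-c • T) = 1 := by
  let _ : NormedAlgebra ℚ 𝔸 := NormedAlgebra.restrictScalars ℚ ℂ 𝔸
  rw [← NormedSpace.exp_add_of_commute, neg_smul, add_neg_cancel, NormedSpace.exp_zero]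
  rw [neg_smul]
  exact (Commute.refl _).neg_right

theorem exp_neg_smul_mul_exp_smul (c : ℂ) (T : 𝔸) :
    NormedSpace.exp (-c • T) * NormedSpace.exp (c • T) = 1 := by
  have := exp_smul_mul_exp_neg_smul (-c) T
  rwa [neg_neg] at this

/-- Undoing the conjugation along the flow, `e^{-sT} (e^{s ad_T} M) e^{sT}` has zero derivative in
`s`; its values at `0` and `1` are compared. -/
theorem exp_mul_mul_exp_neg (T M : 𝔸) :
    NormedSpace.exp T * M * NormedSpace.exp (-T) = NormedSpace.exp (adL T) M := by
  let F : ℝ → 𝔸 := fun s => NormedSpace.exp ((s : ℂ) • adL T) M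
  have hF : ∀ s : ℝ, HasDerivAt F (adL T (F s)) s := fun s =>
    ((ContinuousLinearMap.apply ℂ 𝔸 M).restrictScalars ℝ).hasFDerivAt.comp_hasDerivAt s
      (hasDerivAt_exp_smul_mul' (adL T) s)
  let G : ℝ → 𝔸 := fun s => NormedSpace.exp ((s : ℂ) • (-T)) * F s * NormedSpace.exp ((s : ℂ) • T)
  have hG : ∀ s : ℝ, HasDerivAt G 0 s := by
    intro s
    refine (((hasDerivAt_exp_smul_mul (-T) s).mul (hF s)).mul
      (hasDerivAt_exp_smul_mul' T s)).congr_deriv ?_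
    rw [adL_apply, Pi.mul_apply]
    noncomm_ring
  have hc := is_const_of_deriv_eq_zero (fun s => (hG s).differentiableAt)
    (fun s => (hG s).deriv) 1 0
  simp only [G, F, Complex.ofReal_one, one_smul, Complex.ofReal_zero, zero_smul,
    NormedSpace.exp_zero, one_mul, mul_one] at hc
  have e1 := exp_smul_mul_exp_neg_smul 1 T
  have e2 := exp_neg_smul_mul_exp_smul 1 T
  simp only [neg_smul, one_smul] at e1 e2
  have e3 : NormedSpace.exp T * (NormedSpace.exp (-T) * NormedSpace.exp (adL T) M *
      NormedSpace.exp T) * NormedSpace.exp (-T) = NormedSpace.exp (adL T) M := by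
    rw [mul_assoc, mul_assoc (NormedSpace.exp (-T) * _), e1, mul_one, ← mul_assoc, e1, one_mul]
  have z : (0 : ℂ) • adL T = 0 := by
    ext
    simp
  rw [hc, z, NormedSpace.exp_zero] at e3
  exact e3

theorem hasSum_exp_conj (T M : 𝔸) : HasSum (fun n : ℕ => ((n.factorial : ℂ)⁻¹) • (adL T ^ n) M)
    (NormedSpace.exp T * M * NormedSpace.exp (-T)) := by
  rw [exp_mul_mul_exp_neg]
  exact (NormedSpace.exp_series_hasSum_exp' (𝕂 := ℂ) (adL T)).mapL
    (ContinuousLinearMap.apply ℂ 𝔸 M)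

end Adjoint

/-! ### Commutators of interactions and the exact transformation -/

section Interactions

variable {Λ : Type*} [Fintype Λ] [DecidableEq Λ] {q : Λ → ℕ}

namespace Interaction

/-- The term on every region is supported on that region. -/
def IsLocal (Φ : Interaction q) : Prop := ∀ A, SupportedOn A (Φ A)

variable {Φ Ψ : Interaction q}

theorem IsLocal.comm (hΦ : Φ.IsLocal) (hΨ : Ψ.IsLocal) : (comm Φ Ψ).IsLocal := by
  intro B
  refine SupportedOn.sum fun A _ => SupportedOn.sum fun A' _ => ?_
  split_ifs with h
  · have h1 := (hΦ A).mono (h.1 ▸ Finset.subset_union_left : A ⊆ B)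
    have h2 := (hΨ A').mono (h.1 ▸ Finset.subset_union_right : A' ⊆ B)
    exact (h1.mul h2).sub (h2.mul h1)
  · exact SupportedOn.zero

theorem IsLocal.iterate_comm (hΦ : Φ.IsLocal) (hΨ : Ψ.IsLocal) (n : ℕ) :
    ((Interaction.comm Φ)^[n] Ψ).IsLocal := by
  induction n with
  | zero => exact hΨ
  | succ n ih =>
    rw [Function.iterate_succ_apply']
    exact hΦ.comm ih

/-- Keeping only overlapping pairs loses nothing, since terms on disjoint regions commute. -/
theorem total_comm (hΦ : Φ.IsLocal) (hΨ : Ψ.IsLocal) :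
    (Interaction.comm Φ Ψ).total = adL Φ.total Ψ.total := by
  have h : ∀ A A', (∑ B, if A ∪ A' = B ∧ (A ∩ A').Nonempty then Φ A * Ψ A' - Ψ A' * Φ A else 0) =
      Φ A * Ψ A' - Ψ A' * Φ A := by
    intro A A'
    by_cases h : (A ∩ A').Nonempty
    · simp [h]
    · have hc := ((hΦ A).commute (hΨ A') (Finset.disjoint_iff_inter_eq_empty.2
        (Finset.not_nonempty_iff_eq_empty.1 h))).eq
      simp [h, hc]
  rw [adL_apply, total, total, total, Finset.sum_mul_sum, Finset.sum_mul_sum]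
  conv_rhs => rhs; rw [Finset.sum_comm]
  rw [← Finset.sum_sub_distrib]
  simp only [comm]
  rw [Finset.sum_comm]
  refine Finset.sum_congr rfl fun A _ => ?_
  rw [Finset.sum_comm, ← Finset.sum_sub_distrib]
  exact Finset.sum_congr rfl fun A' _ => h A A'

theorem total_iterate_comm (hΦ : Φ.IsLocal) (hΨ : Ψ.IsLocal) (n : ℕ) :
    ((Interaction.comm Φ)^[n] Ψ).total = (adL Φ.total ^ n) Ψ.total := by
  induction n with
  | zero => rfl
  | succ n ih =>
    rw [Function.iterate_succ_apply', total_comm hΦ (hΦ.iterate_comm hΨ n), ih, pow_succ']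
    rfl

theorem norm_comm_apply_le (Φ Ψ : Interaction q) (B : Finset Λ) : ‖comm Φ Ψ B‖ ≤
    ∑ A, ∑ A', if A ∪ A' = B ∧ (A ∩ A').Nonempty then ‖Φ A * Ψ A' - Ψ A' * Φ A‖ else 0 := by
  refine (norm_sum_le _ _).trans (Finset.sum_le_sum fun A _ => (norm_sum_le _ _).trans
    (Finset.sum_le_sum fun A' _ => ?_))
  split_ifs
  · exact le_rfl
  · exact norm_zero.le

theorem norm_commutator_le {𝔸 : Type*} [NormedRing 𝔸] (M N : 𝔸) :
    ‖M * N - N * M‖ ≤ 2 * ‖M‖ * ‖N‖ := by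
  have h1 := norm_mul_le M N
  have h2 := norm_mul_le N M
  have h3 := norm_sub_le (M * N) (N * M)
  nlinarith

/-- A crude bound in the total norm, which depends on the size of the lattice. It serves only for
the convergence of the series of `V'`; the quantitative estimates use the local norm. -/
theorem sum_norm_comm_le (Φ Ψ : Interaction q) :
    ∑ B, ‖comm Φ Ψ B‖ ≤ 2 * (∑ B, ‖Φ B‖) * ∑ B, ‖Ψ B‖ := by
  refine (Finset.sum_le_sum fun B _ => norm_comm_apply_le Φ Ψ B).trans ?_
  rw [mul_assoc, Finset.sum_mul_sum, Finset.mul_sum, Finset.sum_comm]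
  refine Finset.sum_le_sum fun A _ => ?_
  rw [Finset.mul_sum, Finset.sum_comm]
  refine Finset.sum_le_sum fun A' _ => ?_
  by_cases h : (A ∩ A').Nonempty
  · simp only [h, and_true, Finset.sum_ite_eq, Finset.mem_univ, if_true]
    rw [← mul_assoc]
    exact norm_commutator_le _ _
  · simp only [h, and_false, if_false, Finset.sum_const_zero]
    positivity

theorem sum_norm_iterate_comm_le (Φ Ψ : Interaction q) (n : ℕ) :
    ∑ B, ‖(comm Φ)^[n] Ψ B‖ ≤ (2 * ∑ B, ‖Φ B‖) ^ n * ∑ B, ‖Ψ B‖ := by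
  induction n with
  | zero => simp
  | succ n ih =>
    rw [Function.iterate_succ_apply', pow_succ', mul_assoc]
    exact (sum_norm_comm_le _ _).trans (mul_le_mul_of_nonneg_left ih (by positivity))

end Interaction

variable {d k : ℕ} {L : LatticeGeometry d Λ} (H₀ : CommutingHamiltonian q)
  (V : LocalPerturbation L q k) {Δ : ℝ}

theorem isLocal_swGen (hgap : H₀.HasGap Δ) : (swGen H₀ V.term).IsLocal := by
  intro B
  refine SupportedOn.sum fun A hA => ?_
  have := H₀.supportedOn_localGen hgap (V.isHermitian_term A) (V.supportedOn_term A)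
  rwa [(Finset.mem_filter.1 hA).2] at this

theorem isLocal_diagInter : (diagInter H₀ V.term).IsLocal := by
  intro B
  refine SupportedOn.sum fun A hA => ?_
  have := H₀.supportedOn_localDiag (V.supportedOn_term A)
  rwa [(Finset.mem_filter.1 hA).2] at this

theorem isLocal_mixedInter (n : ℕ) : (mixedInter H₀ V.term n).IsLocal := fun B =>
  ((V.supportedOn_term B).smul _).add ((isLocal_diagInter H₀ V B).smul _)

theorem isLocal_residualInter (hgap : H₀.HasGap Δ) : (residualInter H₀ V.term).IsLocal := fun B =>
  SupportedOn.tsum fun n =>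
    ((isLocal_swGen H₀ V hgap).iterate_comm (isLocal_mixedInter H₀ V (n + 1)) (n + 1) B).smul _

theorem sum_sum_hull_eq {M : Type*} [AddCommMonoid M] (f : Finset Λ → M) :
    ∑ B, ∑ A with H₀.hull A = B, f A = ∑ A, f A :=
  Finset.sum_fiberwise_of_maps_to (fun _ _ => Finset.mem_univ _) f

theorem total_swGen (V : Interaction q) : (swGen H₀ V).total = ∑ A, localGen H₀ A (V A) :=
  sum_sum_hull_eq H₀ _

theorem total_diagInter (V : Interaction q) :
    (diagInter H₀ V).total = ∑ A, localDiag H₀ A (V A) :=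
  sum_sum_hull_eq H₀ _

theorem norm_div_succ_le_one (n : ℕ) : ‖(n : ℂ) / ((n : ℂ) + 1)‖ ≤ 1 := by
  rw [norm_div]
  norm_cast
  exact div_le_one_of_le₀ (by exact_mod_cast Nat.le_succ n) (by positivity)

theorem norm_one_div_succ_le_one (n : ℕ) : ‖1 / ((n : ℂ) + 1)‖ ≤ 1 := by
  rw [norm_div]
  norm_cast
  exact div_le_one_of_le₀ (by exact_mod_cast Nat.succ_pos n) (by positivity)

theorem norm_mixedInter_le (V : Interaction q) (n : ℕ) (B : Finset Λ) :
    ‖mixedInter H₀ V n B‖ ≤ ‖V B‖ + ‖diagInter H₀ V B‖ := by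
  refine (norm_add_le _ _).trans (add_le_add ?_ ?_) <;> rw [norm_smul]
  · exact mul_le_of_le_one_left (norm_nonneg _) (norm_div_succ_le_one n)
  · exact mul_le_of_le_one_left (norm_nonneg _) (norm_one_div_succ_le_one n)

theorem summable_norm_residual (V : Interaction q) (B : Finset Λ) :
    Summable fun n : ℕ => ‖(((n + 1).factorial : ℂ)⁻¹) •
      ((Interaction.comm (swGen H₀ V))^[n + 1] (mixedInter H₀ V (n + 1))) B‖ := by
  have hs := ((summable_nat_add_iff 1).2 (Real.summable_pow_div_factorial
    (2 * ∑ B, ‖swGen H₀ V B‖))).mul_right (∑ B, (‖V B‖ + ‖diagInter H₀ V B‖))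
  refine Summable.of_nonneg_of_le (fun _ => norm_nonneg _) (fun n => ?_) hs
  rw [norm_smul, norm_inv, Complex.norm_natCast, div_eq_inv_mul, mul_assoc]
  refine mul_le_mul_of_nonneg_left ?_ (by positivity)
  refine (Finset.single_le_sum (f := fun B => ‖((Interaction.comm (swGen H₀ V))^[n + 1]
    (mixedInter H₀ V (n + 1))) B‖) (fun _ _ => norm_nonneg _) (Finset.mem_univ B)).trans ?_
  refine (Interaction.sum_norm_iterate_comm_le _ _ _).trans ?_
  exact mul_le_mul_of_nonneg_left (Finset.sum_le_sum fun B _ => norm_mixedInter_le H₀ V _ B)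
    (by positivity)

theorem total_residualInter (hgap : H₀.HasGap Δ) : (residualInter H₀ V.term).total =
    ∑' n : ℕ, (((n + 1).factorial : ℂ)⁻¹) • (adL (swGen H₀ V.term).total ^ (n + 1))
      (mixedInter H₀ V.term (n + 1)).total := by
  rw [Interaction.total]
  simp only [residualInter]
  rw [← Summable.tsum_finsetSum fun B _ => (summable_norm_residual H₀ V.term B).of_norm]
  refine tsum_congr fun n => ?_
  rw [← Finset.smul_sum, ← Interaction.total_iterate_comm (isLocal_swGen H₀ V hgap)
    (isLocal_mixedInter H₀ V (n + 1)), Interaction.total]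

theorem adL_swGen_ham (hgap : H₀.HasGap Δ) : adL (swGen H₀ V.term).total H₀.ham =
    (diagInter H₀ V.term).total - V.term.total := by
  rw [adL_apply, total_swGen, total_diagInter, Interaction.total, Finset.sum_mul, Finset.mul_sum,
    ← Finset.sum_sub_distrib, ← Finset.sum_sub_distrib]
  refine Finset.sum_congr rfl fun A _ => ?_
  have := H₀.ham_mul_localGen_sub hgap (V.isHermitian_term A) (V.supportedOn_term A)
  rw [← neg_sub, this, neg_sub]

/-- The local Schrieffer-Wolff transformation block-diagonalizes the Hamiltonian up to the residual
interaction. -/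
theorem exp_swGen_conj (hgap : H₀.HasGap Δ) :
    NormedSpace.exp (swGen H₀ V.term).total * (H₀.ham + V.term.total) *
        NormedSpace.exp (-(swGen H₀ V.term).total) =
      blockHam H₀ V.term + (residualInter H₀ V.term).total := by
  obtain ⟨T, hT⟩ : ∃ T, T = (swGen H₀ V.term).total := ⟨_, rfl⟩
  obtain ⟨W, hW⟩ : ∃ W, W = (diagInter H₀ V.term).total - V.term.total := ⟨_, rfl⟩
  have hb : blockHam H₀ V.term = H₀.ham + (diagInter H₀ V.term).total := by
    rw [total_diagInter]
    rfl
  have ha := adL_swGen_ham H₀ V hgap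
  rw [← hT, ← hW] at ha
  rw [total_residualInter H₀ V hgap, hb, ← hT, mul_add, add_mul]
  have h0 := hasSum_exp_conj T H₀.ham
  have h1 := hasSum_exp_conj T V.term.total
  -- The `H₀` series is shifted by two and the `V` series by one, because `ad_T H₀ = W` makes
  -- `ad_T^(n+2) H₀` and `ad_T^(n+1) V` of the same order in `V`. The removed terms `H₀ + W + V` add
  -- up to `H₁`.
  rw [← hasSum_nat_add_iff' 2] at h0
  rw [← hasSum_nat_add_iff' 1] at h1
  have h2 := h0.add h1
  have e : ∀ n : ℕ, (((n + 1).factorial : ℂ)⁻¹) • (adL T ^ (n + 1))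
      (mixedInter H₀ V.term (n + 1)).total =
      (((n + 2).factorial : ℂ)⁻¹) • (adL T ^ (n + 2)) H₀.ham +
      (((n + 1).factorial : ℂ)⁻¹) • (adL T ^ (n + 1)) V.term.total := by
    intro n
    -- The coefficient of `W` is the ratio of `1/(n+2)!` to `1/(n+1)!`, which is where the weights
    -- `n/(n+1)` and `1/(n+1)` in `V'` come from.
    have hm : (mixedInter H₀ V.term (n + 1)).total =
        V.term.total + (((n : ℂ) + 2)⁻¹) • W := by
      have hn : (n : ℂ) + 2 ≠ 0 := by exact_mod_cast (Nat.succ_ne_zero (n + 1))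
      have e1 : (((n + 1 : ℕ) : ℂ) / (((n + 1 : ℕ) : ℂ) + 1)) = 1 - ((n : ℂ) + 2)⁻¹ := by
        push_cast
        rw [show (n : ℂ) + 1 + 1 = n + 2 by ring]
        field_simp
        ring
      have e2 : (1 / (((n + 1 : ℕ) : ℂ) + 1)) = ((n : ℂ) + 2)⁻¹ := by
        push_cast
        rw [show (n : ℂ) + 1 + 1 = n + 2 by ring, one_div]
      rw [hW, Interaction.total, Interaction.total, Interaction.total]
      simp only [mixedInter, e1, e2]
      rw [Finset.sum_add_distrib, ← Finset.smul_sum, ← Finset.smul_sum, sub_smul, one_smul,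
        smul_sub]
      abel
    have e3 : (adL T ^ (n + 2)) H₀.ham = (adL T ^ (n + 1)) W := by
      rw [pow_succ, ← ha]
      rfl
    rw [hm, map_add, map_smul, e3, smul_add, smul_smul, add_comm]
    congr 2
    rw [Nat.factorial_succ (n + 1)]
    push_cast
    rw [mul_inv, mul_comm]
    congr 2
    ring
  simp only [e]
  rw [h2.tsum_eq]
  simp only [Finset.sum_range_succ, Finset.sum_range_zero, pow_zero, pow_one, Nat.factorial_zero,
    Nat.factorial_one, Nat.cast_one, inv_one, one_smul, ha, one_apply_eq_self, zero_add,
    hW]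
  abel

end Interactions

/-! ### Local interaction strength of commutators -/

section Strength

variable {Λ : Type*} [Fintype Λ] [DecidableEq Λ] {q : Λ → ℕ} {d k : ℕ}

section Norms

variable (L : LatticeGeometry d Λ) (Φ : Interaction q)

theorem sum_le_interNorm (μ : ℝ) (j : Λ) :
    ∑ A with j ∈ A, ‖Φ A‖ * Real.exp (μ * L.diam A) ≤ interNorm L μ Φ :=
  le_ciSup (f := fun j : Λ => ∑ A with j ∈ A, ‖Φ A‖ * Real.exp (μ * L.diam A))
    (Set.finite_range _).bddAbove j

theorem sum_le_starNorm (j : Λ) : ∑ A with j ∈ A, ‖Φ A‖ ≤ starNorm L Φ := by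
  have := sum_le_interNorm L Φ 0 j
  simpa [starNorm] using this

variable {L Φ} in
theorem starNorm_le {c : ℝ} (h : ∀ j, ∑ A with j ∈ A, ‖Φ A‖ ≤ c) : starNorm L Φ ≤ c := by
  have := L.connected.nonempty
  refine ciSup_le fun j => ?_
  simpa using h j

theorem interNorm_nonneg (μ : ℝ) : 0 ≤ interNorm L μ Φ :=
  Real.iSup_nonneg fun _ => Finset.sum_nonneg fun _ _ => by positivity

theorem starNorm_nonneg : 0 ≤ starNorm L Φ := interNorm_nonneg L Φ 0

end Norms

/-- A union bound over the sites of `S`. -/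
theorem sum_inter_nonempty_le {f : Finset Λ → ℝ} (hf : ∀ A, 0 ≤ f A) {c : ℝ}
    (h : ∀ j, ∑ A with j ∈ A, f A ≤ c) (S : Finset Λ) :
    ∑ A with (A ∩ S).Nonempty, f A ≤ S.card * c := by
  calc ∑ A with (A ∩ S).Nonempty, f A ≤ ∑ A, ∑ j ∈ S, if j ∈ A then f A else 0 := by
        rw [Finset.sum_filter]
        refine Finset.sum_le_sum fun A _ => ?_
        split_ifs with hA
        · obtain ⟨x, hx⟩ := hA
          rw [Finset.mem_inter] at hx
          have := Finset.single_le_sum (f := fun j => if j ∈ A then f A else 0)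
            (fun j _ => by split_ifs <;> simp [hf]) hx.2
          simpa [hx.1] using this
        · exact Finset.sum_nonneg fun j _ => by split_ifs <;> simp [hf]
    _ = ∑ j ∈ S, ∑ A with j ∈ A, f A := by
        rw [Finset.sum_comm]
        exact Finset.sum_congr rfl fun j _ => (Finset.sum_filter _ _).symm
    _ ≤ ∑ _j ∈ S, c := Finset.sum_le_sum fun j _ => h j
    _ = S.card * c := by rw [Finset.sum_const, nsmul_eq_mul]

/-- The terms of a commutator of interactions whose regions contain a given site, when the
interactions are sums over fibres of `h`, `h'`. -/
theorem sum_norm_comm_fiber_le (h h' : Finset Λ → Finset Λ) (τ σ : Finset Λ → Op q) (j : Λ) :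
    ∑ B with j ∈ B, ‖Interaction.comm (fun B => ∑ A with h A = B, τ A)
        (fun B => ∑ A with h' A = B, σ A) B‖ ≤
      ∑ A, ∑ A', if j ∈ h A ∪ h' A' ∧ (h A ∩ h' A').Nonempty then
        ‖τ A * σ A' - σ A' * τ A‖ else 0 := by
  have e : ∀ B, Interaction.comm (fun B => ∑ A with h A = B, τ A)
        (fun B => ∑ A with h' A = B, σ A) B = ∑ A, ∑ A',
        if h A ∪ h' A' = B ∧ (h A ∩ h' A').Nonempty then τ A * σ A' - σ A' * τ A else 0 := by
    intro B
    have h1 : ∀ C C', (if C ∪ C' = B ∧ (C ∩ C').Nonempty then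
        (∑ A with h A = C, τ A) * (∑ A with h' A = C', σ A) -
        (∑ A with h' A = C', σ A) * (∑ A with h A = C, τ A) else 0) =
        ∑ A with h A = C, ∑ A' with h' A' = C',
          if h A ∪ h' A' = B ∧ (h A ∩ h' A').Nonempty then τ A * σ A' - σ A' * τ A else 0 := by
      intro C C'
      have h2 : ∀ A ∈ Finset.univ.filter (fun A => h A = C),
          ∀ A' ∈ Finset.univ.filter (fun A' => h' A' = C'),
          (if h A ∪ h' A' = B ∧ (h A ∩ h' A').Nonempty then τ A * σ A' - σ A' * τ A else 0) =
          if C ∪ C' = B ∧ (C ∩ C').Nonempty then τ A * σ A' - σ A' * τ A else 0 := by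
        intro A hA A' hA'
        rw [(Finset.mem_filter.1 hA).2, (Finset.mem_filter.1 hA').2]
      rw [Finset.sum_congr rfl fun A hA => Finset.sum_congr rfl (h2 A hA)]
      split_ifs
      · rw [Finset.sum_mul_sum, Finset.sum_mul_sum]
        conv_lhs => rhs; rw [Finset.sum_comm]
        rw [← Finset.sum_sub_distrib]
        exact Finset.sum_congr rfl fun A _ => (Finset.sum_sub_distrib _ _).symm
      · simp
    rw [Interaction.comm, Finset.sum_congr rfl fun C _ => Finset.sum_congr rfl fun C' _ => h1 C C']
    rw [Finset.sum_congr rfl fun C _ => Finset.sum_comm,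
      Finset.sum_fiberwise_of_maps_to (fun _ _ => Finset.mem_univ _)]
    exact Finset.sum_congr rfl fun A _ =>
      Finset.sum_fiberwise_of_maps_to (fun _ _ => Finset.mem_univ _) _
  calc _ ≤ ∑ B with j ∈ B, ∑ A, ∑ A', if h A ∪ h' A' = B ∧ (h A ∩ h' A').Nonempty then
        ‖τ A * σ A' - σ A' * τ A‖ else 0 := by
        refine Finset.sum_le_sum fun B _ => ?_
        rw [e]
        refine (norm_sum_le _ _).trans (Finset.sum_le_sum fun A _ => (norm_sum_le _ _).trans
          (Finset.sum_le_sum fun A' _ => ?_))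
        split_ifs
        · exact le_rfl
        · exact norm_zero.le
    _ = _ := by
        rw [Finset.sum_comm]
        refine Finset.sum_congr rfl fun A _ => ?_
        rw [Finset.sum_comm]
        refine Finset.sum_congr rfl fun A' _ => ?_
        by_cases hn : (h A ∩ h' A').Nonempty
        · by_cases hj : j ∈ h A ∪ h' A'
          · simp only [hn, hj, and_true, if_true]
            rw [Finset.sum_ite_eq]
            simp only [Finset.mem_filter, Finset.mem_univ, true_and, hj, if_true]
          · simp only [hn, hj, and_true, if_false]
            rw [Finset.sum_ite_eq]
            simp only [Finset.mem_filter, Finset.mem_univ, true_and, hj, if_false]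
        · simp [hn]

theorem ite_le_ite_add_ite {a b n : ℝ} {p₁ p₂ p₃ p₄ : Prop} [Decidable p₁] [Decidable p₂]
    [Decidable p₃] [Decidable p₄] (hp : 0 ≤ a * b) (hn : n ≤ 2 * a * b)
    (h : ¬ p₃ → p₄ → n = 0) : (if (p₁ ∨ p₂) ∧ p₄ then n else 0) ≤
      (if p₁ then 2 * a * (if p₃ then b else 0) else 0) +
      (if p₂ then 2 * b * (if p₃ then a else 0) else 0) := by
  by_cases h3 : p₃
  · by_cases h1 : p₁ <;> by_cases h2 : p₂ <;> by_cases h4 : p₄ <;> simp [h1, h2, h3, h4] <;>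
      linarith
  · by_cases h4 : p₄
    · simp [h3, h4, h h3 h4]
    · simp [h3, h4]

/-- A pair counts only if `j` lies in one of the two regions; that region is summed with `F₀` or
`G₀`, its partner with `G₁` or `F₁`. The relation `r` may be narrower than overlap as long as the
commutator vanishes outside it. The partner bounds are required only where the fixed term is
nonzero, so that size limits on the regions can be used. -/
theorem sum_pairs_le {r : Finset Λ → Finset Λ → Prop} [∀ A A', Decidable (r A A')]
    {h h' : Finset Λ → Finset Λ} {N : Finset Λ → Finset Λ → ℝ} {f g : Finset Λ → ℝ} {j : Λ}
    (hf : ∀ A, 0 ≤ f A) (hg : ∀ A, 0 ≤ g A)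
    (hN : ∀ A A', N A A' ≤ 2 * f A * g A')
    (hr : ∀ A A', ¬ r A A' → (h A ∩ h' A').Nonempty → N A A' = 0) {F₀ F₁ G₀ G₁ : ℝ} (hF₁ : 0 ≤ F₁)
    (hG₁ : 0 ≤ G₁)
    (hF : ∑ A with j ∈ h A, f A ≤ F₀) (hG : ∑ A with j ∈ h' A, g A ≤ G₀)
    (hG' : ∀ A, f A ≠ 0 → ∑ A' with r A A', g A' ≤ G₁)
    (hF' : ∀ A', g A' ≠ 0 → ∑ A with r A A', f A ≤ F₁) :
    ∑ A, ∑ A', (if j ∈ h A ∪ h' A' ∧ (h A ∩ h' A').Nonempty then N A A' else 0) ≤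
      2 * F₀ * G₁ + 2 * G₀ * F₁ := by
  have hp : ∀ A A', 0 ≤ f A * g A' := fun A A' => mul_nonneg (hf A) (hg A')
  have h1 : ∀ A A', (if j ∈ h A ∪ h' A' ∧ (h A ∩ h' A').Nonempty then N A A' else 0) ≤
      (if j ∈ h A then 2 * f A * (if r A A' then g A' else 0) else 0) +
      (if j ∈ h' A' then 2 * g A' * (if r A A' then f A else 0) else 0) := by
    intro A A'
    simp only [Finset.mem_union]
    exact ite_le_ite_add_ite (hp A A') (hN A A') (hr A A')
  have h2 : ∑ A, ∑ A', (if j ∈ h A then 2 * f A * (if r A A' then g A' else 0) else 0) ≤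
      2 * F₀ * G₁ := by
    calc _ = ∑ A with j ∈ h A, 2 * f A * ∑ A' with r A A', g A' := by
          rw [Finset.sum_filter]
          refine Finset.sum_congr rfl fun A _ => ?_
          split_ifs
          · rw [Finset.sum_filter, Finset.mul_sum]
          · exact Finset.sum_const_zero
      _ ≤ ∑ A with j ∈ h A, 2 * f A * G₁ := by
          refine Finset.sum_le_sum fun A _ => ?_
          by_cases h0 : f A = 0
          · simp [h0]
          · exact mul_le_mul_of_nonneg_left (hG' A h0) (by linarith [hf A])
      _ = 2 * (∑ A with j ∈ h A, f A) * G₁ := by rw [Finset.mul_sum, Finset.sum_mul]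
      _ ≤ _ := by nlinarith
  have h3 : ∑ A, ∑ A', (if j ∈ h' A' then 2 * g A' * (if r A A' then f A else 0) else 0) ≤
      2 * G₀ * F₁ := by
    rw [Finset.sum_comm]
    calc _ = ∑ A' with j ∈ h' A', 2 * g A' * ∑ A with r A A', f A := by
          rw [Finset.sum_filter]
          refine Finset.sum_congr rfl fun A _ => ?_
          split_ifs
          · rw [Finset.sum_filter, Finset.mul_sum]
          · exact Finset.sum_const_zero
      _ ≤ ∑ A' with j ∈ h' A', 2 * g A' * F₁ := by
          refine Finset.sum_le_sum fun A _ => ?_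
          by_cases h0 : g A = 0
          · simp [h0]
          · exact mul_le_mul_of_nonneg_left (hF' A h0) (by linarith [hg A])
      _ = 2 * (∑ A' with j ∈ h' A', g A') * F₁ := by rw [Finset.mul_sum, Finset.sum_mul]
      _ ≤ _ := by nlinarith
  calc _ ≤ _ := Finset.sum_le_sum fun A _ => Finset.sum_le_sum fun A' _ => h1 A A'
    _ = _ := by
      rw [Finset.sum_congr rfl fun A _ => Finset.sum_add_distrib, Finset.sum_add_distrib]
    _ ≤ _ := add_le_add h2 h3

/-- The terms on regions with more than `a` sites vanish. -/
def Interaction.SizeLE (a : ℕ) (Φ : Interaction q) : Prop := ∀ A, a < A.card → Φ A = 0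

theorem Interaction.SizeLE.comm {a b : ℕ} {Φ Ψ : Interaction q} (hΦ : Φ.SizeLE a)
    (hΨ : Ψ.SizeLE b) : (Interaction.comm Φ Ψ).SizeLE (a + b) := by
  intro B hB
  refine Finset.sum_eq_zero fun A _ => Finset.sum_eq_zero fun A' _ => ?_
  split_ifs with h
  · have hc := Finset.card_union_le A A'
    rw [h.1] at hc
    rcases lt_or_ge a A.card with h1 | h1
    · simp [hΦ A h1]
    · simp [hΨ A' (by omega)]
  · rfl

theorem Interaction.SizeLE.iterate_comm {a b : ℕ} {Φ Ψ : Interaction q} (hΦ : Φ.SizeLE a)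
    (hΨ : Ψ.SizeLE b) (n : ℕ) : ((Interaction.comm Φ)^[n] Ψ).SizeLE (n * a + b) := by
  induction n with
  | zero => simpa using hΨ
  | succ n ih =>
    rw [Function.iterate_succ_apply', show (n + 1) * a + b = a + (n * a + b) by ring]
    exact hΦ.comm ih

theorem starNorm_comm_le (L : LatticeGeometry d Λ) {a b : ℕ} {Φ Ψ : Interaction q}
    (hΦ : Φ.SizeLE a) (hΨ : Ψ.SizeLE b) : starNorm L (Interaction.comm Φ Ψ) ≤
      2 * (a + b) * starNorm L Φ * starNorm L Ψ := by
  refine starNorm_le fun j => ?_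
  have h1 := sum_norm_comm_fiber_le id id Φ Ψ j
  simp only [id, Finset.sum_filter, Finset.sum_ite_eq', Finset.mem_univ, if_true] at h1
  rw [Finset.sum_filter]
  refine h1.trans ?_
  have hs : ∀ {c : ℕ} {Θ : Interaction q} (Ξ : Interaction q) (_ : Θ.SizeLE c) (A : Finset Λ),
      ‖Θ A‖ ≠ 0 → ∑ A' with (A' ∩ A).Nonempty, ‖Ξ A'‖ ≤ c * starNorm L Ξ := by
    intro c Θ Ξ hΘ A hA
    refine (sum_inter_nonempty_le (fun _ => norm_nonneg _) (sum_le_starNorm L Ξ) A).trans ?_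
    refine mul_le_mul_of_nonneg_right ?_ (starNorm_nonneg L Ξ)
    by_contra hc
    push Not at hc
    exact hA (by rw [hΘ A (by exact_mod_cast hc), norm_zero])
  refine (sum_pairs_le (r := fun A A' => (A' ∩ A).Nonempty) (h := id) (h' := id)
    (N := fun A A' => ‖Φ A * Ψ A' - Ψ A' * Φ A‖) (fun _ => norm_nonneg _)
    (fun _ => norm_nonneg _) (fun A A' => Interaction.norm_commutator_le _ _)
    (fun A A' hr hn => absurd (by rwa [Finset.inter_comm] at hn) hr)
    (mul_nonneg (Nat.cast_nonneg b) (starNorm_nonneg L Φ))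
    (mul_nonneg (Nat.cast_nonneg a) (starNorm_nonneg L Ψ))
    (sum_le_starNorm L Φ j) (sum_le_starNorm L Ψ j) (fun A hA => hs Ψ hΦ A hA)
    (fun A' hA' => ?_)).trans (le_of_eq (by ring))
  simp only [Finset.inter_comm A']
  exact hs Φ hΨ A' hA'

/-- After `n` commutators a region has at most `(n+1) a` sites, so the next commutator costs `2 a
(n+2)` times the strength of `Φ`; the product of these factors is the factorial. -/
theorem starNorm_iterate_comm_le (L : LatticeGeometry d Λ) {a : ℕ} {Φ Ψ : Interaction q}
    (hΦ : Φ.SizeLE a) (hΨ : Ψ.SizeLE a) (n : ℕ) : starNorm L ((Interaction.comm Φ)^[n] Ψ) ≤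
      (2 * a * starNorm L Φ) ^ n * (n + 1).factorial * starNorm L Ψ := by
  have h0 := starNorm_nonneg L Φ
  induction n with
  | zero => simp
  | succ n ih =>
    rw [Function.iterate_succ_apply']
    refine (starNorm_comm_le L hΦ (hΦ.iterate_comm hΨ n)).trans ?_
    refine (mul_le_mul_of_nonneg_left ih (by positivity)).trans (le_of_eq ?_)
    rw [Nat.factorial_succ (n + 1)]
    push_cast
    ring

namespace CommutingHamiltonian

variable (H₀ : CommutingHamiltonian q)

theorem card_hull_singleton_le (j : Λ) : (H₀.hull {j}).card ≤ H₀.w := by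
  have e : H₀.hull {j} = (Finset.univ.filter (fun j' => j ∈ H₀.region j')).biUnion H₀.region := by
    rw [hull, meets]
    congr 2
    ext j'
    rw [Finset.inter_singleton]
    split_ifs with h <;> simp [h]
  rw [e]
  exact Finset.le_sup (f := fun j => ((Finset.univ.filter (fun j' => j ∈ H₀.region j')).biUnion
    H₀.region).card) (Finset.mem_univ j)

theorem card_hull_le {A : Finset Λ} (hA : A.card ≤ k) : (H₀.hull A).card ≤ H₀.u k :=
  Finset.le_sup (f := fun A => (H₀.hull A).card)
    (Finset.mem_filter.2 ⟨Finset.mem_univ A, hA⟩)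

theorem mem_hull_iff_inter {A : Finset Λ} {j : Λ} :
    j ∈ H₀.hull A ↔ (A ∩ H₀.hull {j}).Nonempty := by
  rw [← H₀.hull_inter_nonempty_comm, Finset.inter_singleton]
  split_ifs with h <;> simp [h]

theorem one_le_w (j : Λ) : 1 ≤ H₀.w :=
  (Finset.card_pos.2 ⟨j, H₀.subset_hull _ (Finset.mem_singleton_self j)⟩).trans_le
    (H₀.card_hull_singleton_le j)

/-- `j` lies in the hull of `A` exactly when `A` meets the hull of `{j}`, which has at most `w`
sites. -/
theorem sum_mem_hull_le {f : Finset Λ → ℝ} (hf : ∀ A, 0 ≤ f A) {c : ℝ}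
    (h : ∀ j, ∑ A with j ∈ A, f A ≤ c) (j : Λ) : ∑ A with j ∈ H₀.hull A, f A ≤ H₀.w * c := by
  have hc : 0 ≤ c := (Finset.sum_nonneg fun A _ => hf A).trans (h j)
  simp only [H₀.mem_hull_iff_inter (j := j)]
  refine (sum_inter_nonempty_le hf h _).trans (mul_le_mul_of_nonneg_right ?_ hc)
  exact_mod_cast H₀.card_hull_singleton_le j

theorem sum_mem_hull_fiber_le (τ : Finset Λ → Op q) {f : Finset Λ → ℝ} (hf : ∀ A, ‖τ A‖ ≤ f A)
    {c : ℝ} (h : ∀ j, ∑ A with j ∈ A, f A ≤ c) (j : Λ) :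
    ∑ B with j ∈ B, ‖∑ A with H₀.hull A = B, τ A‖ ≤ H₀.w * c := by
  calc _ ≤ ∑ B with j ∈ B, ∑ A with H₀.hull A = B, f A :=
        Finset.sum_le_sum fun B _ => (norm_sum_le _ _).trans (Finset.sum_le_sum fun A _ => hf A)
    _ = ∑ A with j ∈ H₀.hull A, f A := by
        rw [Finset.sum_filter, Finset.sum_filter,
          ← sum_sum_hull_eq H₀ fun A => if j ∈ H₀.hull A then f A else 0]
        refine Finset.sum_congr rfl fun B _ => ?_
        split_ifs with hB
        · exact Finset.sum_congr rfl fun A hA => by rw [(Finset.mem_filter.1 hA).2, if_pos hB]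
        · exact (Finset.sum_eq_zero fun A hA => by
            rw [(Finset.mem_filter.1 hA).2, if_neg hB]).symm
    _ ≤ _ := H₀.sum_mem_hull_le (fun A => (norm_nonneg _).trans (hf A)) h j

end CommutingHamiltonian

variable {L : LatticeGeometry d Λ} (H₀ : CommutingHamiltonian q)
  (V : LocalPerturbation L q k) {Δ : ℝ}

theorem sum_norm_div_le (V : Interaction q) (hΔ : 0 < Δ) (j : Λ) :
    ∑ A with j ∈ A, ‖V A‖ / Δ ≤ starNorm L V / Δ := by
  rw [← Finset.sum_div]
  exact div_le_div_of_nonneg_right (sum_le_starNorm L V j) hΔ.le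

theorem starNorm_swGen_le (hgap : H₀.HasGap Δ) :
    starNorm L (swGen H₀ V.term) ≤ H₀.w * starNorm L V.term / Δ := by
  refine starNorm_le fun j => ?_
  rw [mul_div_assoc]
  exact H₀.sum_mem_hull_fiber_le _ (fun A => H₀.norm_localGen_le hgap (V.isHermitian_term A))
    (sum_norm_div_le V.term hgap.1) j

theorem starNorm_diagInter_le (V : Interaction q) :
    starNorm L (diagInter H₀ V) ≤ H₀.w * starNorm L V :=
  starNorm_le fun j => H₀.sum_mem_hull_fiber_le _ (fun A => H₀.norm_localDiag_le A (V A))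
    (sum_le_starNorm L V) j

theorem card_le_of_term_ne_zero {A : Finset Λ} (hA : V.term A ≠ 0) :
    (H₀.hull A).card ≤ H₀.u k := by
  refine H₀.card_hull_le ?_
  by_contra h
  exact hA (V.term_eq_zero_of_card A (not_le.1 h))

theorem sizeLE_term : V.term.SizeLE (H₀.u k) := by
  intro A hA
  by_contra h
  exact absurd (card_le_of_term_ne_zero H₀ V h)
    (not_le.2 (hA.trans_le (Finset.card_le_card (H₀.subset_hull A))))

theorem localDiag_zero (A : Finset Λ) : localDiag H₀ A 0 = 0 := by simp [localDiag]

theorem localGen_zero (A : Finset Λ) : localGen H₀ A 0 = 0 := by simp [localGen]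

theorem sizeLE_hull_fiber {τ : Finset Λ → Op q} (h : ∀ A, V.term A = 0 → τ A = 0) :
    Interaction.SizeLE (H₀.u k) fun B => ∑ A with H₀.hull A = B, τ A := by
  intro B hB
  refine Finset.sum_eq_zero fun A hA => h A ?_
  by_contra h0
  have := card_le_of_term_ne_zero H₀ V h0
  rw [(Finset.mem_filter.1 hA).2] at this
  exact absurd this (not_le.2 hB)

theorem sizeLE_swGen : (swGen H₀ V.term).SizeLE (H₀.u k) :=
  sizeLE_hull_fiber H₀ V fun A hA => by rw [hA, localGen_zero]

theorem sizeLE_mixedInter (n : ℕ) : (mixedInter H₀ V.term n).SizeLE (H₀.u k) := by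
  intro B hB
  have h1 : diagInter H₀ V.term B = 0 :=
    sizeLE_hull_fiber H₀ V (fun A hA => by rw [hA, localDiag_zero]) B hB
  rw [mixedInter, sizeLE_term H₀ V B hB, h1, smul_zero, smul_zero, add_zero]

theorem starNorm_mixedInter_le (V : Interaction q) (n : ℕ) :
    starNorm L (mixedInter H₀ V n) ≤ (1 + H₀.w) * starNorm L V := by
  refine starNorm_le fun j => ?_
  refine (Finset.sum_le_sum fun B _ => norm_mixedInter_le H₀ V n B).trans ?_
  rw [Finset.sum_add_distrib, one_add_mul]
  exact add_le_add (sum_le_starNorm L V j)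
    ((sum_le_starNorm L _ j).trans (starNorm_diagInter_le H₀ V))

theorem sum_inter_hull_le {f : Finset Λ → ℝ} (hf : ∀ A, 0 ≤ f A) {c : ℝ} (hc : 0 ≤ c)
    (h : ∀ j, ∑ A with j ∈ A, f A ≤ c) {A : Finset Λ} (hA : V.term A ≠ 0) :
    ∑ A' with (A' ∩ H₀.hull A).Nonempty, f A' ≤ H₀.u k * c := by
  refine (sum_inter_nonempty_le hf h _).trans (mul_le_mul_of_nonneg_right ?_ hc)
  exact_mod_cast card_le_of_term_ne_zero H₀ V hA

/-- In either order the partner must meet a hull of at most `u` sites. The two orders contribute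
`2wu` and `2u`, and `1 ≤ w` merges them into `4wu`. -/
theorem sum_norm_comm_swGen_term_le (hgap : H₀.HasGap Δ) (j : Λ) :
    ∑ B with j ∈ B, ‖Interaction.comm (swGen H₀ V.term) V.term B‖ ≤
      4 * H₀.w * H₀.u k * starNorm L V.term ^ 2 / Δ := by
  have hΔ := hgap.1
  have hV := starNorm_nonneg L V.term
  have h1 := sum_norm_comm_fiber_le H₀.hull id (fun A => localGen H₀ A (V.term A)) V.term j
  have e : (fun B => ∑ A with id A = B, V.term A) = V.term := by
    ext1 B
    simp [Finset.sum_filter]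
  rw [e] at h1
  refine h1.trans ?_
  have hw : (1 : ℝ) ≤ H₀.w := by exact_mod_cast H₀.one_le_w j
  refine (sum_pairs_le (r := fun A A' => (A' ∩ H₀.hull A).Nonempty) (h := H₀.hull) (h' := id)
    (N := fun A A' => ‖localGen H₀ A (V.term A) * V.term A' -
      V.term A' * localGen H₀ A (V.term A)‖)
    (f := fun A => ‖V.term A‖ / Δ) (g := fun A => ‖V.term A‖)
    (F₀ := H₀.w * (starNorm L V.term / Δ)) (G₁ := H₀.u k * starNorm L V.term)
    (G₀ := starNorm L V.term) (F₁ := H₀.u k * (starNorm L V.term / Δ))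
    (fun _ => by positivity) (fun _ => norm_nonneg _) (fun A A' => ?_)
    (fun A A' hr hn => absurd (by rwa [Finset.inter_comm] at hn) hr)
    (by positivity) (by positivity)
    (H₀.sum_mem_hull_le (fun _ => by positivity) (sum_norm_div_le V.term hΔ) j)
    (sum_le_starNorm L V.term j) (fun A hA => ?_) (fun A' hA' => ?_)).trans ?_
  · refine (Interaction.norm_commutator_le _ _).trans ?_
    have := H₀.norm_localGen_le (A := A) hgap (V.isHermitian_term A)
    gcongr
  · exact sum_inter_hull_le H₀ V (fun _ => norm_nonneg _) hV (sum_le_starNorm L V.term)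
      (fun h0 => hA (by simp [h0]))
  · simp only [Finset.inter_comm A', H₀.hull_inter_nonempty_comm]
    exact sum_inter_hull_le H₀ V (fun _ => by positivity) (by positivity)
      (sum_norm_div_le V.term hΔ) (fun h0 => hA' (by simp [h0]))
  · have : 0 ≤ H₀.u k * starNorm L V.term ^ 2 / Δ := by positivity
    have e1 : 2 * (↑H₀.w * (starNorm L V.term / Δ)) * (↑(H₀.u k) * starNorm L V.term) +
        2 * starNorm L V.term * (↑(H₀.u k) * (starNorm L V.term / Δ)) =
        (2 * H₀.w + 2) * (H₀.u k * starNorm L V.term ^ 2 / Δ) := by ring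
    have e2 : 4 * H₀.w * H₀.u k * starNorm L V.term ^ 2 / Δ =
        (4 * H₀.w) * (H₀.u k * starNorm L V.term ^ 2 / Δ) := by ring
    rw [e1, e2]
    exact mul_le_mul_of_nonneg_right (by linarith) this

/-- Although both factors live on hulls, their commutator vanishes unless the hull of `A` meets `A'`
itself (`commute_localGen_localDiag`). Counting these pairs instead of overlapping hulls keeps the
constant at `4wu`. -/
theorem sum_norm_comm_swGen_diagInter_le (hgap : H₀.HasGap Δ) (j : Λ) :
    ∑ B with j ∈ B, ‖Interaction.comm (swGen H₀ V.term) (diagInter H₀ V.term) B‖ ≤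
      4 * H₀.w * H₀.u k * starNorm L V.term ^ 2 / Δ := by
  have hΔ := hgap.1
  have hV := starNorm_nonneg L V.term
  refine (sum_norm_comm_fiber_le H₀.hull H₀.hull (fun A => localGen H₀ A (V.term A))
    (fun A => localDiag H₀ A (V.term A)) j).trans ?_
  refine (sum_pairs_le (r := fun A A' => (A' ∩ H₀.hull A).Nonempty) (h := H₀.hull) (h' := H₀.hull)
    (N := fun A A' => ‖localGen H₀ A (V.term A) * localDiag H₀ A' (V.term A') -
      localDiag H₀ A' (V.term A') * localGen H₀ A (V.term A)‖)
    (f := fun A => ‖V.term A‖ / Δ) (g := fun A => ‖V.term A‖)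
    (F₀ := H₀.w * (starNorm L V.term / Δ)) (G₁ := H₀.u k * starNorm L V.term)
    (G₀ := H₀.w * starNorm L V.term) (F₁ := H₀.u k * (starNorm L V.term / Δ))
    (fun _ => by positivity) (fun _ => norm_nonneg _) (fun A A' => ?_)
    (fun A A' hr _ => ?_)
    (by positivity) (by positivity)
    (H₀.sum_mem_hull_le (fun _ => by positivity) (sum_norm_div_le V.term hΔ) j)
    (H₀.sum_mem_hull_le (fun _ => norm_nonneg _) (sum_le_starNorm L V.term) j)
    (fun A hA => ?_) (fun A' hA' => ?_)).trans (le_of_eq (by ring))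
  · refine (Interaction.norm_commutator_le _ _).trans ?_
    have h1 := H₀.norm_localGen_le (A := A) hgap (V.isHermitian_term A)
    have h2 := H₀.norm_localDiag_le A' (V.term A')
    gcongr
  · rw [Finset.inter_comm] at hr
    rw [(H₀.commute_localGen_localDiag hgap (V.isHermitian_term A) (V.supportedOn_term A)
      (V.supportedOn_term A') hr).eq, sub_self, norm_zero]
  · exact sum_inter_hull_le H₀ V (fun _ => norm_nonneg _) hV (sum_le_starNorm L V.term)
      (fun h0 => hA (by simp [h0]))
  · simp only [Finset.inter_comm A', H₀.hull_inter_nonempty_comm]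
    exact sum_inter_hull_le H₀ V (fun _ => by positivity) (by positivity)
      (sum_norm_div_le V.term hΔ) (fun h0 => hA' (by simp [h0]))

theorem sum_norm_comm_mixedInter_one_le (hgap : H₀.HasGap Δ) (j : Λ) :
    ∑ B with j ∈ B, ‖Interaction.comm (swGen H₀ V.term) (mixedInter H₀ V.term 1) B‖ ≤
      4 * H₀.w * H₀.u k * starNorm L V.term ^ 2 / Δ := by
  have h1 := sum_norm_comm_swGen_term_le H₀ V hgap j
  have h2 := sum_norm_comm_swGen_diagInter_le H₀ V hgap j
  have e : ∀ B, Interaction.comm (swGen H₀ V.term) (mixedInter H₀ V.term 1) B =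
      (1 / 2 : ℂ) • Interaction.comm (swGen H₀ V.term) V.term B +
      (1 / 2 : ℂ) • Interaction.comm (swGen H₀ V.term) (diagInter H₀ V.term) B := by
    intro B
    simp only [Interaction.comm, Finset.smul_sum]
    rw [← Finset.sum_add_distrib]
    refine Finset.sum_congr rfl fun A _ => ?_
    rw [← Finset.sum_add_distrib]
    refine Finset.sum_congr rfl fun A' _ => ?_
    split_ifs
    · have e1 : ((1 : ℕ) : ℂ) / (((1 : ℕ) : ℂ) + 1) = 1 / 2 := by norm_num
      have e2 : 1 / (((1 : ℕ) : ℂ) + 1) = 1 / 2 := by norm_num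
      rw [mixedInter, e1, e2, mul_add, add_mul, mul_smul_comm, smul_mul_assoc, mul_smul_comm,
        smul_mul_assoc, smul_sub, smul_sub]
      abel
    · simp
  have h3 : ∀ B, ‖Interaction.comm (swGen H₀ V.term) (mixedInter H₀ V.term 1) B‖ ≤
      (1 / 2) * ‖Interaction.comm (swGen H₀ V.term) V.term B‖ +
      (1 / 2) * ‖Interaction.comm (swGen H₀ V.term) (diagInter H₀ V.term) B‖ := by
    intro B
    rw [e]
    refine (norm_add_le _ _).trans (le_of_eq ?_)
    rw [norm_smul, norm_smul]
    norm_num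
  refine (Finset.sum_le_sum fun B _ => h3 B).trans ?_
  rw [Finset.sum_add_distrib, ← Finset.mul_sum, ← Finset.mul_sum]
  linarith

end Strength

/-! ### The residual interaction is of second order -/

section Residual

variable {Λ : Type*} [Fintype Λ] [DecidableEq Λ] {q : Λ → ℕ} {d k : ℕ}

variable {L : LatticeGeometry d Λ} (H₀ : CommutingHamiltonian q)
  (V : LocalPerturbation L q k) {Δ : ℝ}

theorem hasSum_add_three_mul_geometric : HasSum (fun n : ℕ => ((n : ℝ) + 3) * (1 / 2) ^ n) 8 := by
  have h1 := hasSum_coe_mul_geometric_of_norm_lt_one (r := (1 / 2 : ℝ)) (by norm_num)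
  have h2 := (hasSum_geometric_two).mul_left 3
  have h3 := h1.add h2
  rw [show (8 : ℝ) = 1 / 2 / (1 - 1 / 2) ^ 2 + 3 * 2 by norm_num]
  simpa only [add_mul] using h3

/-- The quotient `(n+3)!/(n+2)!` leaves only a linear factor. Two powers of `y` are kept as the
small parameter, and the others are bounded by powers of `1/2`. -/
theorem inv_factorial_mul_le {n : ℕ} {x y m M S : ℝ} (hy : 0 ≤ y) (hyx : y ≤ x) (hx : x ≤ 1 / 2)
    (hm : 0 ≤ m) (hmM : m ≤ M) (hS : S ≤ y ^ (n + 2) * (n + 2 + 1).factorial * m) :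
    ((n + 2).factorial : ℝ)⁻¹ * S ≤ ((n : ℝ) + 3) * (1 / 2) ^ n * (x ^ 2 * M) := by
  have h0 : ((n + 2).factorial : ℝ) ≠ 0 := by positivity
  have hx0 : 0 ≤ x := hy.trans hyx
  have hM : 0 ≤ M := hm.trans hmM
  calc ((n + 2).factorial : ℝ)⁻¹ * S
      ≤ ((n + 2).factorial : ℝ)⁻¹ * (y ^ (n + 2) * (n + 2 + 1).factorial * m) := by gcongr
    _ = ((n : ℝ) + 3) * y ^ n * (y ^ 2 * m) := by
        rw [Nat.factorial_succ (n + 2)]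
        push_cast
        field_simp
        ring
    _ ≤ ((n : ℝ) + 3) * (1 / 2) ^ n * (x ^ 2 * M) := by
        gcongr
        exact hyx.trans hx

/-- The residual interaction is of second order in the perturbation. -/
theorem starNorm_residualInter_le (hgap : H₀.HasGap Δ) {K : ℝ}
    (hK : K = 8 * H₀.u k * H₀.w * (1 + H₀.w) + 4 * H₀.u k * H₀.w)
    (hVΔ : K * starNorm L V.term ≤ Δ) : starNorm L (residualInter H₀ V.term) ≤
      4 * H₀.w * H₀.u k * starNorm L V.term ^ 2 / Δ * (1 + K * (starNorm L V.term / Δ)) := by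
  have hΔ := hgap.1
  have hV := starNorm_nonneg L V.term
  obtain ⟨x, hx⟩ : ∃ x, x = 2 * H₀.u k * (H₀.w * starNorm L V.term / Δ) := ⟨_, rfl⟩
  have hx0 : 0 ≤ x := by rw [hx]; positivity
  -- This uses the summand `4uw` of `K`.
  have hx1 : x ≤ 1 / 2 := by
    have e : x = (2 * H₀.u k * H₀.w * starNorm L V.term) / Δ := by rw [hx]; ring
    rw [e, div_le_iff₀ hΔ]
    have : 0 ≤ 8 * H₀.u k * H₀.w * (1 + H₀.w) * starNorm L V.term := by positivity
    rw [hK] at hVΔ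
    linarith
  refine starNorm_le fun j => ?_
  obtain ⟨r, hr⟩ : ∃ r : ℕ → ℝ, r = fun n => ∑ B with j ∈ B, ‖(((n + 1).factorial : ℂ)⁻¹) •
    ((Interaction.comm (swGen H₀ V.term))^[n + 1] (mixedInter H₀ V.term (n + 1))) B‖ := ⟨_, rfl⟩
  have hsum : ∀ B, Summable fun n : ℕ => ‖(((n + 1).factorial : ℂ)⁻¹) •
    ((Interaction.comm (swGen H₀ V.term))^[n + 1] (mixedInter H₀ V.term (n + 1))) B‖ :=
    summable_norm_residual H₀ V.term
  have hrs : Summable r := by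
    rw [hr]
    exact summable_sum fun B _ => hsum B
  have h1 : ∑ B with j ∈ B, ‖residualInter H₀ V.term B‖ ≤ ∑' n, r n := by
    rw [hr, Summable.tsum_finsetSum fun B _ => hsum B]
    exact Finset.sum_le_sum fun B _ => norm_tsum_le_tsum_norm (hsum B)
  -- Index `0` is the single commutator, which gets the sharp constant; the general factorial bound
  -- is used only from the double commutator on.
  have h2 : r 0 ≤ 4 * H₀.w * H₀.u k * starNorm L V.term ^ 2 / Δ := by
    rw [hr]
    simpa using sum_norm_comm_mixedInter_one_le H₀ V hgap j
  have h3 : ∀ n, r (n + 1) ≤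
      ((n : ℝ) + 3) * (1 / 2) ^ n * (x ^ 2 * ((1 + H₀.w) * starNorm L V.term)) := by
    intro n
    have h4 : r (n + 1) ≤ (((n + 2).factorial : ℝ)⁻¹) * starNorm L
        ((Interaction.comm (swGen H₀ V.term))^[n + 2] (mixedInter H₀ V.term (n + 2))) := by
      rw [hr]
      simp only [norm_smul, norm_inv, Complex.norm_natCast]
      rw [← Finset.mul_sum]
      exact mul_le_mul_of_nonneg_left (sum_le_starNorm L _ j) (by positivity)
    have h5 := starNorm_iterate_comm_le L (sizeLE_swGen H₀ V) (sizeLE_mixedInter H₀ V (n + 2))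
      (n + 2)
    have h6 : 2 * H₀.u k * starNorm L (swGen H₀ V.term) ≤ x := by
      rw [hx]
      exact mul_le_mul_of_nonneg_left (starNorm_swGen_le H₀ V hgap) (by positivity)
    have h7 : 0 ≤ 2 * H₀.u k * starNorm L (swGen H₀ V.term) :=
      mul_nonneg (by positivity) (starNorm_nonneg L _)
    have h8 := starNorm_mixedInter_le (L := L) H₀ V.term (n + 2)
    have h9 : 0 ≤ starNorm L (mixedInter H₀ V.term (n + 2)) := starNorm_nonneg L _
    exact h4.trans (inv_factorial_mul_le h7 h6 hx1 h9 h8 h5)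
  have h10 : ∑' n, r n ≤ 4 * H₀.w * H₀.u k * starNorm L V.term ^ 2 / Δ +
      8 * (x ^ 2 * ((1 + H₀.w) * starNorm L V.term)) := by
    rw [hrs.tsum_eq_zero_add]
    refine add_le_add h2 ?_
    exact hasSum_le h3 ((summable_nat_add_iff 1).2 hrs).hasSum
      (hasSum_add_three_mul_geometric.mul_right _)
  refine h1.trans (h10.trans ?_)
  -- Relative to the leading term, the tail is `8uw(1+w)‖V‖⋆/Δ`; this is the other summand of `K`.
  have e1 : 8 * (x ^ 2 * ((1 + H₀.w) * starNorm L V.term)) =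
      4 * H₀.w * H₀.u k * starNorm L V.term ^ 2 / Δ *
        ((8 * H₀.u k * H₀.w * (1 + H₀.w)) * (starNorm L V.term / Δ)) := by
    rw [hx]
    field_simp
    ring
  rw [e1, mul_one_add (4 * (H₀.w : ℝ) * H₀.u k * starNorm L V.term ^ 2 / Δ)]
  refine (add_le_add_iff_left _).2 (mul_le_mul_of_nonneg_left ?_ ?_)
  swap
  · positivity
  rw [hK]
  refine mul_le_mul_of_nonneg_right ?_ (by positivity)
  have : (0 : ℝ) ≤ 4 * H₀.u k * H₀.w := by positivity
  linarith

end Residual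

/-! ### The polynomial `p_κ` as an exponentially weighted series -/

section GeometricPolynomial

theorem summable_pow_mul_exp (r : ℝ) (m l : ℕ) {s : ℝ} (hs : 0 < s) :
    Summable fun n : ℕ => ((n : ℝ) + 1) ^ l * |r + (n + 1)| ^ m * Real.exp (-(s * (n + 1))) := by
  have h1 := (summable_nat_add_iff 1).2 (Real.summable_pow_mul_exp_neg_nat_mul (l + m) hs)
  refine Summable.of_nonneg_of_le (fun n => by positivity) (fun n => ?_)
    (h1.mul_left ((|r| + 1) ^ m))
  have h2 : |r + (n + 1)| ≤ (|r| + 1) * (n + 1) := by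
    have := abs_add_le r ((n : ℝ) + 1)
    have h3 : |(n : ℝ) + 1| = n + 1 := abs_of_nonneg (by positivity)
    have h4 : 0 ≤ |r| * n := by positivity
    rw [h3] at this
    linarith
  calc ((n : ℝ) + 1) ^ l * |r + (n + 1)| ^ m * Real.exp (-(s * (n + 1)))
      ≤ ((n : ℝ) + 1) ^ l * ((|r| + 1) * (n + 1)) ^ m * Real.exp (-(s * (n + 1))) := by gcongr
    _ = _ := by
      push_cast
      rw [mul_pow, pow_add, neg_mul]
      ring

theorem summable_pow_mul_exp' (r : ℝ) (m : ℕ) {s : ℝ} (hs : 0 < s) :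
    Summable fun n : ℕ => (r + (n + 1)) ^ m * Real.exp (-(s * (n + 1))) := by
  refine Summable.of_norm ((summable_pow_mul_exp r m 0 hs).congr fun n => ?_)
  rw [norm_mul, norm_pow, Real.norm_eq_abs, Real.norm_eq_abs, Real.abs_exp]
  ring

/-- Termwise differentiation is justified on the half-line beyond `s / 2`, where the derivatives are
dominated by their size at `s / 2`. -/
theorem hasDerivAt_tsum_pow_mul_exp (r : ℝ) (m : ℕ) {s : ℝ} (hs : 0 < s) :
    HasDerivAt (fun s : ℝ => ∑' n : ℕ, (r + (n + 1)) ^ m * Real.exp (-(s * (n + 1))))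
      (∑' n : ℕ, (r + (n + 1)) ^ m * (Real.exp (-(s * (n + 1))) * -(n + 1))) s := by
  have hs2 : 0 < s / 2 := by linarith
  have hmem : s ∈ Set.Ioi (s / 2) := Set.mem_Ioi.2 (by linarith)
  refine hasDerivAt_tsum_of_isPreconnected
    (g := fun (n : ℕ) (s : ℝ) => (r + (n + 1)) ^ m * Real.exp (-(s * (n + 1))))
    (g' := fun (n : ℕ) (s : ℝ) => (r + (n + 1)) ^ m * (Real.exp (-(s * (n + 1))) * -(n + 1)))
    (u := fun n : ℕ => ((n : ℝ) + 1) ^ 1 * |r + (n + 1)| ^ m * Real.exp (-(s / 2 * (n + 1))))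
    (summable_pow_mul_exp r m 1 hs2) isOpen_Ioi isPreconnected_Ioi (y₀ := s) (y := s)
    (fun n y _ => ?_) (fun n y hy => ?_) hmem (summable_pow_mul_exp' r m hs) hmem
  · have h1 : HasDerivAt (fun z : ℝ => -(z * ((n : ℝ) + 1))) (-(n + 1)) y :=
      ((hasDerivAt_id y).mul_const ((n : ℝ) + 1)).neg.congr_deriv (by rw [one_mul])
    exact (h1.exp).const_mul _
  · rw [norm_mul, norm_mul, norm_neg, norm_pow, Real.norm_eq_abs, Real.norm_eq_abs, Real.abs_exp,
      Real.norm_eq_abs, abs_of_nonneg (by positivity : (0 : ℝ) ≤ (n : ℝ) + 1)]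
    have h2 : Real.exp (-(y * (n + 1))) ≤ Real.exp (-(s / 2 * (n + 1))) := by
      rw [Real.exp_le_exp]
      have : s / 2 < y := hy
      nlinarith [(by positivity : (0 : ℝ) ≤ n)]
    calc |r + (n + 1)| ^ m * (Real.exp (-(y * (n + 1))) * (n + 1))
        ≤ |r + (n + 1)| ^ m * (Real.exp (-(s / 2 * (n + 1))) * (n + 1)) := by gcongr
      _ = _ := by ring

theorem hasSum_exp_neg_mul_succ {s : ℝ} (hs : 0 < s) :
    HasSum (fun n : ℕ => Real.exp (-(s * ((n : ℝ) + 1)))) (Real.exp s - 1)⁻¹ := by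
  have h1 : Real.exp (-s) < 1 := by rw [Real.exp_lt_one_iff]; linarith
  have h := (hasSum_geometric_of_lt_one (Real.exp_nonneg _) h1).mul_left (Real.exp (-s))
  have h2 : Real.exp s ≠ 0 := (Real.exp_pos s).ne'
  have h3 : Real.exp s - 1 ≠ 0 := by
    have := Real.add_one_le_exp s
    linarith
  have e1 : (Real.exp s - 1)⁻¹ = Real.exp (-s) * (1 - Real.exp (-s))⁻¹ := by
    rw [← one_div, Real.exp_neg, eq_comm]
    field_simp
  rw [e1]
  refine h.congr_fun fun n => ?_
  rw [← Real.exp_nat_mul, ← Real.exp_add]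
  congr 1
  ring

/-- On `e^{-s(n+1)}` the operator `r - d/ds` acts as multiplication by `r + n + 1`, and `(e^s -
1)⁻¹` is the sum of these exponentials. -/
theorem iterate_sub_deriv_eq (r : ℝ) (m : ℕ) : ∀ {s : ℝ}, 0 < s →
    ((fun (f : ℝ → ℝ) (s : ℝ) => r * f s - deriv f s)^[m] (fun s => (Real.exp s - 1)⁻¹)) s =
      ∑' n : ℕ, (r + (n + 1)) ^ m * Real.exp (-(s * (n + 1))) := by
  induction m with
  | zero =>
    intro s hs
    simpa using (hasSum_exp_neg_mul_succ hs).tsum_eq.symm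
  | succ m ih =>
    intro s hs
    rw [Function.iterate_succ_apply']
    have hd := hasDerivAt_tsum_pow_mul_exp r m hs
    -- The induction hypothesis holds only for positive arguments; equality near `s` is what the
    -- derivative needs.
    have he : ((fun (f : ℝ → ℝ) (s : ℝ) => r * f s - deriv f s)^[m]
        (fun s => (Real.exp s - 1)⁻¹)) =ᶠ[nhds s]
        fun s : ℝ => ∑' n : ℕ, (r + (n + 1)) ^ m * Real.exp (-(s * (n + 1))) := by
      filter_upwards [lt_mem_nhds hs] with y hy using ih hy
    rw [he.deriv_eq, hd.deriv, ih hs, ← tsum_mul_left, ← Summable.tsum_sub]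
    · exact tsum_congr fun n => by ring
    · exact (summable_pow_mul_exp' r m hs).mul_left r
    · refine Summable.of_norm ((summable_pow_mul_exp r m 1 hs).congr fun n => ?_)
      rw [norm_mul, norm_mul, norm_neg, norm_pow, Real.norm_eq_abs, Real.norm_eq_abs, Real.abs_exp,
        Real.norm_eq_abs, abs_of_nonneg (by positivity : (0 : ℝ) ≤ (n : ℝ) + 1)]
      ring

theorem hasSum_pKappa (b : ℝ[X]) {κ : ℝ} (hκ : 0 < κ) (r : ℝ) :
    HasSum (fun n : ℕ => 2 * (Real.exp κ - 1) *
      (b.eval (r + (n + 1)) * Real.exp (-(κ * (n + 1))))) (pKappa b κ r) := by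
  refine HasSum.mul_left _ ?_
  simp only [iterate_sub_deriv_eq r _ hκ]
  have h : ∀ m ∈ Finset.range (b.natDegree + 1),
      HasSum (fun n : ℕ => b.coeff m * ((r + (n + 1)) ^ m * Real.exp (-(κ * (n + 1)))))
      (b.coeff m * ∑' n : ℕ, (r + (n + 1)) ^ m * Real.exp (-(κ * (n + 1)))) :=
    fun m _ => (summable_pow_mul_exp' r m hκ).hasSum.mul_left _
  refine (hasSum_sum h).congr_fun fun n => ?_
  rw [eval_eq_sum_range, Finset.sum_mul]
  exact Finset.sum_congr rfl fun m _ => by ring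

/-- Taylor expansion of `b(r + n + 1)` about `r` leaves moments `M i` times Hasse derivatives of
`b`. Only `i = 0` reaches the top degree, and `M 0 = (e^κ - 1)⁻¹` gives leading coefficient twice
that of `b`, so the degree is preserved. -/
theorem exists_pKappa_eq_eval {b : ℝ[X]} (hb : b ≠ 0) {κ : ℝ} (hκ : 0 < κ) :
    ∃ p : ℝ[X], p ≠ 0 ∧ p.natDegree = b.natDegree ∧ ∀ r, pKappa b κ r = p.eval r := by
  obtain ⟨M, hM⟩ : ∃ M : ℕ → ℝ, M = fun i => ∑' n : ℕ, ((n : ℝ) + 1) ^ i *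
    Real.exp (-(κ * (n + 1))) := ⟨_, rfl⟩
  have hs : ∀ i, Summable fun n : ℕ => ((n : ℝ) + 1) ^ i * Real.exp (-(κ * (n + 1))) := fun i => by
    simpa using summable_pow_mul_exp' 0 i hκ
  obtain ⟨p, hp⟩ : ∃ p : ℝ[X], p = C (2 * (Real.exp κ - 1)) *
    ∑ i ∈ Finset.range (b.natDegree + 1), C (M i) * hasseDeriv i b := ⟨_, rfl⟩
  have hexp : Real.exp κ - 1 ≠ 0 := by
    have := Real.add_one_le_exp κ
    linarith
  have hcoeff : p.coeff b.natDegree ≠ 0 := by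
    have e : p.coeff b.natDegree = 2 * b.leadingCoeff := by
      rw [hp, coeff_C_mul, finsetSum_coeff, Finset.sum_eq_single 0]
      · have h0 : M 0 = (Real.exp κ - 1)⁻¹ := by
          rw [hM]
          simpa using (hasSum_exp_neg_mul_succ hκ).tsum_eq
        rw [coeff_C_mul, h0, hasseDeriv_zero, LinearMap.id_apply]
        field_simp
        rfl
      · intro i _ hi
        rw [coeff_C_mul, hasseDeriv_coeff, coeff_eq_zero_of_natDegree_lt (by omega), mul_zero,
          mul_zero]
      · simp
    rw [e]
    exact mul_ne_zero two_ne_zero (leadingCoeff_ne_zero.2 hb)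
  refine ⟨p, fun h => hcoeff (by rw [h, coeff_zero]), ?_, fun r => ?_⟩
  · refine natDegree_eq_of_le_of_coeff_ne_zero ?_ hcoeff
    rw [hp]
    refine (natDegree_C_mul_le _ _).trans (natDegree_sum_le_of_forall_le _ _ fun i _ => ?_)
    exact (natDegree_C_mul_le _ _).trans ((natDegree_hasseDeriv_le b i).trans (Nat.sub_le _ _))
  · refine (hasSum_pKappa b hκ r).unique ?_
    rw [hp, eval_mul, eval_C, eval_finsetSum]
    refine HasSum.mul_left _ ?_
    have h : ∀ i ∈ Finset.range (b.natDegree + 1),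
        HasSum (fun n : ℕ => (((n : ℝ) + 1) ^ i * Real.exp (-(κ * (n + 1)))) *
          (hasseDeriv i b).eval r) ((C (M i) * hasseDeriv i b).eval r) := by
      intro i _
      rw [eval_mul, eval_C, hM]
      exact (hs i).hasSum.mul_right _
    refine (hasSum_sum h).congr_fun fun n => ?_
    rw [add_comm r, ← taylor_eval, eval_eq_sum_range, natDegree_taylor, Finset.sum_mul]
    exact Finset.sum_congr rfl fun i _ => by rw [taylor_coeff]; ring

theorem exists_integral_eq_eval {p : ℝ[X]} (hp : p ≠ 0) : ∃ P : ℝ[X],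
    P.natDegree = p.natDegree + 1 ∧ ∀ r, (∫ s in (0 : ℝ)..r, p.eval s) = P.eval r := by
  refine ⟨∑ i ∈ Finset.range (p.natDegree + 1), C (p.coeff i / (i + 1)) * X ^ (i + 1), ?_,
    fun r => ?_⟩
  · refine natDegree_eq_of_le_of_coeff_ne_zero ?_ ?_
    · refine natDegree_sum_le_of_forall_le _ _ fun i hi => ?_
      refine (natDegree_C_mul_X_pow_le _ _).trans ?_
      have := Finset.mem_range.1 hi
      omega
    · rw [finsetSum_coeff, Finset.sum_eq_single p.natDegree]
      · rw [coeff_C_mul_X_pow, if_pos rfl]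
        exact div_ne_zero (leadingCoeff_ne_zero.2 hp) (by positivity)
      · intro i _ hi
        rw [coeff_C_mul_X_pow, if_neg (by omega)]
      · simp
  · simp only [eval_eq_sum_range (p := p)]
    rw [intervalIntegral.integral_finsetSum fun i _ =>
      (Continuous.intervalIntegrable (by fun_prop) _ _), eval_finsetSum]
    refine Finset.sum_congr rfl fun i _ => ?_
    rw [intervalIntegral.integral_const_mul, integral_pow, eval_mul, eval_C, eval_pow, eval_X]
    simp
    ring

end GeometricPolynomial

/-! ### Counting sites by distance from a region -/

section Counting

variable {Λ : Type*} [Fintype Λ] [DecidableEq Λ] {q : Λ → ℕ} {d : ℕ} (L : LatticeGeometry d Λ)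

theorem one_le_eval_ballPoly {r : ℝ} (hr : 0 ≤ r) : 1 ≤ L.ballPoly.eval r := by
  obtain ⟨x⟩ := L.connected.nonempty
  have h := L.card_ball_le x 0
  have h1 : 1 ≤ (Finset.univ.filter (fun y => L.graph.dist x y ≤ 0)).card :=
    Finset.card_pos.2 ⟨x, by simp⟩
  have h2 : (1 : ℝ) ≤ (Finset.univ.filter (fun y => L.graph.dist x y ≤ 0)).card := by
    exact_mod_cast h1
  refine (h2.trans h).trans ?_
  have := L.monotoneOn_ballPoly (Set.mem_Ici.2 le_rfl) (Set.mem_Ici.2 hr) hr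
  simpa using this

theorem ballPoly_ne_zero : L.ballPoly ≠ 0 := by
  intro h
  have := one_le_eval_ballPoly L (le_refl 0)
  rw [h, eval_zero] at this
  linarith

theorem pKappa_nonneg {κ : ℝ} (hκ : 0 < κ) {r : ℝ} (hr : 0 ≤ r) : 0 ≤ pKappa L.ballPoly κ r := by
  refine (hasSum_pKappa L.ballPoly hκ r).nonneg fun n => ?_
  have h1 := one_le_eval_ballPoly L (r := r + (n + 1)) (by positivity)
  have h2 := Real.add_one_le_exp κ
  exact mul_nonneg (by linarith) (mul_nonneg (by linarith) (Real.exp_nonneg _))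

/-- The distance of a site from a region. -/
noncomputable def LatticeGeometry.distTo (S : Finset Λ) (y : Λ) : ℕ :=
  sInf ((fun x => L.graph.dist x y) '' (S : Set Λ))

theorem distTo_le {S : Finset Λ} {x : Λ} (hx : x ∈ S) (y : Λ) :
    L.distTo S y ≤ L.graph.dist x y :=
  Nat.sInf_le ⟨x, hx, rfl⟩

theorem exists_dist_eq_distTo {S : Finset Λ} (hS : S.Nonempty) (y : Λ) :
    ∃ x ∈ S, L.graph.dist x y = L.distTo S y := by
  obtain ⟨x, hx, h⟩ := Nat.sInf_mem (s := (fun x => L.graph.dist x y) '' (S : Set Λ))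
    (Set.Nonempty.image _ hS)
  exact ⟨x, hx, h⟩

theorem exists_ball_radius (X : Finset Λ) :
    ∃ x : Λ, ∀ y ∈ X, L.graph.dist x y ≤ L.radius X := by
  refine Nat.sInf_mem (s := {r : ℕ | ∃ x : Λ, ∀ y ∈ X, L.graph.dist x y ≤ r}) ?_
  obtain ⟨x⟩ := L.connected.nonempty
  exact ⟨X.sup (fun y => L.graph.dist x y), x, fun y hy =>
    Finset.le_sup (f := fun y => L.graph.dist x y) hy⟩

theorem card_distTo_le {X : Finset Λ} (hX : X.Nonempty) {z : ℝ} (hz : 0 ≤ z) :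
    ((Finset.univ.filter fun y => (L.distTo X y : ℝ) ≤ z).card : ℝ) ≤
      L.ballPoly.eval (L.radius X + z) := by
  obtain ⟨x₀, hx₀⟩ := exists_ball_radius L X
  have h1 : (Finset.univ.filter fun y => (L.distTo X y : ℝ) ≤ z) ⊆
      Finset.univ.filter (fun y => L.graph.dist x₀ y ≤ L.radius X + ⌊z⌋₊) := by
    intro y hy
    have hy' := (Finset.mem_filter.1 hy).2
    obtain ⟨x, hx, h⟩ := exists_dist_eq_distTo L hX y
    refine Finset.mem_filter.2 ⟨Finset.mem_univ y, ?_⟩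
    have h2 := L.connected.dist_triangle (u := x₀) (v := x) (w := y)
    have h3 := hx₀ x hx
    have h4 := Nat.le_floor hy'
    omega
  refine (Nat.cast_le.2 (Finset.card_le_card h1)).trans ((L.card_ball_le x₀ _).trans ?_)
  refine L.monotoneOn_ballPoly (Set.mem_Ici.2 (by positivity)) (Set.mem_Ici.2 (by positivity)) ?_
  push_cast
  have := Nat.floor_le hz
  linarith

/-- A layer decomposition: the weights `(e^κ - 1) e^{-κ(n+1)}` have total mass `1`, and their tail
from `N` on has mass `e^{-κN}`. It turns exponential weights of sites into counts of sites in balls.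
-/
theorem exp_mul_le_tsum {κ : ℝ} (hκ : 0 < κ) (z : ℝ) :
    min 1 (Real.exp (κ * z)) ≤ ∑' n : ℕ, (Real.exp κ - 1) * Real.exp (-(κ * (n + 1))) *
      (if -z ≤ (n : ℝ) + 1 then 1 else 0) := by
  have hpos : 0 ≤ Real.exp κ - 1 := by
    have := Real.add_one_le_exp κ
    linarith
  have hsum := (hasSum_exp_neg_mul_succ hκ).mul_left (Real.exp κ - 1)
  have hne : Real.exp κ - 1 ≠ 0 := by
    have := Real.add_one_le_exp κ
    linarith
  rw [mul_inv_cancel₀ hne] at hsum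
  -- The first layer that is counted. Truncation at `0` produces the `1` in the minimum; otherwise
  -- `N < -z`.
  obtain ⟨N, hN⟩ : ∃ N, N = ⌈-z - 1⌉₊ := ⟨_, rfl⟩
  have hind : ∀ n : ℕ, -z ≤ (n : ℝ) + 1 ↔ N ≤ n := by
    intro n
    rw [hN, Nat.ceil_le, sub_le_iff_le_add]
  have hs : Summable fun n : ℕ => (Real.exp κ - 1) * Real.exp (-(κ * (n + 1))) *
      (if -z ≤ (n : ℝ) + 1 then 1 else 0) := by
    refine Summable.of_nonneg_of_le (fun n => by positivity) (fun n => ?_) hsum.summable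
    split_ifs
    · rw [mul_one]
    · rw [mul_zero]
      positivity
  have hval : ∑' n : ℕ, (Real.exp κ - 1) * Real.exp (-(κ * (n + 1))) *
      (if -z ≤ (n : ℝ) + 1 then 1 else 0) = Real.exp (-(κ * N)) := by
    rw [← hs.sum_add_tsum_nat_add N, Finset.sum_eq_zero, zero_add]
    · have := (hsum.mul_left (Real.exp (-(κ * N)))).tsum_eq
      rw [mul_one] at this
      rw [← this]
      refine tsum_congr fun n => ?_
      rw [if_pos ((hind _).2 (Nat.le_add_left N n)), mul_one, mul_left_comm, ← Real.exp_add]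
      congr 2
      push_cast
      ring
    · intro n hn
      rw [if_neg, mul_zero]
      rw [hind]
      exact not_le.2 (Finset.mem_range.1 hn)
  rw [hval]
  rcases Nat.eq_zero_or_pos N with h0 | h0
  · rw [h0]
    simp
  · refine (min_le_right _ _).trans (Real.exp_le_exp.2 ?_)
    have h1 : (N : ℝ) < -z - 1 + 1 := by
      rw [hN]
      refine Nat.ceil_lt_add_one ?_
      by_contra hneg
      push Not at hneg
      rw [hN, Nat.ceil_eq_zero.2 hneg.le] at h0
      exact lt_irrefl _ h0
    nlinarith

/-- Sites near a region `X` count fully, sites away from it with an exponential weight. -/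
theorem sum_min_one_exp_le {κ : ℝ} (hκ : 0 < κ) {X : Finset Λ} (hX : X.Nonempty) {ρ : ℝ}
    (hρ : 0 ≤ ρ) : ∑ y, 2 * min 1 (Real.exp (κ * (ρ - L.distTo X y))) ≤
      pKappa L.ballPoly κ (L.radius X + ρ) := by
  have hpos : 0 ≤ Real.exp κ - 1 := by
    have := Real.add_one_le_exp κ
    linarith
  have hs : ∀ y ∈ (Finset.univ : Finset Λ), Summable fun n : ℕ =>
      2 * ((Real.exp κ - 1) * Real.exp (-(κ * (n + 1))) *
      (if -(ρ - L.distTo X y) ≤ (n : ℝ) + 1 then 1 else 0)) := by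
    intro y _
    refine Summable.mul_left _ (Summable.of_nonneg_of_le (fun n => by positivity) (fun n => ?_)
      ((hasSum_exp_neg_mul_succ hκ).mul_left (Real.exp κ - 1)).summable)
    split_ifs
    · rw [mul_one]
    · rw [mul_zero]
      positivity
  calc ∑ y, 2 * min 1 (Real.exp (κ * (ρ - L.distTo X y)))
      ≤ ∑ y, ∑' n : ℕ, 2 * ((Real.exp κ - 1) * Real.exp (-(κ * (n + 1))) *
        (if -(ρ - L.distTo X y) ≤ (n : ℝ) + 1 then 1 else 0)) := by
        refine Finset.sum_le_sum fun y _ => ?_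
        rw [tsum_mul_left]
        exact mul_le_mul_of_nonneg_left (exp_mul_le_tsum hκ _) two_pos.le
    _ = ∑' n : ℕ, ∑ y, 2 * ((Real.exp κ - 1) * Real.exp (-(κ * (n + 1))) *
        (if -(ρ - L.distTo X y) ≤ (n : ℝ) + 1 then 1 else 0)) := (Summable.tsum_finsetSum hs).symm
    _ ≤ pKappa L.ballPoly κ (L.radius X + ρ) := by
        refine hasSum_le (fun n => ?_) (summable_sum hs).hasSum (hasSum_pKappa L.ballPoly hκ _)
        -- In layer `n` the sum over sites counts those within `ρ + n + 1` of `X`, and the ball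
        -- bound reproduces the `n`th term of the series of `p_κ`.
        have h1 := card_distTo_le L hX (z := ρ + (n + 1)) (by positivity)
        have h2 : ∑ y, (if -(ρ - (L.distTo X y : ℝ)) ≤ (n : ℝ) + 1 then (1 : ℝ) else 0) =
            (Finset.univ.filter fun y => (L.distTo X y : ℝ) ≤ ρ + (n + 1)).card := by
          rw [Finset.sum_boole]
          congr 2
          ext y
          simp only [Finset.mem_filter, Finset.mem_univ, true_and]
          constructor <;> intro h <;> linarith
        rw [← Finset.mul_sum, ← Finset.mul_sum, h2, add_assoc (L.radius X : ℝ)]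
        calc _ = 2 * (Real.exp κ - 1) * (((Finset.univ.filter fun y =>
              (L.distTo X y : ℝ) ≤ ρ + (n + 1)).card : ℝ) * Real.exp (-(κ * (n + 1)))) := by ring
          _ ≤ _ := by gcongr

end Counting

/-! ### Heisenberg evolution, norm growth and Duhamel's bound -/

section Heisenberg

variable {Λ : Type*} [Fintype Λ] [DecidableEq Λ] {q : Λ → ℕ}

theorem heisenberg_sub (H M N : Op q) (t : ℝ) :
    heisenberg H (M - N) t = heisenberg H M t - heisenberg H N t := by
  simp only [heisenberg, mul_sub, sub_mul]

theorem heisenberg_smul (H M : Op q) (c : ℂ) (t : ℝ) :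
    heisenberg H (c • M) t = c • heisenberg H M t := by
  simp only [heisenberg, mul_smul_comm, smul_mul_assoc]

theorem heisenberg_mul (H M N : Op q) (t : ℝ) :
    heisenberg H (M * N) t = heisenberg H M t * heisenberg H N t := by
  simp only [heisenberg]
  have h := exp_neg_smul_mul_exp_smul (Complex.I * (t : ℂ)) H
  calc _ = NormedSpace.exp ((Complex.I * (t : ℂ)) • H) * M * 1 * N *
        NormedSpace.exp (-(Complex.I * (t : ℂ)) • H) := by simp only [mul_one, mul_assoc]
    _ = _ := by rw [← h]; simp only [mul_assoc]

theorem heisenberg_sum {ι : Type*} (H : Op q) (s : Finset ι) (f : ι → Op q) (t : ℝ) :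
    heisenberg H (∑ i ∈ s, f i) t = ∑ i ∈ s, heisenberg H (f i) t := by
  simp only [heisenberg, Finset.mul_sum, Finset.sum_mul]

theorem heisenberg_zero_time (H M : Op q) : heisenberg H M 0 = M := by
  simp [heisenberg]

theorem heisenberg_of_commute {H M : Op q} (h : Commute M H) (t : ℝ) : heisenberg H M t = M := by
  have h1 : Commute M (NormedSpace.exp ((Complex.I * (t : ℂ)) • H)) :=
    (h.smul_right (Complex.I * (t : ℂ))).exp_right
  rw [heisenberg, ← h1.eq, mul_assoc, exp_smul_mul_exp_neg_smul, mul_one]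

theorem heisenberg_heisenberg (H M : Op q) (s t : ℝ) :
    heisenberg H (heisenberg H M s) t = heisenberg H M (s + t) := by
  have h : ∀ a b : ℂ, NormedSpace.exp (a • H) * NormedSpace.exp (b • H) =
      NormedSpace.exp ((a + b) • H) := by
    intro a b
    rw [add_smul, Matrix.exp_add_of_commute]
    exact ((Commute.refl H).smul_left a).smul_right b
  simp only [heisenberg]
  have e1 := h (Complex.I * t) (Complex.I * s)
  have e2 := h (-(Complex.I * s)) (-(Complex.I * t))
  rw [show Complex.I * t + Complex.I * s = Complex.I * ((s + t : ℝ) : ℂ) by push_cast; ring] at e1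
  rw [show -(Complex.I * s) + -(Complex.I * t) = -(Complex.I * ((s + t : ℝ) : ℂ)) by
    push_cast; ring] at e2
  rw [← e1, ← e2]
  simp only [mul_assoc]

theorem exp_I_smul_mem_unitary {H : Op q} (hH : H.IsHermitian) (t : ℝ) :
    NormedSpace.exp ((Complex.I * (t : ℂ)) • H) ∈ unitary (Op q) := by
  let _ : NormedAlgebra ℚ (Op q) := NormedAlgebra.restrictScalars ℚ ℂ (Op q)
  apply NormedSpace.exp_mem_unitary_of_mem_skewAdjoint
  rw [skewAdjoint.mem_iff, star_smul, show star H = H from hH]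
  simp

theorem norm_heisenberg {H : Op q} (hH : H.IsHermitian) (M : Op q) (t : ℝ) :
    ‖heisenberg H M t‖ = ‖M‖ := by
  have h1 := exp_I_smul_mem_unitary hH t
  have h2 := exp_I_smul_mem_unitary hH (-t)
  rw [Complex.ofReal_neg, mul_neg] at h2
  rw [heisenberg, CStarRing.norm_mul_mem_unitary _ h2, CStarRing.norm_mem_unitary_mul _ h1]

theorem hasDerivAt_heisenberg (H : Op q) {O : ℝ → Op q} {O' : Op q} {τ : ℝ → ℝ} {τ' s : ℝ}
    (hτ : HasDerivAt τ τ' s) (hO : HasDerivAt O O' s) :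
    HasDerivAt (fun s => heisenberg H (O s) (τ s))
      (heisenberg H ((Complex.I * (τ' : ℂ)) • (H * O s - O s * H) + O') (τ s)) s := by
  have e1 : ∀ t : ℝ, (Complex.I * (t : ℂ)) • H = (t : ℂ) • (Complex.I • H) := fun t => by
    rw [smul_smul, mul_comm]
  have e2 : ∀ t : ℝ, -(Complex.I * (t : ℂ)) • H = (t : ℂ) • (-(Complex.I • H)) := fun t => by
    rw [smul_neg, smul_smul, mul_comm, neg_smul]
  have h1 := (hasDerivAt_exp_smul_mul (Complex.I • H) (τ s)).scomp s hτ
  have h2 := (hasDerivAt_exp_smul_mul' (-(Complex.I • H)) (τ s)).scomp s hτ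
  simp only [heisenberg, e1, e2]
  refine ((h1.mul hO).mul h2).congr_deriv ?_
  simp only [Function.comp_apply, Pi.mul_apply, ← Complex.coe_smul, neg_mul, smul_neg, mul_smul,
    smul_mul_assoc, mul_smul_comm, mul_add, add_mul, mul_sub, sub_mul, smul_sub, mul_neg, mul_assoc]
  rw [smul_comm (τ' : ℂ) Complex.I, smul_comm (τ' : ℂ) Complex.I]
  abel

/-- Growth of the norm under an isometric flow generated by commutators, with a source. -/
theorem norm_le_of_hasDerivAt_commutator_add {G K S : ℝ → Op q} {β β' : ℝ → ℝ} {t : ℝ}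
    (hK : ∀ s, (K s).IsHermitian)
    (hG : ∀ s, HasDerivAt G (Complex.I • (K s * G s - G s * K s) + S s) s)
    (h0 : ‖G 0‖ ≤ β 0) (hβ : ∀ s, HasDerivAt β (β' s) s)
    (hS : ∀ s ∈ Set.Ico 0 t, ‖S s‖ ≤ β' s) {s : ℝ} (hs : s ∈ Set.Icc 0 t) : ‖G s‖ ≤ β s := by
  refine image_le_of_liminf_slope_right_le_deriv_boundary (f := fun s => ‖G s‖) (B := β)
    (B' := β') (a := 0) (b := t) ?_ h0 ?_ (fun x _ => (hβ x).hasDerivWithinAt)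
    (fun x hx r hr => ?_) hs
  · exact fun x _ => (hG x).continuousAt.norm.continuousWithinAt
  · exact fun x _ => (hβ x).continuousAt.continuousWithinAt
  -- Conjugation by the flow of the frozen generator `K x` leaves the norm unchanged and cancels the
  -- commutator at `z = x`, so the right slope of the norm sees only the source.
  · have hτ : HasDerivAt (fun z : ℝ => x - z) (-1) x := by
      simpa using (hasDerivAt_id x).const_sub x
    have hF := hasDerivAt_heisenberg (K x) hτ (hG x)
    have e : (fun s => ‖G s‖) = norm ∘ fun z => heisenberg (K x) (G z) (x - z) := by
      ext z
      exact (norm_heisenberg (hK x) _ _).symm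
    rw [e]
    refine hF.hasDerivWithinAt.liminf_right_slope_norm_le (lt_of_le_of_lt ?_ hr)
    rw [norm_heisenberg (hK x), Complex.ofReal_neg, Complex.ofReal_one, mul_neg, mul_one, neg_smul,
      neg_add_cancel_left]
    exact hS x hx

theorem norm_heisenberg_sub_le {H : Op q} (hH : H.IsHermitian) (O : Op q) :
    ‖heisenberg H O 1 - O‖ ≤ ‖H * O - O * H‖ := by
  have hd : ∀ s : ℝ, HasDerivAt (fun s => heisenberg H O s)
      (heisenberg H ((Complex.I * ((1 : ℝ) : ℂ)) • (H * O - O * H) + 0) s) s := fun s =>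
    hasDerivAt_heisenberg H (hasDerivAt_id s) (hasDerivAt_const s O)
  have h := norm_image_sub_le_of_norm_deriv_le_segment_01' (f := fun s => heisenberg H O s)
    (C := ‖H * O - O * H‖) (fun s _ => (hd s).hasDerivWithinAt) (fun s _ => by
      rw [norm_heisenberg hH, add_zero, norm_smul]
      simp)
  rwa [heisenberg_zero_time] at h

/-- Duhamel's formula, as a bound on the difference of two evolutions. -/
theorem norm_heisenberg_sub_heisenberg_le {H W : Op q} (hH : H.IsHermitian) (hW : W.IsHermitian)
    (O : Op q) {β β' : ℝ → ℝ} (hβ0 : β 0 = 0) (hβ : ∀ s, HasDerivAt β (β' s) s) {t : ℝ} (ht : 0 ≤ t)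
    (h : ∀ s ∈ Set.Ico 0 t, ‖heisenberg H O s * W - W * heisenberg H O s‖ ≤ β' s) :
    ‖heisenberg (H + W) O t - heisenberg H O t‖ ≤ β t := by
  -- The path evolves with `H` for time `s` and with `H + W` for the remaining `t - s`, so only `W`
  -- survives in its derivative.
  have hd : ∀ s : ℝ, HasDerivAt (fun s => heisenberg (H + W) (heisenberg H O s) (t - s))
      (heisenberg (H + W)
        (Complex.I • (heisenberg H O s * W - W * heisenberg H O s)) (t - s)) s := by
    intro s
    have hτ : HasDerivAt (fun z : ℝ => t - z) (-1) s := by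
      simpa using (hasDerivAt_id s).const_sub t
    have h1 := hasDerivAt_heisenberg H (hasDerivAt_id s) (hasDerivAt_const s O)
    have h2 := hasDerivAt_heisenberg (H + W) hτ h1
    refine h2.congr_deriv ?_
    have hc : heisenberg H H s = H := heisenberg_of_commute (Commute.refl H) s
    congr 1
    simp only [id, Complex.ofReal_one, mul_one, add_zero, heisenberg_smul, heisenberg_sub,
      heisenberg_mul, hc, Complex.ofReal_neg, mul_neg, neg_smul]
    rw [neg_add_eq_sub, ← smul_sub]
    congr 1
    noncomm_ring
  have hm := image_norm_le_of_norm_deriv_right_le_deriv_boundary (a := 0) (b := t) (B := β)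
    (B' := β') (f := fun s => heisenberg (H + W) (heisenberg H O s) (t - s) -
      heisenberg (H + W) (heisenberg H O 0) (t - 0))
    (fun s _ => ((hd s).sub_const _).continuousAt.continuousWithinAt)
    (fun s _ => ((hd s).sub_const _).hasDerivWithinAt) (by simp [hβ0]) hβ
    (fun s hs => by
      rw [norm_heisenberg (hH.add hW), norm_smul, Complex.norm_I, one_mul]
      exact h s hs) (Set.right_mem_Icc.2 ht)
  rw [sub_self, heisenberg_zero_time, heisenberg_zero_time, sub_zero, norm_sub_rev] at hm
  exact hm

end Heisenberg

/-! ### A Lieb-Robinson bound independent of the strength of `H₀` -/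

section LiebRobinson

variable {Λ : Type*} [Fintype Λ] [DecidableEq Λ] {q : Λ → ℕ} {d k : ℕ}
  {L : LatticeGeometry d Λ} (H₀ : CommutingHamiltonian q) (V : LocalPerturbation L q k)

/-- Under the unperturbed dynamics, an operator that commutes with the terms that do not meet `A`
stays supported on the hull of `A`. -/
theorem supportedOn_hull_heisenberg {A : Finset Λ} {M : Op q} (hM : SupportedOn (H₀.hull A) M)
    (hc : ∀ j, j ∉ H₀.meets A → Commute M (H₀.term j)) (t : ℝ) :
    SupportedOn (H₀.hull A) (heisenberg H₀.ham M t) := by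
  obtain ⟨N, hN⟩ : ∃ N, N = ∑ j ∈ (H₀.meets A)ᶜ, H₀.term j := ⟨_, rfl⟩
  have h1 : Commute M N := by
    rw [hN]
    exact Commute.sum_right _ _ _ fun j hj => hc j (Finset.mem_compl.1 hj)
  have h2 : Commute N (H₀.trunc A) := by
    rw [hN]
    exact Commute.sum_left _ _ _ fun j _ => H₀.commute_term_trunc j A
  have e : ∀ c : ℂ, NormedSpace.exp (c • H₀.ham) =
      NormedSpace.exp (c • H₀.trunc A) * NormedSpace.exp (c • N) := by
    intro c
    rw [H₀.ham_eq A, ← hN, smul_add, Matrix.exp_add_of_commute]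
    exact (h2.symm.smul_left c).smul_right c
  have e' : ∀ c : ℂ, NormedSpace.exp (c • H₀.ham) =
      NormedSpace.exp (c • N) * NormedSpace.exp (c • H₀.trunc A) := by
    intro c
    rw [H₀.ham_eq A, ← hN, smul_add, add_comm, Matrix.exp_add_of_commute]
    exact (h2.smul_left c).smul_right c
  -- The terms that do not meet `A` commute with `M` and with `H_{0A}`, so their evolution cancels
  -- whatever their size.
  have h3 : heisenberg H₀.ham M t = heisenberg (H₀.trunc A) M t := by
    have h4 := heisenberg_of_commute h1 t
    rw [heisenberg] at h4
    rw [heisenberg, heisenberg, e, e']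
    conv_rhs => rw [← h4]
    simp only [mul_assoc]
  rw [h3]
  exact (H₀.supportedOn_trunc A).heisenberg hM t

theorem commute_localDiag_term {A : Finset Λ} {M : Op q} (hM : SupportedOn A M) {j : Λ}
    (hj : j ∉ H₀.meets A) : Commute (localDiag H₀ A M) (H₀.term j) :=
  (H₀.commute_localDiag (H₀.commute_term_trunc j A)
    (H₀.commute_term_of_notMem_meets hM hj).symm).symm

theorem isHermitian_blockHam : (blockHam H₀ V.term).IsHermitian := by
  refine H₀.isHermitian_ham.add ?_
  rw [Matrix.IsHermitian, Matrix.conjTranspose_sum]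
  exact Finset.sum_congr rfl fun A _ => H₀.isHermitian_localDiag (V.isHermitian_term A)

theorem isHermitian_heisenberg {H M : Op q} (hH : H.IsHermitian) (hM : M.IsHermitian) (t : ℝ) :
    (heisenberg H M t).IsHermitian := by
  have hu : star (NormedSpace.exp ((Complex.I * (t : ℂ)) • H)) =
      NormedSpace.exp (-(Complex.I * (t : ℂ)) • H) := by
    rw [NormedSpace.star_exp, star_smul, show star H = H from hH]
    simp
  have hu' := congrArg star hu
  rw [star_star] at hu'
  have hM' : M.conjTranspose = M := hM
  rw [heisenberg, Matrix.IsHermitian, Matrix.conjTranspose_mul, Matrix.conjTranspose_mul, hM',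
    ← Matrix.star_eq_conjTranspose, ← Matrix.star_eq_conjTranspose, hu, ← hu', mul_assoc]

/-- The path joins the unperturbed evolution for time `t` (at `s = 0`) to the block-diagonal
evolution (at `s = t`). `H₀` cancels from the derivative, so it does not contribute to the velocity.
-/
theorem hasDerivAt_interaction_picture (O : Op q) (t s : ℝ) :
    HasDerivAt (fun s => heisenberg (blockHam H₀ V.term) (heisenberg H₀.ham O (t - s)) s)
      (heisenberg (blockHam H₀ V.term) (Complex.I • ∑ A,
        (localDiag H₀ A (V.term A) * heisenberg H₀.ham O (t - s) -
          heisenberg H₀.ham O (t - s) * localDiag H₀ A (V.term A))) s) s := by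
  have hτ : HasDerivAt (fun z : ℝ => t - z) (-1) s := by
    simpa using (hasDerivAt_id s).const_sub t
  have h1 := hasDerivAt_heisenberg H₀.ham hτ (hasDerivAt_const s O)
  have h2 := hasDerivAt_heisenberg (blockHam H₀ V.term) (hasDerivAt_id s) h1
  refine h2.congr_deriv ?_
  have hc : heisenberg H₀.ham H₀.ham (t - s) = H₀.ham := heisenberg_of_commute (Commute.refl _) _
  congr 1
  simp only [Complex.ofReal_one, mul_one, add_zero, Complex.ofReal_neg, heisenberg_smul,
    heisenberg_sub, heisenberg_mul, hc]
  rw [mul_neg, mul_one, neg_smul, ← sub_eq_add_neg, ← smul_sub, Finset.sum_sub_distrib,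
    ← Finset.sum_mul, ← Finset.mul_sum, blockHam]
  congr 1
  noncomm_ring

theorem supportedOn_heisenberg_localDiag (A : Finset Λ) (s : ℝ) :
    SupportedOn (H₀.hull A) (heisenberg H₀.ham (localDiag H₀ A (V.term A)) s) :=
  supportedOn_hull_heisenberg H₀ (H₀.supportedOn_localDiag (V.supportedOn_term A))
    (fun _ hj => commute_localDiag_term H₀ (V.supportedOn_term A) hj) s

theorem hasDerivAt_interaction_picture_of_supportedOn {X : Finset Λ} {O : Op q}
    (hO : SupportedOn X O) (t s : ℝ) :
    HasDerivAt (fun s => heisenberg (blockHam H₀ V.term) (heisenberg H₀.ham O (t - s)) s)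
      (Complex.I •
        ((∑ A with (H₀.hull A ∩ X).Nonempty,
            heisenberg (blockHam H₀ V.term) (localDiag H₀ A (V.term A)) s) *
          heisenberg (blockHam H₀ V.term) (heisenberg H₀.ham O (t - s)) s -
        heisenberg (blockHam H₀ V.term) (heisenberg H₀.ham O (t - s)) s *
          (∑ A with (H₀.hull A ∩ X).Nonempty,
            heisenberg (blockHam H₀ V.term) (localDiag H₀ A (V.term A)) s))) s := by
  refine (hasDerivAt_interaction_picture H₀ V O t s).congr_deriv ?_
  -- To discard a term, the unperturbed evolution is moved from `O` to `𝓓_A(V_A)`, which stays on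
  -- the hull of `A`.
  have hsum : ∑ A, (localDiag H₀ A (V.term A) * heisenberg H₀.ham O (t - s) -
      heisenberg H₀.ham O (t - s) * localDiag H₀ A (V.term A)) =
      ∑ A with (H₀.hull A ∩ X).Nonempty, (localDiag H₀ A (V.term A) * heisenberg H₀.ham O (t - s) -
        heisenberg H₀.ham O (t - s) * localDiag H₀ A (V.term A)) := by
    rw [Finset.sum_filter]
    refine Finset.sum_congr rfl fun A _ => ?_
    split_ifs with hA
    · rfl
    · have hdisj : Disjoint (H₀.hull A) X := Finset.disjoint_iff_inter_eq_empty.2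
        (Finset.not_nonempty_iff_eq_empty.1 hA)
      have hc := ((supportedOn_heisenberg_localDiag H₀ V A (s - t)).commute hO hdisj).eq
      have hc' := congrArg (fun M => heisenberg H₀.ham M (t - s)) hc
      simp only [heisenberg_mul] at hc'
      rw [heisenberg_heisenberg, sub_add_sub_cancel, sub_self, heisenberg_zero_time] at hc'
      rw [hc', sub_self]
  rw [hsum, heisenberg_smul, heisenberg_sum]
  congr 1
  rw [Finset.sum_mul, Finset.mul_sum, ← Finset.sum_sub_distrib]
  exact Finset.sum_congr rfl fun A _ => by rw [heisenberg_sub, heisenberg_mul, heisenberg_mul]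

section Weight

variable {φ : Λ → ℝ} {a t : ℝ} {B : Op q}

theorem sum_hull_inter_weight_le (hφ : ∀ x, 0 ≤ φ x)
    (h1 : ∀ x, ∑ A with x ∈ H₀.hull A, ‖V.term A‖ * ∑ z ∈ H₀.hull A, φ z ≤ a / 2 * φ x)
    (X : Finset Λ) :
    ∑ A with (H₀.hull A ∩ X).Nonempty, ‖V.term A‖ * ∑ x ∈ H₀.hull A, φ x ≤
      a / 2 * ∑ x ∈ X, φ x := by
  have hnn : ∀ A, 0 ≤ ‖V.term A‖ * ∑ x ∈ H₀.hull A, φ x := fun A =>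
    mul_nonneg (norm_nonneg _) (Finset.sum_nonneg fun x _ => hφ x)
  calc ∑ A with (H₀.hull A ∩ X).Nonempty, ‖V.term A‖ * ∑ x ∈ H₀.hull A, φ x
      ≤ ∑ A, ∑ x ∈ X, if x ∈ H₀.hull A then ‖V.term A‖ * ∑ x ∈ H₀.hull A, φ x else 0 := by
        rw [Finset.sum_filter]
        refine Finset.sum_le_sum fun A _ => ?_
        have hnn' : ∀ y ∈ X, (0 : ℝ) ≤ if y ∈ H₀.hull A then
            ‖V.term A‖ * ∑ x ∈ H₀.hull A, φ x else 0 := fun y _ => by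
          split_ifs
          exacts [hnn A, le_rfl]
        split_ifs with hA
        · obtain ⟨x, hx⟩ := hA
          rw [Finset.mem_inter] at hx
          have := Finset.single_le_sum hnn' hx.2
          simpa only [hx.1, if_true] using this
        · exact Finset.sum_nonneg hnn'
    _ = ∑ x ∈ X, ∑ A with x ∈ H₀.hull A, ‖V.term A‖ * ∑ z ∈ H₀.hull A, φ z := by
        rw [Finset.sum_comm]
        exact Finset.sum_congr rfl fun x _ => (Finset.sum_filter _ _).symm
    _ ≤ ∑ x ∈ X, a / 2 * φ x := Finset.sum_le_sum fun x _ => h1 x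
    _ = _ := (Finset.mul_sum _ _ _).symm

theorem norm_commutator_sum_le {e E : ℝ} {X : Finset Λ} {D : Finset Λ → Op q} (he : 0 ≤ e)
    (hE : 0 ≤ E) (hφ : ∀ x, 0 ≤ φ x)
    (h1 : ∀ x, ∑ A with x ∈ H₀.hull A, ‖V.term A‖ * ∑ z ∈ H₀.hull A, φ z ≤ a / 2 * φ x)
    (hD : ∀ A, ‖D A * B - B * D A‖ ≤ ‖V.term A‖ * ‖B‖ * (2 * e * ∑ x ∈ H₀.hull A, φ x + 2 * E)) :
    ‖(∑ A with (H₀.hull A ∩ X).Nonempty, D A) * B - B * ∑ A with (H₀.hull A ∩ X).Nonempty, D A‖ ≤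
      ‖B‖ * (2 * e * (a / 2 * ∑ x ∈ X, φ x) + 2 * E * ∑ A, ‖V.term A‖) := by
  rw [Finset.sum_mul, Finset.mul_sum, ← Finset.sum_sub_distrib]
  refine (norm_sum_le _ _).trans ((Finset.sum_le_sum fun A _ => hD A).trans ?_)
  have h2 : ∑ A with (H₀.hull A ∩ X).Nonempty, ‖V.term A‖ * ‖B‖ *
        (2 * e * ∑ x ∈ H₀.hull A, φ x + 2 * E) =
      ‖B‖ * (2 * e * ∑ A with (H₀.hull A ∩ X).Nonempty, ‖V.term A‖ * ∑ x ∈ H₀.hull A, φ x +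
        2 * E * ∑ A with (H₀.hull A ∩ X).Nonempty, ‖V.term A‖) := by
    rw [Finset.mul_sum, Finset.mul_sum, ← Finset.sum_add_distrib, Finset.mul_sum]
    exact Finset.sum_congr rfl fun A _ => by ring
  rw [h2]
  refine mul_le_mul_of_nonneg_left (add_le_add ?_ ?_) (norm_nonneg _)
  · exact mul_le_mul_of_nonneg_left (sum_hull_inter_weight_le H₀ V hφ h1 X) (by positivity)
  · exact mul_le_mul_of_nonneg_left (Finset.sum_le_sum_of_subset_of_nonneg (Finset.subset_univ _)
      fun _ _ _ => norm_nonneg _) (by positivity)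

theorem hasDerivAt_lieb_robinson_bound (a b c e s : ℝ) (n : ℕ) :
    HasDerivAt (fun s => c * (2 * Real.exp (a * s) * e + 2 * (b * s) ^ (n + 1) / (n + 1).factorial))
      (c * (2 * (Real.exp (a * s) * a) * e + 2 * b * ((b * s) ^ n / n.factorial))) s := by
  refine HasDerivAt.const_mul _ (HasDerivAt.add ?_ ?_)
  · have he : HasDerivAt (fun s : ℝ => Real.exp (a * s)) (Real.exp (a * s) * a) s :=
      (((hasDerivAt_id s).const_mul a).exp).congr_deriv (by simp)
    exact (he.const_mul 2).mul_const _
  · have hp := (((hasDerivAt_id s).const_mul b).fun_pow (n + 1)).const_mul 2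
    refine (hp.div_const ((n + 1).factorial : ℝ)).congr_deriv ?_
    rw [Nat.factorial_succ]
    push_cast
    simp only [id, mul_one]
    field_simp

/-- Induction on the depth of the Duhamel iteration. The remainder `(2 ∑‖V_A‖ s)^n / n!` starts from
the trivial commutator bound. The weight term reproduces itself because `h1` makes `φ` a
supersolution; the `a / 2` there absorbs the `2` from bounding a commutator. -/
theorem lieb_robinson_induction (hφ : ∀ x, 0 ≤ φ x)
    (h1 : ∀ x, ∑ A with x ∈ H₀.hull A, ‖V.term A‖ * ∑ z ∈ H₀.hull A, φ z ≤ a / 2 * φ x)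
    (h2 : ∀ (X : Finset Λ) (O : Op q), SupportedOn X O →
      ‖heisenberg H₀.ham O t * B - B * heisenberg H₀.ham O t‖ ≤
        ‖O‖ * ‖B‖ * (2 * ∑ x ∈ X, φ x)) (n : ℕ) :
    ∀ (X : Finset Λ) (O : Op q), SupportedOn X O → ∀ s ∈ Set.Icc 0 t,
      ‖heisenberg (blockHam H₀ V.term) (heisenberg H₀.ham O (t - s)) s * B -
        B * heisenberg (blockHam H₀ V.term) (heisenberg H₀.ham O (t - s)) s‖ ≤
      ‖O‖ * ‖B‖ * (2 * Real.exp (a * s) * ∑ x ∈ X, φ x +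
        2 * ((2 * ∑ A, ‖V.term A‖) * s) ^ n / n.factorial) := by
  have hH := isHermitian_blockHam H₀ V
  have hnorm : ∀ (O : Op q) (s : ℝ),
      ‖heisenberg (blockHam H₀ V.term) (heisenberg H₀.ham O (t - s)) s‖ = ‖O‖ := fun O s => by
    rw [norm_heisenberg hH, norm_heisenberg H₀.isHermitian_ham]
  induction n with
  | zero =>
    intro X O _ s _
    refine (Interaction.norm_commutator_le _ _).trans ?_
    rw [hnorm]
    have : 0 ≤ ‖O‖ * ‖B‖ * (2 * Real.exp (a * s) * ∑ x ∈ X, φ x) :=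
      mul_nonneg (by positivity) (mul_nonneg (by positivity) (Finset.sum_nonneg fun x _ => hφ x))
    simp only [pow_zero, Nat.factorial_zero, Nat.cast_one, div_one]
    linarith
  | succ n ih =>
    intro X O hO s hs
    have hder := hasDerivAt_interaction_picture_of_supportedOn H₀ V hO t
    generalize hO' : (fun s => heisenberg (blockHam H₀ V.term) (heisenberg H₀.ham O (t - s)) s) = O'
      at hder
    have hO'' : ∀ s, heisenberg (blockHam H₀ V.term) (heisenberg H₀.ham O (t - s)) s = O' s :=
      fun s => congrFun hO' s
    obtain ⟨K, hK⟩ : ∃ K : ℝ → Op q, K = fun s => ∑ A with (H₀.hull A ∩ X).Nonempty,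
      heisenberg (blockHam H₀ V.term) (localDiag H₀ A (V.term A)) s := ⟨_, rfl⟩
    have hder' : ∀ s, HasDerivAt O' (Complex.I • (K s * O' s - O' s * K s)) s := fun s => by
      rw [← hO'', hK]
      exact hder s
    have hKh : ∀ s, (K s).IsHermitian := by
      intro s
      rw [hK, Matrix.IsHermitian, Matrix.conjTranspose_sum]
      exact Finset.sum_congr rfl fun A _ =>
        isHermitian_heisenberg hH (H₀.isHermitian_localDiag (V.isHermitian_term A)) s
    rw [hO'']
    refine norm_le_of_hasDerivAt_commutator_add (G := fun s => O' s * B - B * O' s) (K := K)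
      (S := fun s => Complex.I • ((K s * B - B * K s) * O' s - O' s * (K s * B - B * K s)))
      hKh (fun s => ?_) ?_ (fun s => hasDerivAt_lieb_robinson_bound a (2 * ∑ A, ‖V.term A‖)
        (‖O‖ * ‖B‖) (∑ x ∈ X, φ x) s n) (fun s hs => ?_) hs
    -- By the Jacobi identity the derivative of `[O', B]` is an isometric flow plus a source
    -- containing `[K, B]`.
    · refine (((hder' s).mul_const B).sub ((hder' s).const_mul B)).congr_deriv ?_
      rw [← smul_add, smul_mul_assoc, mul_smul_comm, ← smul_sub]
      congr 1
      noncomm_ring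
    · have h := h2 X O hO
      rw [← hO'']
      simp only [sub_zero, heisenberg_zero_time, mul_zero, Real.exp_zero, mul_one, ne_eq,
        Nat.succ_ne_zero, not_false_eq_true, zero_pow, zero_div, add_zero]
      exact h
    · have hs' : s ∈ Set.Icc 0 t := ⟨hs.1, hs.2.le⟩
      obtain ⟨E, hE⟩ : ∃ E, E = ((2 * ∑ A, ‖V.term A‖) * s) ^ n / n.factorial := ⟨_, rfl⟩
      have hE0 : 0 ≤ E := by
        rw [hE]
        exact div_nonneg (pow_nonneg (mul_nonneg (mul_nonneg two_pos.le
          (Finset.sum_nonneg fun _ _ => norm_nonneg _)) hs.1) _) (Nat.cast_nonneg _)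
      have hn2 : ‖K s * B - B * K s‖ ≤ ‖B‖ * (2 * Real.exp (a * s) * (a / 2 * ∑ x ∈ X, φ x) +
          2 * E * ∑ A, ‖V.term A‖) := by
        rw [hK]
        refine norm_commutator_sum_le H₀ V (Real.exp_pos _).le hE0 hφ h1 fun A => ?_
        -- Each term of `K s` has the form of the induction hypothesis: evolving `𝓓_A(V_A)` by `s -
        -- t` under `H₀` keeps it on the hull, and the interaction picture undoes that evolution.
        have h := ih (H₀.hull A) _ (supportedOn_heisenberg_localDiag H₀ V A (s - t)) s hs'
        rw [heisenberg_heisenberg, sub_add_sub_cancel, sub_self, heisenberg_zero_time,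
          norm_heisenberg H₀.isHermitian_ham, mul_div_assoc, ← hE] at h
        refine h.trans (mul_le_mul_of_nonneg_right (mul_le_mul_of_nonneg_right
          (H₀.norm_localDiag_le A (V.term A)) (norm_nonneg _)) ?_)
        exact add_nonneg (mul_nonneg (by positivity) (Finset.sum_nonneg fun x _ => hφ x))
          (by positivity)
      rw [norm_smul, Complex.norm_I, one_mul, ← hE]
      refine (Interaction.norm_commutator_le _ _).trans ?_
      rw [← hO'' s, hnorm]
      refine (mul_le_mul_of_nonneg_right (mul_le_mul_of_nonneg_left hn2 two_pos.le)
        (norm_nonneg _)).trans_eq ?_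
      ring

/-- A Lieb-Robinson bound with a weight on the sites that is adapted to the perturbation. -/
theorem lieb_robinson (ht : 0 ≤ t) (hφ : ∀ x, 0 ≤ φ x)
    (h1 : ∀ x, ∑ A with x ∈ H₀.hull A, ‖V.term A‖ * ∑ z ∈ H₀.hull A, φ z ≤ a / 2 * φ x)
    (h2 : ∀ (X : Finset Λ) (O : Op q), SupportedOn X O →
      ‖heisenberg H₀.ham O t * B - B * heisenberg H₀.ham O t‖ ≤
        ‖O‖ * ‖B‖ * (2 * ∑ x ∈ X, φ x)) {X : Finset Λ} {O : Op q} (hO : SupportedOn X O) :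
    ‖heisenberg (blockHam H₀ V.term) O t * B - B * heisenberg (blockHam H₀ V.term) O t‖ ≤
      ‖O‖ * ‖B‖ * (2 * Real.exp (a * t) * ∑ x ∈ X, φ x) := by
  have h := fun n => lieb_robinson_induction H₀ V hφ h1 h2 n X O hO t ⟨ht, le_rfl⟩
  simp only [sub_self, heisenberg_zero_time] at h
  -- On a finite lattice the factorial remainder tends to `0`, which removes the dependence on the
  -- total size of `V`.
  have hlim := (((FloorSemiring.tendsto_pow_div_factorial_atTop
    ((2 * ∑ A, ‖V.term A‖) * t)).const_mul 2).const_add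
      (2 * Real.exp (a * t) * ∑ x ∈ X, φ x)).const_mul (‖O‖ * ‖B‖)
  rw [mul_zero, add_zero] at hlim
  refine ge_of_tendsto' hlim fun n => ?_
  rw [← mul_div_assoc]
  exact h n

end Weight

end LiebRobinson

/-! ### The exponential weight and the velocity -/

section Velocity

variable {Λ : Type*} [Fintype Λ] [DecidableEq Λ] {q : Λ → ℕ} {d k : ℕ}
  {L : LatticeGeometry d Λ}

theorem dist_le_diam {A : Finset Λ} {x y : Λ} (hx : x ∈ A) (hy : y ∈ A) :
    L.graph.dist x y ≤ L.diam A :=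
  Finset.le_sup (f := fun p : Λ × Λ => L.graph.dist p.1 p.2) (Finset.mk_mem_product hx hy)

theorem one_le_volConst : 1 ≤ L.volConst := by
  obtain ⟨x⟩ := L.connected.nonempty
  simpa using L.card_le {x} (Finset.singleton_nonempty x)

theorem CommutingHamiltonian.diam_region_le_range (H₀ : CommutingHamiltonian q) (j : Λ) :
    L.diam (H₀.region j) ≤ H₀.range L :=
  Finset.le_sup (f := fun j => L.diam (H₀.region j)) (Finset.mem_univ j)

theorem CommutingHamiltonian.exists_dist_le_range (H₀ : CommutingHamiltonian q) {A : Finset Λ}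
    {x : Λ} (hx : x ∈ H₀.hull A) : ∃ y ∈ A, L.graph.dist x y ≤ H₀.range L := by
  obtain ⟨j, hj, hxj⟩ := Finset.mem_biUnion.1 hx
  obtain ⟨y, hy⟩ := (Finset.mem_filter.1 hj).2
  rw [Finset.mem_inter] at hy
  exact ⟨y, hy.2, (dist_le_diam hxj hy.1).trans (H₀.diam_region_le_range j)⟩

theorem CommutingHamiltonian.diam_hull_le (H₀ : CommutingHamiltonian q) (A : Finset Λ) :
    L.diam (H₀.hull A) ≤ L.diam A + 2 * H₀.range L := by
  refine Finset.sup_le fun p hp => ?_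
  rw [Finset.mem_product] at hp
  obtain ⟨y, hy, h1⟩ := H₀.exists_dist_le_range (L := L) hp.1
  obtain ⟨z, hz, h2⟩ := H₀.exists_dist_le_range (L := L) hp.2
  have h3 := L.connected.dist_triangle (u := p.1) (v := y) (w := p.2)
  have h4 := L.connected.dist_triangle (u := y) (v := z) (w := p.2)
  have h5 : L.graph.dist y z ≤ L.diam A := dist_le_diam hy hz
  rw [SimpleGraph.dist_comm] at h2
  omega

theorem distTo_le_dist_add {S : Finset Λ} (hS : S.Nonempty) (x y : Λ) :
    L.distTo S x ≤ L.distTo S y + L.graph.dist x y := by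
  obtain ⟨z, hz, h⟩ := exists_dist_eq_distTo L hS y
  have h1 := distTo_le L hz x
  have h2 := L.connected.dist_triangle (u := z) (v := y) (w := x)
  rw [SimpleGraph.dist_comm (u := y)] at h2
  omega

/-- The maximum of `x^d e^{-ηx}` is at `x = d/η`; this is the origin of the factor `(d/(eη))^d` in
the velocity. -/
theorem pow_le_pow_mul_exp (d : ℕ) {η x : ℝ} (hη : 0 < η) (hx : 0 ≤ x) :
    x ^ d ≤ ((d : ℝ) / (Real.exp 1 * η)) ^ d * Real.exp (η * x) := by
  rcases Nat.eq_zero_or_pos d with rfl | hd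
  · simpa using mul_nonneg hη.le hx
  have hd' : (0 : ℝ) < d := Nat.cast_pos.2 hd
  have h := Real.add_one_le_exp (η * x / d - 1)
  rw [sub_add_cancel, Real.exp_sub, div_le_div_iff₀ hd' (Real.exp_pos 1)] at h
  have h1 : x ≤ d / (Real.exp 1 * η) * Real.exp (η * x / d) := by
    rw [div_mul_eq_mul_div, le_div_iff₀ (by positivity)]
    linarith
  refine (pow_le_pow_left₀ hx h1 d).trans_eq ?_
  rw [mul_pow, ← Real.exp_nat_mul, mul_div_cancel₀ _ hd'.ne']

theorem velocity_nonneg (H₀ : CommutingHamiltonian q) (V : Interaction q) {κ η : ℝ} (hκ : 0 < κ)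
    (hη : 0 < η) : 0 ≤ velocity L H₀ V κ η := by
  have h1 := one_le_volConst (L := L)
  have h2 := interNorm_nonneg L V (κ + η)
  have h3 : 0 ≤ L.volConst := by linarith
  rw [velocity]
  positivity

/-- The weight `exp (-κ dist (S, x))`. -/
noncomputable def LatticeGeometry.weight (L : LatticeGeometry d Λ) (κ : ℝ) (S : Finset Λ)
    (x : Λ) : ℝ :=
  Real.exp (-(κ * L.distTo S x))

theorem weight_nonneg (κ : ℝ) (S : Finset Λ) (x : Λ) : 0 ≤ L.weight κ S x := (Real.exp_pos _).le

theorem weight_eq_one {κ : ℝ} {S : Finset Λ} {x : Λ} (hx : x ∈ S) : L.weight κ S x = 1 := by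
  have h := distTo_le L hx x
  rw [SimpleGraph.dist_self, Nat.le_zero] at h
  simp [LatticeGeometry.weight, h]

theorem weight_le_exp_mul {κ : ℝ} (hκ : 0 < κ) {S A : Finset Λ} (hS : S.Nonempty) {x z : Λ}
    (hx : x ∈ A) (hz : z ∈ A) :
    L.weight κ S z ≤ Real.exp (κ * L.diam A) * L.weight κ S x := by
  rw [LatticeGeometry.weight, LatticeGeometry.weight, ← Real.exp_add, Real.exp_le_exp]
  have h1 := distTo_le_dist_add (L := L) hS x z
  have h2 : L.graph.dist x z ≤ L.diam A := dist_le_diam hx hz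
  have h3 : (L.distTo S x : ℝ) ≤ L.distTo S z + L.diam A := by exact_mod_cast h1.trans (by omega)
  nlinarith

/-- The weight varies by at most `e^{κl}` over a hull of diameter `l`, and `e^{η(l+1)}` pays for the
number of its sites. Since `l` exceeds the diameter of `A` by at most `2 l₀`, this produces the
factors `e^η` and `e^{2(κ+η)l₀}`. -/
theorem sum_weight_hull_le (H₀ : CommutingHamiltonian q) {κ η : ℝ} (hκ : 0 < κ) (hη : 0 < η)
    {S A : Finset Λ} (hS : S.Nonempty) {x : Λ} (hx : x ∈ H₀.hull A) :
    ∑ z ∈ H₀.hull A, L.weight κ S z ≤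
      L.volConst * ((d : ℝ) / (Real.exp 1 * η)) ^ d * Real.exp η *
        Real.exp (2 * (κ + η) * H₀.range L) * L.weight κ S x *
          Real.exp ((κ + η) * L.diam A) := by
  have hC : 0 ≤ L.volConst := by
    have := one_le_volConst (L := L)
    linarith
  have hφ := weight_nonneg (L := L) κ S x
  obtain ⟨l, hl⟩ : ∃ l : ℝ, l = L.diam (H₀.hull A) := ⟨_, rfl⟩
  have hl0 : 0 ≤ l := by
    rw [hl]
    positivity
  have hl1 : l ≤ L.diam A + 2 * H₀.range L := by
    rw [hl]
    exact_mod_cast H₀.diam_hull_le A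
  have h1 : ((H₀.hull A).card : ℝ) ≤
      L.volConst * (((d : ℝ) / (Real.exp 1 * η)) ^ d * Real.exp (η * (l + 1))) := by
    refine (L.card_le (H₀.hull A) ⟨x, hx⟩).trans (mul_le_mul_of_nonneg_left ?_ hC)
    rw [hl]
    exact pow_le_pow_mul_exp d hη (by positivity)
  calc ∑ z ∈ H₀.hull A, L.weight κ S z
      ≤ ∑ _z ∈ H₀.hull A, Real.exp (κ * l) * L.weight κ S x :=
        Finset.sum_le_sum fun z hz => by
          rw [hl]
          exact weight_le_exp_mul hκ hS hx hz
    _ = (H₀.hull A).card * (Real.exp (κ * l) * L.weight κ S x) := by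
        rw [Finset.sum_const, nsmul_eq_mul]
    _ ≤ L.volConst * (((d : ℝ) / (Real.exp 1 * η)) ^ d * Real.exp (η * (l + 1))) *
          (Real.exp (κ * l) * L.weight κ S x) :=
        mul_le_mul_of_nonneg_right h1 (mul_nonneg (Real.exp_pos _).le hφ)
    _ = L.volConst * ((d : ℝ) / (Real.exp 1 * η)) ^ d * Real.exp η * L.weight κ S x *
          Real.exp ((κ + η) * l) := by
        rw [show η * (l + 1) = η + η * l by ring, show (κ + η) * l = η * l + κ * l by ring,
          Real.exp_add, Real.exp_add]
        ring
    _ ≤ L.volConst * ((d : ℝ) / (Real.exp 1 * η)) ^ d * Real.exp η * L.weight κ S x *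
          Real.exp (2 * (κ + η) * H₀.range L + (κ + η) * L.diam A) := by
        refine mul_le_mul_of_nonneg_left (Real.exp_le_exp.2 ?_) (by positivity)
        nlinarith
    _ = _ := by
        rw [Real.exp_add]
        ring

/-- The weight decays along the lattice at the rate of the perturbation. -/
theorem sum_norm_mul_sum_weight_le (H₀ : CommutingHamiltonian q) (V : Interaction q) {κ η : ℝ}
    (hκ : 0 < κ) (hη : 0 < η) {S : Finset Λ} (hS : S.Nonempty) (x : Λ) :
    ∑ A with x ∈ H₀.hull A, ‖V A‖ * ∑ z ∈ H₀.hull A, L.weight κ S z ≤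
      κ * velocity L H₀ V κ η / 2 * L.weight κ S x := by
  have hC : 0 ≤ L.volConst := by
    have := one_le_volConst (L := L)
    linarith
  have hφ := weight_nonneg (L := L) κ S x
  have h := H₀.sum_mem_hull_le (f := fun A => ‖V A‖ * Real.exp ((κ + η) * L.diam A))
    (fun A => by positivity) (sum_le_interNorm L V (κ + η)) x
  calc ∑ A with x ∈ H₀.hull A, ‖V A‖ * ∑ z ∈ H₀.hull A, L.weight κ S z
      ≤ ∑ A with x ∈ H₀.hull A, ‖V A‖ *
        (L.volConst * ((d : ℝ) / (Real.exp 1 * η)) ^ d * Real.exp η *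
        Real.exp (2 * (κ + η) * H₀.range L) * L.weight κ S x * Real.exp ((κ + η) * L.diam A)) :=
        Finset.sum_le_sum fun A hA => mul_le_mul_of_nonneg_left
          (sum_weight_hull_le H₀ hκ hη hS (Finset.mem_filter.1 hA).2) (norm_nonneg _)
    _ = L.volConst * ((d : ℝ) / (Real.exp 1 * η)) ^ d * Real.exp η *
        Real.exp (2 * (κ + η) * H₀.range L) * L.weight κ S x *
        ∑ A with x ∈ H₀.hull A, ‖V A‖ * Real.exp ((κ + η) * L.diam A) := by
        rw [Finset.mul_sum]
        exact Finset.sum_congr rfl fun A _ => by ring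
    _ ≤ L.volConst * ((d : ℝ) / (Real.exp 1 * η)) ^ d * Real.exp η *
        Real.exp (2 * (κ + η) * H₀.range L) * L.weight κ S x *
        (H₀.w * interNorm L (κ + η) V) := mul_le_mul_of_nonneg_left h (by positivity)
    _ = _ := by
        rw [velocity]
        field_simp

/-- The initial condition of the Lieb-Robinson induction. If `X` misses the hull of `Y` the
commutator vanishes; otherwise a common site has weight `1` and the trivial bound suffices. -/
theorem norm_commutator_heisenberg_ham_le (H₀ : CommutingHamiltonian q) {κ : ℝ} {Y : Finset Λ}
    {B : Op q} (hB : SupportedOn Y B) (t : ℝ) {X : Finset Λ} {O : Op q} (hO : SupportedOn X O) :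
    ‖heisenberg H₀.ham O t * B - B * heisenberg H₀.ham O t‖ ≤
      ‖O‖ * ‖B‖ * (2 * ∑ x ∈ X, L.weight κ (H₀.hull Y) x) := by
  have hs : 0 ≤ ∑ x ∈ X, L.weight κ (H₀.hull Y) x :=
    Finset.sum_nonneg fun x _ => weight_nonneg _ _ x
  by_cases h : Disjoint X (H₀.hull Y)
  · have h1 := supportedOn_hull_heisenberg H₀ (hB.mono (H₀.subset_hull Y))
      (fun j hj => H₀.commute_term_of_notMem_meets hB hj) (-t)
    have h2 := congrArg (fun M => heisenberg H₀.ham M t) (hO.commute h1 h).eq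
    simp only [heisenberg_mul] at h2
    rw [heisenberg_heisenberg, neg_add_cancel, heisenberg_zero_time] at h2
    rw [h2, sub_self, norm_zero]
    positivity
  · obtain ⟨x, hx, hx'⟩ := Finset.not_disjoint_iff.1 h
    have h1 : 1 ≤ ∑ x ∈ X, L.weight κ (H₀.hull Y) x := by
      rw [← weight_eq_one (L := L) (κ := κ) hx']
      exact Finset.single_le_sum (fun x _ => weight_nonneg (L := L) κ (H₀.hull Y) x) hx
    refine (Interaction.norm_commutator_le _ _).trans ?_
    rw [norm_heisenberg H₀.isHermitian_ham]
    nlinarith [mul_nonneg (norm_nonneg O) (norm_nonneg B)]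

/-- The site is a point of `Y` closest to `X`; passing from `Y` to its hull shortens the distance by
at most `l₀`. The minimum with `1` is the trivial commutator bound. -/
theorem exists_mem_norm_commutator_le (H₀ : CommutingHamiltonian q) (V : LocalPerturbation L q k)
    {κ η : ℝ} (hκ : 0 < κ) (hη : 0 < η) {X Y : Finset Λ} (hX : X.Nonempty) (hY : Y.Nonempty)
    {O B : Op q} (hO : SupportedOn X O) (hO1 : ‖O‖ = 1) (hB : SupportedOn Y B) {t : ℝ}
    (ht : 0 ≤ t) : ∃ y ∈ Y,
      ‖heisenberg (blockHam H₀ V.term) O t * B - B * heisenberg (blockHam H₀ V.term) O t‖ ≤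
        ‖B‖ * (2 * min 1 (Real.exp (κ * (velocity L H₀ V.term κ η * t + H₀.range L +
          κ⁻¹ * Real.log X.card - L.distTo X y)))) := by
  obtain ⟨y, hy, hmin⟩ := Finset.exists_min_image Y (fun y => L.distTo X y) hY
  refine ⟨y, hy, ?_⟩
  have hYh : (H₀.hull Y).Nonempty := hY.mono (H₀.subset_hull Y)
  have h1 := lieb_robinson H₀ V ht (weight_nonneg (L := L) κ (H₀.hull Y))
    (sum_norm_mul_sum_weight_le H₀ V.term hκ hη hYh)
    (fun X O hO => norm_commutator_heisenberg_ham_le H₀ hB t hO) hO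
  have h2 := Interaction.norm_commutator_le (heisenberg (blockHam H₀ V.term) O t) B
  rw [norm_heisenberg (isHermitian_blockHam H₀ V), hO1] at h2
  rw [hO1] at h1
  have hcard : (0 : ℝ) < X.card := Nat.cast_pos.2 (Finset.card_pos.2 hX)
  have h3 : ∀ x ∈ X, L.weight κ (H₀.hull Y) x ≤ Real.exp (κ * (H₀.range L - L.distTo X y)) := by
    intro x hx
    obtain ⟨z, hz, hzx⟩ := exists_dist_eq_distTo L hYh x
    obtain ⟨y', hy', hd⟩ := H₀.exists_dist_le_range (L := L) hz
    have h4 := hmin y' hy'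
    have h5 := distTo_le L hx y'
    have h6 := L.connected.dist_triangle (u := x) (v := z) (w := y')
    rw [SimpleGraph.dist_comm (u := x) (v := z), hzx] at h6
    have h7 : (L.distTo X y : ℝ) ≤ L.distTo (H₀.hull Y) x + H₀.range L := by
      exact_mod_cast h4.trans (h5.trans (h6.trans (by omega)))
    rw [LatticeGeometry.weight, Real.exp_le_exp]
    nlinarith
  have h4 : ∑ x ∈ X, L.weight κ (H₀.hull Y) x ≤
      X.card * Real.exp (κ * (H₀.range L - L.distTo X y)) := by
    refine (Finset.sum_le_sum h3).trans_eq ?_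
    rw [Finset.sum_const, nsmul_eq_mul]
  -- The sum over the sites of `X` costs `|X|`, which is absorbed as the shift `κ⁻¹ log |X|` of the
  -- radius.
  have h5 : Real.exp (κ * (velocity L H₀ V.term κ η * t + H₀.range L +
      κ⁻¹ * Real.log X.card - L.distTo X y)) = Real.exp (κ * velocity L H₀ V.term κ η * t) *
      (X.card * Real.exp (κ * (H₀.range L - L.distTo X y))) := by
    rw [← Real.exp_log hcard, ← Real.exp_add, ← Real.exp_add, Real.log_exp]
    congr 1
    field_simp
    ring
  rw [h5]
  rcases min_choice (1 : ℝ) (Real.exp (κ * velocity L H₀ V.term κ η * t) *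
      (X.card * Real.exp (κ * (H₀.range L - L.distTo X y)))) with h | h
  · rw [h]
    linarith
  · rw [h]
    refine h1.trans ?_
    have h6 := mul_le_mul_of_nonneg_left h4 (Real.exp_pos (κ * velocity L H₀ V.term κ η * t)).le
    nlinarith [norm_nonneg B]

/-- Each region is charged to one well-chosen site, so the local strength enters once per site and
no factor for the size of the region appears. -/
theorem sum_le_sum_site_mul {f g : Finset Λ → ℝ} {b : Λ → ℝ} {c : ℝ} (hf : ∀ A, 0 ≤ f A)
    (hb : ∀ y, 0 ≤ b y) (hg0 : g ∅ ≤ 0) (hg : ∀ A : Finset Λ, A.Nonempty → ∃ y ∈ A, g A ≤ f A * b y)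
    (h : ∀ j, ∑ A with j ∈ A, f A ≤ c) : ∑ A, g A ≤ (∑ y, b y) * c := by
  calc ∑ A, g A ≤ ∑ A, ∑ y ∈ A, f A * b y := by
        refine Finset.sum_le_sum fun A _ => ?_
        rcases A.eq_empty_or_nonempty with rfl | hA
        · simpa using hg0
        · obtain ⟨y, hy, hgy⟩ := hg A hA
          exact hgy.trans (Finset.single_le_sum (f := fun y => f A * b y)
            (fun y _ => mul_nonneg (hf A) (hb y)) hy)
    _ = ∑ A, ∑ y, if y ∈ A then f A * b y else 0 :=
        Finset.sum_congr rfl fun A _ => by rw [Finset.sum_ite_mem, Finset.univ_inter]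
    _ = ∑ y, b y * ∑ A with y ∈ A, f A := by
        rw [Finset.sum_comm]
        refine Finset.sum_congr rfl fun y _ => ?_
        rw [Finset.mul_sum, Finset.sum_filter]
        exact Finset.sum_congr rfl fun A _ => by split_ifs <;> ring
    _ ≤ ∑ y, b y * c := Finset.sum_le_sum fun y _ => mul_le_mul_of_nonneg_left (h y) (hb y)
    _ = _ := (Finset.sum_mul _ _ _).symm

/-- Lieb-Robinson bound on the commutator of an evolved local observable with an interaction. -/
theorem norm_commutator_total_le (H₀ : CommutingHamiltonian q) (V : LocalPerturbation L q k)
    {κ η : ℝ} (hκ : 0 < κ) (hη : 0 < η) {X : Finset Λ} (hX : X.Nonempty)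
    {O : Op q} (hO : SupportedOn X O) (hO1 : ‖O‖ = 1) {Φ : Interaction q} (hΦ : Φ.IsLocal) {t : ℝ}
    (ht : 0 ≤ t) :
    ‖heisenberg (blockHam H₀ V.term) O t * Φ.total -
        Φ.total * heisenberg (blockHam H₀ V.term) O t‖ ≤
      pTilde L H₀ X κ (velocity L H₀ V.term κ η * t) * starNorm L Φ := by
  have hv := velocity_nonneg (L := L) H₀ V.term hκ hη
  have hlog : 0 ≤ Real.log X.card := Real.log_natCast_nonneg _
  have hρ : 0 ≤ velocity L H₀ V.term κ η * t + H₀.range L + κ⁻¹ * Real.log X.card := by positivity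
  have hp := sum_min_one_exp_le L hκ hX hρ
  rw [show (L.radius X : ℝ) + (velocity L H₀ V.term κ η * t + H₀.range L +
    κ⁻¹ * Real.log X.card) = velocity L H₀ V.term κ η * t + L.radius X + H₀.range L +
    κ⁻¹ * Real.log X.card by ring] at hp
  rw [Interaction.total, Finset.sum_mul, Finset.mul_sum, ← Finset.sum_sub_distrib]
  refine (norm_sum_le _ _).trans ((sum_le_sum_site_mul (fun A => norm_nonneg (Φ A))
    (fun y => ?_) ?_ (fun A hA => exists_mem_norm_commutator_le H₀ V hκ hη hX hA hO hO1 (hΦ A) ht)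
    (sum_le_starNorm L Φ)).trans (mul_le_mul_of_nonneg_right hp (starNorm_nonneg L Φ)))
  · exact mul_nonneg two_pos.le (le_min zero_le_one (Real.exp_pos _).le)
  -- The empty region has no site to be charged to, but its term is a scalar.
  · have h := (supportedOn_univ (heisenberg (blockHam H₀ V.term) O t)).commute (hΦ ∅)
      (Finset.disjoint_empty_right _)
    rw [h.eq, sub_self, norm_zero]

/-- The commutator of a local observable with an interaction. -/
theorem norm_commutator_total_le_card {X : Finset Λ} {O : Op q} (hO : SupportedOn X O)
    (hO1 : ‖O‖ = 1) {Φ : Interaction q} (hΦ : Φ.IsLocal) :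
    ‖Φ.total * O - O * Φ.total‖ ≤ 2 * X.card * starNorm L Φ := by
  rw [Interaction.total, Finset.sum_mul, Finset.mul_sum, ← Finset.sum_sub_distrib]
  calc ‖∑ A, (Φ A * O - O * Φ A)‖ ≤ ∑ A, ‖Φ A * O - O * Φ A‖ := norm_sum_le _ _
    _ ≤ ∑ A with (A ∩ X).Nonempty, 2 * ‖Φ A‖ := by
        rw [Finset.sum_filter]
        refine Finset.sum_le_sum fun A _ => ?_
        split_ifs with h
        · simpa [hO1] using Interaction.norm_commutator_le (Φ A) O
        · have hd : Disjoint A X := Finset.disjoint_iff_inter_eq_empty.2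
            (Finset.not_nonempty_iff_eq_empty.1 h)
          rw [((hΦ A).commute hO hd).eq, sub_self, norm_zero]
    _ = 2 * ∑ A with (A ∩ X).Nonempty, ‖Φ A‖ := (Finset.mul_sum _ _ _).symm
    _ ≤ 2 * (X.card * starNorm L Φ) := mul_le_mul_of_nonneg_left
        (sum_inter_nonempty_le (fun A => norm_nonneg (Φ A)) (sum_le_starNorm L Φ) X) two_pos.le
    _ = _ := by ring

end Velocity

/-! ### Assembly of the error bound -/

section ErrorBound

variable {Λ : Type*} [Fintype Λ] [DecidableEq Λ] {q : Λ → ℕ} {d k : ℕ}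
  {L : LatticeGeometry d Λ}

theorem heisenberg_conj (G H O : Op q) (s t : ℝ) :
    heisenberg G (heisenberg H O t) s =
      heisenberg (heisenberg G H s) (heisenberg G O s) t := by
  have h : ∀ M : Op q, heisenberg G (NormedSpace.exp M) s = NormedSpace.exp (heisenberg G M s) :=
    fun M => (Matrix.exp_units_conj ⟨NormedSpace.exp ((Complex.I * (s : ℂ)) • G),
      NormedSpace.exp (-(Complex.I * (s : ℂ)) • G), exp_smul_mul_exp_neg_smul _ _,
      exp_neg_smul_mul_exp_smul _ _⟩ M).symm
  conv_lhs => rw [heisenberg.eq_def H]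
  rw [heisenberg_mul, heisenberg_mul, h, h, heisenberg_smul, heisenberg_smul]
  rfl

/-- `H₀` vanishes on both sides of `P`, and each `𝓓_A(V_A)` compresses to `P V_A P`; in particular
`H₁` commutes with `P`. -/
theorem P_mul_blockHam (H₀ : CommutingHamiltonian q) (V : LocalPerturbation L q k) :
    H₀.P * blockHam H₀ V.term = H₀.P * (H₀.ham + V.term.total) * H₀.P ∧
      blockHam H₀ V.term * H₀.P = H₀.P * (H₀.ham + V.term.total) * H₀.P := by
  have h1 : H₀.ham * H₀.P = 0 := by
    rw [CommutingHamiltonian.ham, Finset.sum_mul]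
    exact Finset.sum_eq_zero fun j _ => H₀.term_mul_P j
  rw [blockHam, Interaction.total, mul_add, add_mul, mul_add, add_mul, H₀.P_mul_ham, h1, zero_mul,
    zero_add, zero_add, zero_add, Finset.mul_sum, Finset.sum_mul, Finset.mul_sum, Finset.sum_mul]
  exact ⟨Finset.sum_congr rfl fun A _ => (H₀.P_mul_localDiag (V.supportedOn_term A)).1,
    Finset.sum_congr rfl fun A _ => (H₀.P_mul_localDiag (V.supportedOn_term A)).2⟩

/-- On the zero-energy space, the constrained dynamics is the block-diagonal dynamics. -/
theorem P_mul_heisenberg_mul_P (H₀ : CommutingHamiltonian q) (V : LocalPerturbation L q k)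
    (O : Op q) (t : ℝ) :
    H₀.P * heisenberg (H₀.P * (H₀.ham + V.term.total) * H₀.P) O t * H₀.P =
      H₀.P * heisenberg (blockHam H₀ V.term) O t * H₀.P := by
  obtain ⟨h1, h2⟩ := P_mul_blockHam H₀ V
  have hP := H₀.P_mul_self
  let _ : NormedAlgebra ℚ (Op q) := NormedAlgebra.restrictScalars ℚ ℂ (Op q)
  generalize H₀.ham + V.term.total = H at h1 h2 ⊢
  have h3 : H₀.P * (H₀.P * H * H₀.P) = H₀.P * H * H₀.P := by rw [← mul_assoc, ← mul_assoc, hP]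
  have h4 : H₀.P * H * H₀.P * H₀.P = H₀.P * H * H₀.P := by rw [mul_assoc, hP]
  generalize H₀.P * H * H₀.P = HP at h1 h2 h3 h4 ⊢
  have e1 : ∀ c : ℂ, H₀.P * NormedSpace.exp (c • HP) =
      H₀.P * NormedSpace.exp (c • blockHam H₀ V.term) := by
    intro c
    have s1 : SemiconjBy H₀.P (c • blockHam H₀ V.term) (c • HP) := by
      rw [SemiconjBy, mul_smul_comm, smul_mul_assoc, h1, h4]
    have s2 : SemiconjBy H₀.P (c • HP) (c • HP) := by
      rw [SemiconjBy, mul_smul_comm, smul_mul_assoc, h3, h4]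
    have r1 := s1.exp_right
    have r2 := s2.exp_right
    exact r2.eq.trans r1.eq.symm
  have e2 : ∀ c : ℂ, NormedSpace.exp (c • HP) * H₀.P =
      NormedSpace.exp (c • blockHam H₀ V.term) * H₀.P := by
    intro c
    have s1 : SemiconjBy H₀.P (c • HP) (c • blockHam H₀ V.term) := by
      rw [SemiconjBy, mul_smul_comm, smul_mul_assoc, h2, h3]
    have s2 : SemiconjBy H₀.P (c • HP) (c • HP) := by
      rw [SemiconjBy, mul_smul_comm, smul_mul_assoc, h3, h4]
    have r1 := s1.exp_right
    have r2 := s2.exp_right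
    exact r2.eq.symm.trans r1.eq
  rw [heisenberg, heisenberg, ← mul_assoc, ← mul_assoc, e1, mul_assoc, e2]
  simp only [mul_assoc]

theorem swError_le_norm_sub (H₀ : CommutingHamiltonian q) (V : LocalPerturbation L q k)
    (O : Op q) (t : ℝ) : swError H₀ V.term O t ≤
      ‖heisenberg (H₀.ham + V.term.total) O t - heisenberg (blockHam H₀ V.term) O t‖ := by
  have hP : ‖H₀.P‖ ≤ 1 := norm_le_one_of_isHermitian_of_mul_self H₀.isHermitian_P H₀.P_mul_self
  rw [swError, mul_sub, sub_mul, P_mul_heisenberg_mul_P, ← sub_mul, ← mul_sub]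
  generalize heisenberg (H₀.ham + V.term.total) O t - heisenberg (blockHam H₀ V.term) O t = M
  calc ‖H₀.P * M * H₀.P‖ ≤ ‖H₀.P‖ * ‖M‖ * ‖H₀.P‖ :=
        (norm_mul_le _ _).trans (mul_le_mul_of_nonneg_right (norm_mul_le _ _) (norm_nonneg _))
    _ ≤ 1 * ‖M‖ * 1 := by gcongr
    _ = ‖M‖ := by ring

/-- The generator of a Schrieffer-Wolff transformation, its block-diagonal part and the residual
control the difference of the dynamics. -/
theorem norm_heisenberg_sub_le_of_conj {G H H₁ W : Op q} (hG : G.IsHermitian)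
    (hH₁ : H₁.IsHermitian) (hW : W.IsHermitian) (hconj : heisenberg G H 1 = H₁ + W) (O : Op q)
    {β β' : ℝ → ℝ} (hβ0 : β 0 = 0) (hβ : ∀ s, HasDerivAt β (β' s) s) {t : ℝ} (ht : 0 ≤ t)
    (h : ∀ s ∈ Set.Ico 0 t, ‖heisenberg H₁ O s * W - W * heisenberg H₁ O s‖ ≤ β' s) :
    ‖heisenberg H O t - heisenberg H₁ O t‖ ≤ ‖G * O - O * G‖ +
      ‖G * heisenberg H₁ O t - heisenberg H₁ O t * G‖ + β t := by
  have h1 := norm_heisenberg_sub_le hG O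
  have h2 := norm_heisenberg_sub_le hG (heisenberg H₁ O t)
  have h3 := norm_heisenberg_sub_heisenberg_le hH₁ hW O hβ0 hβ ht h
  have h4 : ‖heisenberg (H₁ + W) (heisenberg G O 1) t - heisenberg (H₁ + W) O t‖ =
      ‖heisenberg G O 1 - O‖ := by
    rw [← heisenberg_sub, norm_heisenberg (hH₁.add hW)]
  rw [norm_sub_rev] at h2
  -- The difference is rotated by the isometric conjugation with `G`, which turns `H` into `H₁ + W`.
  -- The three pieces are the dressing of `O`, the effect of `W`, and the dressing of the evolved
  -- `O`.
  calc ‖heisenberg H O t - heisenberg H₁ O t‖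
      = ‖heisenberg G (heisenberg H O t) 1 - heisenberg G (heisenberg H₁ O t) 1‖ := by
        rw [← heisenberg_sub, norm_heisenberg hG]
    _ = ‖(heisenberg (H₁ + W) (heisenberg G O 1) t - heisenberg (H₁ + W) O t) +
          (heisenberg (H₁ + W) O t - heisenberg H₁ O t) +
          (heisenberg H₁ O t - heisenberg G (heisenberg H₁ O t) 1)‖ := by
        rw [heisenberg_conj G H, hconj]
        congr 1
        abel
    _ ≤ _ := (norm_add₃_le).trans (by linarith)

theorem isHermitian_neg_I_smul_swGen (H₀ : CommutingHamiltonian q) (V : LocalPerturbation L q k)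
    {Δ : ℝ} (hgap : H₀.HasGap Δ) : ((-Complex.I) • (swGen H₀ V.term).total).IsHermitian := by
  have h : (swGen H₀ V.term).total.conjTranspose = -(swGen H₀ V.term).total := by
    rw [total_swGen, Matrix.conjTranspose_sum, ← Finset.sum_neg_distrib]
    exact Finset.sum_congr rfl fun A _ => H₀.conjTranspose_localGen hgap (V.isHermitian_term A)
  rw [Matrix.IsHermitian, Matrix.conjTranspose_smul, h]
  simp

/-- The anti-Hermitian `T` becomes the Hermitian generator `-iT`, so conjugation by `e^T` is a
Heisenberg evolution for unit time. -/
theorem heisenberg_neg_I_smul (T M : Op q) : heisenberg ((-Complex.I) • T) M 1 =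
    NormedSpace.exp T * M * NormedSpace.exp (-T) := by
  simp [heisenberg, smul_smul]

theorem norm_commutator_neg_I_smul (T M : Op q) :
    ‖((-Complex.I) • T) * M - M * ((-Complex.I) • T)‖ = ‖T * M - M * T‖ := by
  rw [smul_mul_assoc, mul_smul_comm, ← smul_sub, norm_smul]
  simp

theorem LocalPerturbation.isHermitian_total (V : LocalPerturbation L q k) :
    (V.term.total).IsHermitian := by
  rw [Interaction.total, Matrix.IsHermitian, Matrix.conjTranspose_sum]
  exact Finset.sum_congr rfl fun A _ => V.isHermitian_term A

/-- By the exact identity the residual is a difference of two Hermitian operators, so its series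
need not be examined. -/
theorem isHermitian_total_residualInter (H₀ : CommutingHamiltonian q)
    (V : LocalPerturbation L q k) {Δ : ℝ} (hgap : H₀.HasGap Δ) :
    ((residualInter H₀ V.term).total).IsHermitian := by
  rw [← add_sub_cancel_left (blockHam H₀ V.term) (residualInter H₀ V.term).total,
    ← exp_swGen_conj H₀ V hgap, ← heisenberg_neg_I_smul]
  exact (isHermitian_heisenberg (isHermitian_neg_I_smul_swGen H₀ V hgap)
    (H₀.isHermitian_ham.add V.isHermitian_total) 1).sub (isHermitian_blockHam H₀ V)

theorem exists_pTilde_eq_eval (L : LatticeGeometry d Λ) (H₀ : CommutingHamiltonian q)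
    (X : Finset Λ) {κ : ℝ} (hκ : 0 < κ) : ∃ p : ℝ[X], p ≠ 0 ∧ p.natDegree = d ∧
      ∀ r, pTilde L H₀ X κ r = p.eval r := by
  obtain ⟨p, hp0, hp, h⟩ := exists_pKappa_eq_eval (ballPoly_ne_zero L) hκ
  refine ⟨p.comp (Polynomial.X + C (L.radius X + H₀.range L + κ⁻¹ * Real.log X.card)), ?_, ?_,
    fun r => ?_⟩
  · rw [← leadingCoeff_ne_zero, leadingCoeff_comp (by rw [natDegree_X_add_C]; exact one_ne_zero),
      leadingCoeff_X_add_C, one_pow, mul_one]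
    exact leadingCoeff_ne_zero.2 hp0
  · rw [natDegree_comp, natDegree_X_add_C, mul_one, hp, L.natDegree_ballPoly]
  · rw [pTilde, h, eval_comp]
    simp only [eval_add, eval_X, eval_C]
    congr 1
    ring

theorem exists_PTilde_eq_eval (L : LatticeGeometry d Λ) (H₀ : CommutingHamiltonian q)
    (X : Finset Λ) {κ : ℝ} (hκ : 0 < κ) : ∃ p : ℝ[X], p.natDegree = d + 1 ∧
      ∀ r, PTilde L H₀ X κ r = p.eval r := by
  obtain ⟨p, hp0, hp, h⟩ := exists_pTilde_eq_eval L H₀ X hκ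
  obtain ⟨P, hP, hP'⟩ := exists_integral_eq_eval hp0
  refine ⟨P, hP.trans (by rw [hp]), fun r => ?_⟩
  rw [PTilde, ← hP']
  simp only [h]

theorem pTilde_nonneg (L : LatticeGeometry d Λ) (H₀ : CommutingHamiltonian q) (X : Finset Λ)
    {κ : ℝ} (hκ : 0 < κ) {r : ℝ} (hr : 0 ≤ r) : 0 ≤ pTilde L H₀ X κ r := by
  have hlog : 0 ≤ Real.log X.card := Real.log_natCast_nonneg _
  exact pKappa_nonneg L hκ (by positivity)

theorem PTilde_nonneg (L : LatticeGeometry d Λ) (H₀ : CommutingHamiltonian q) (X : Finset Λ)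
    {κ : ℝ} (hκ : 0 < κ) {r : ℝ} (hr : 0 ≤ r) : 0 ≤ PTilde L H₀ X κ r :=
  intervalIntegral.integral_nonneg hr fun _ hs => pTilde_nonneg L H₀ X hκ hs.1

theorem continuous_pTilde (L : LatticeGeometry d Λ) (H₀ : CommutingHamiltonian q) (X : Finset Λ)
    {κ : ℝ} (hκ : 0 < κ) : Continuous (pTilde L H₀ X κ) := by
  obtain ⟨p, -, -, h⟩ := exists_pTilde_eq_eval L H₀ X hκ
  rw [funext h]
  exact p.continuous

/-- The perturbation vanishes if its Lieb-Robinson velocity does. -/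
theorem starNorm_eq_zero_of_velocity_eq_zero (H₀ : CommutingHamiltonian q) (V : Interaction q)
    {κ η : ℝ} (hκ : 0 < κ) (hη : 0 < η) (h : velocity L H₀ V κ η = 0) : starNorm L V = 0 := by
  obtain ⟨x⟩ := L.connected.nonempty
  have hw : (0 : ℝ) < H₀.w := Nat.cast_pos.2 (H₀.one_le_w x)
  have hC : 0 < L.volConst := zero_lt_one.trans_le one_le_volConst
  have hd : 0 < ((d : ℝ) / (Real.exp 1 * η)) ^ d := by
    rcases Nat.eq_zero_or_pos d with rfl | hd
    · simp
    · have : (0 : ℝ) < d := Nat.cast_pos.2 hd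
      positivity
  have hi : interNorm L (κ + η) V = 0 := by
    rw [velocity] at h
    exact (mul_eq_zero.1 h).resolve_left (by positivity)
  refine le_antisymm (starNorm_le fun j => ?_) (starNorm_nonneg L V)
  rw [← hi]
  refine le_trans (Finset.sum_le_sum fun A _ => ?_) (sum_le_interNorm L V (κ + η) j)
  exact le_mul_of_one_le_right (norm_nonneg _) (Real.one_le_exp (by positivity))

theorem starNorm_residualInter_eq_zero (H₀ : CommutingHamiltonian q)
    (V : LocalPerturbation L q k) {Δ : ℝ} (hgap : H₀.HasGap Δ) (h : starNorm L V.term = 0) :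
    starNorm L (residualInter H₀ V.term) = 0 := by
  have h1 := starNorm_residualInter_le H₀ V hgap rfl (by rw [h, mul_zero]; exact hgap.1.le)
  rw [h] at h1
  exact le_antisymm (by simpa using h1) (starNorm_nonneg L _)

theorem swError_le (H₀ : CommutingHamiltonian q) (V : LocalPerturbation L q k) {Δ κ η : ℝ}
    (hgap : H₀.HasGap Δ) (hκ : 0 < κ) (hη : 0 < η) {X : Finset Λ} (hX : X.Nonempty) {O : Op q}
    (hO : SupportedOn X O) (hO1 : ‖O‖ = 1) {t : ℝ} (ht : 0 ≤ t) :
    swError H₀ V.term O t ≤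
      (2 * X.card + pTilde L H₀ X κ (velocity L H₀ V.term κ η * t)) *
          starNorm L (swGen H₀ V.term) +
        (velocity L H₀ V.term κ η)⁻¹ * PTilde L H₀ X κ (velocity L H₀ V.term κ η * t) *
          starNorm L (residualInter H₀ V.term) := by
  obtain ⟨v, hv⟩ : ∃ v, v = velocity L H₀ V.term κ η := ⟨_, rfl⟩
  obtain ⟨c, hc⟩ : ∃ c, c = starNorm L (residualInter H₀ V.term) := ⟨_, rfl⟩
  have hcont : Continuous fun s => pTilde L H₀ X κ (v * s) :=
    (continuous_pTilde L H₀ X hκ).comp (continuous_const.mul continuous_id)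
  have h1 := norm_heisenberg_sub_le_of_conj (isHermitian_neg_I_smul_swGen H₀ V hgap)
    (isHermitian_blockHam H₀ V) (isHermitian_total_residualInter H₀ V hgap)
    ((heisenberg_neg_I_smul _ _).trans (exp_swGen_conj H₀ V hgap)) O
    (β := fun s => (∫ r in (0 : ℝ)..s, pTilde L H₀ X κ (v * r)) * c)
    (β' := fun s => pTilde L H₀ X κ (v * s) * c) (by simp)
    (fun s => (hcont.integral_hasStrictDerivAt 0 s).hasDerivAt.mul_const c) ht (fun s hs => by
      rw [hv, hc]
      exact norm_commutator_total_le H₀ V hκ hη hX hO hO1 (isLocal_residualInter H₀ V hgap) hs.1)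
  rw [norm_commutator_neg_I_smul, norm_commutator_neg_I_smul] at h1
  have h2 := norm_commutator_total_le_card (L := L) hO hO1 (isLocal_swGen H₀ V hgap)
  have h3 := norm_commutator_total_le H₀ V hκ hη hX hO hO1 (isLocal_swGen H₀ V hgap) ht
  rw [norm_sub_rev] at h3
  have h4 : (∫ r in (0 : ℝ)..t, pTilde L H₀ X κ (v * r)) * c =
      v⁻¹ * PTilde L H₀ X κ (v * t) * c := by
    -- For `v = 0` the perturbation and hence the residual vanish, so the convention `0⁻¹ = 0` is
    -- harmless; otherwise this is a change of variables.
    rcases eq_or_ne v 0 with h0 | h0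
    · have hc0 : c = 0 := hc.trans (starNorm_residualInter_eq_zero H₀ V hgap
        (starNorm_eq_zero_of_velocity_eq_zero H₀ V.term hκ hη (hv.symm.trans h0)))
      rw [hc0, mul_zero, mul_zero]
    · rw [intervalIntegral.integral_comp_mul_left _ h0, mul_zero, smul_eq_mul, PTilde]
  rw [h4] at h1
  rw [← hv, ← hc] at *
  have h5 := (swError_le_norm_sub H₀ V O t).trans h1
  rw [add_mul]
  linarith

theorem swError_le_of_gap (H₀ : CommutingHamiltonian q) (V : LocalPerturbation L q k)
    {Δ κ η K : ℝ} (hK : K = 8 * H₀.u k * H₀.w * (1 + H₀.w) + 4 * H₀.u k * H₀.w)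
    (hgap : H₀.HasGap Δ) (hVΔ : K * starNorm L V.term ≤ Δ) (hκ : 0 < κ) (hη : 0 < η)
    {X : Finset Λ} (hX : X.Nonempty) {O : Op q}
    (hO : SupportedOn X O) (hO1 : ‖O‖ = 1) {t : ℝ} (ht : 0 ≤ t) :
    swError H₀ V.term O t ≤ starNorm L V.term / Δ * H₀.w *
      (2 * X.card + pTilde L H₀ X κ (velocity L H₀ V.term κ η * t) +
        4 * H₀.u k * (velocity L H₀ V.term κ η)⁻¹ * starNorm L V.term *
          PTilde L H₀ X κ (velocity L H₀ V.term κ η * t) *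
          (1 + K * (starNorm L V.term / Δ))) := by
  have hv := velocity_nonneg (L := L) H₀ V.term hκ hη
  have hp := pTilde_nonneg L H₀ X hκ (mul_nonneg hv ht)
  have hP := PTilde_nonneg L H₀ X hκ (mul_nonneg hv ht)
  refine (swError_le H₀ V hgap hκ hη hX hO hO1 ht).trans ((add_le_add
    (mul_le_mul_of_nonneg_left (starNorm_swGen_le H₀ V hgap) (by positivity))
    (mul_le_mul_of_nonneg_left (starNorm_residualInter_le H₀ V hgap hK hVΔ)
      (by positivity))).trans_eq ?_)
  ring

/-- Only an upper bound on the degree is needed, so `v = 0` requires no separate treatment. -/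
theorem isBigO_error_bound (L : LatticeGeometry d Λ) (H₀ : CommutingHamiltonian q)
    (X : Finset Λ) {κ : ℝ} (hκ : 0 < κ) (a b c v : ℝ) :
    (fun t : ℝ => a * (c + pTilde L H₀ X κ (v * t) + b * PTilde L H₀ X κ (v * t)))
      =O[Filter.atTop] (fun t : ℝ => t ^ (d + 1)) := by
  obtain ⟨p, -, hp, h⟩ := exists_pTilde_eq_eval L H₀ X hκ
  obtain ⟨P, hP, H⟩ := exists_PTilde_eq_eval L H₀ X hκ
  have hdeg : ∀ Q : ℝ[X], Q.natDegree ≤ d + 1 →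
      (Q.comp (C v * Polynomial.X)).natDegree ≤ d + 1 := fun Q hQ =>
    natDegree_comp_le.trans ((Nat.mul_le_mul hQ
      ((natDegree_C_mul_le v _).trans natDegree_X_le)).trans (mul_one _).le)
  have hb := Polynomial.isBigO_atTop_of_degree_le
    (C a * (C c + p.comp (C v * Polynomial.X) + C b * P.comp (C v * Polynomial.X)))
    (Polynomial.X ^ (d + 1)) (by
      rw [degree_X_pow]
      refine degree_le_of_natDegree_le ?_
      refine (natDegree_C_mul_le _ _).trans (natDegree_add_le_of_degree_le
        (natDegree_add_le_of_degree_le ?_ (hdeg p (by omega)))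
        ((natDegree_C_mul_le _ _).trans (hdeg P (by omega))))
      rw [natDegree_C]
      exact Nat.zero_le _)
  refine (hb.congr_left fun t => ?_).congr_right fun t => ?_
  · simp [h, H]
  · simp

end ErrorBound

end LocalSW

/-! ### The theorem with an explicit constant -/

theorem mainTheorem3 (w u : ℕ) :
    ∃ K : ℝ, 0 ≤ K ∧
      ∀ (d k : ℕ) (Λ : Type*) [Fintype Λ] [DecidableEq Λ] (q : Λ → ℕ)
        (L : LatticeGeometry d Λ) (H₀ : CommutingHamiltonian q) (V : LocalPerturbation L q k)
        (Δ₀ : ℝ) (X : Finset Λ) (O : Op q) (κ η : ℝ),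
        H₀.w = w → H₀.u k = u → H₀.HasGap Δ₀ →
        X.Nonempty → SupportedOn X O → O.IsHermitian → ‖O‖ = 1 → 0 < κ → 0 < η →
        -- the local Schrieffer-Wolff transformation
        NormedSpace.exp (swGen H₀ V.term).total * (H₀.ham + V.term.total) *
            NormedSpace.exp (-(swGen H₀ V.term).total) =
          blockHam H₀ V.term + (residualInter H₀ V.term).total ∧
        -- the strength of its generator
        starNorm L (swGen H₀ V.term) ≤ w * starNorm L V.term / Δ₀ ∧
        -- the error bound
        (∀ t : ℝ, 0 ≤ t →
          swError H₀ V.term O t ≤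
            (2 * X.card + pTilde L H₀ X κ (velocity L H₀ V.term κ η * t)) *
                starNorm L (swGen H₀ V.term) +
              (velocity L H₀ V.term κ η)⁻¹ * PTilde L H₀ X κ (velocity L H₀ V.term κ η * t) *
                starNorm L (residualInter H₀ V.term)) ∧
        -- the asymptotic forms for a large gap
        (K * starNorm L V.term ≤ Δ₀ →
          starNorm L (residualInter H₀ V.term) ≤
            4 * w * u * starNorm L V.term ^ 2 / Δ₀ * (1 + K * (starNorm L V.term / Δ₀)) ∧
          ∀ t : ℝ, 0 ≤ t →
            swError H₀ V.term O t ≤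
              starNorm L V.term / Δ₀ * w *
                (2 * X.card + pTilde L H₀ X κ (velocity L H₀ V.term κ η * t) +
                  4 * u * (velocity L H₀ V.term κ η)⁻¹ * starNorm L V.term *
                    PTilde L H₀ X κ (velocity L H₀ V.term κ η * t) *
                    (1 + K * (starNorm L V.term / Δ₀)))) ∧
        -- the growth in time
        (∃ p : ℝ[X], p.natDegree = d ∧ ∀ r, pTilde L H₀ X κ r = p.eval r) ∧
        (∃ p : ℝ[X], p.natDegree = d + 1 ∧ ∀ r, PTilde L H₀ X κ r = p.eval r) ∧
        (fun t : ℝ => starNorm L V.term / Δ₀ * w *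
            (2 * X.card + pTilde L H₀ X κ (velocity L H₀ V.term κ η * t) +
              4 * u * (velocity L H₀ V.term κ η)⁻¹ * starNorm L V.term *
                PTilde L H₀ X κ (velocity L H₀ V.term κ η * t)))
          =O[Filter.atTop] (fun t : ℝ => t ^ (d + 1)) := by
  -- The summand `4uw` makes the commutator series converge with ratio at most `1/2`, and `8uw(1+w)`
  -- bounds its tail relative to the leading term.
  refine ⟨8 * u * w * (1 + w) + 4 * u * w, by positivity, ?_⟩
  intro d k Λ _ _ q L H₀ V Δ₀ X O κ η hw hu hgap hX hO _ hO1 hκ hη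
  subst hw hu
  refine ⟨exp_swGen_conj H₀ V hgap, starNorm_swGen_le H₀ V hgap,
    fun t ht => swError_le H₀ V hgap hκ hη hX hO hO1 ht,
    fun hVΔ => ⟨starNorm_residualInter_le H₀ V hgap rfl hVΔ,
      fun t ht => swError_le_of_gap H₀ V rfl hgap hVΔ hκ hη hX hO hO1 ht⟩, ?_,
    exists_PTilde_eq_eval L H₀ X hκ, isBigO_error_bound L H₀ X hκ _ _ _ _⟩
  obtain ⟨p, -, hp⟩ := exists_pTilde_eq_eval L H₀ X hκ
  exact ⟨p, hp⟩
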